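/- A \emph{rank-1 symmetric space} means a metric space isometric, up to a constant rescaling of the metric, to real, complex or quaternionic hyperbolic space $\mathbb{H}^n_{\mathbb{R}}$, $\mathbb{H}^n_{\mathbb{C}}$, $\mathbb{H}^n_{\mathbb{H}}$ with $n\ge 2$, or to the Cayley hyperbolic plane $\mathbb{H}^2_{\mathbf{Ca}}$. An \emph{ideal graph of spaces} is a space $Z$ obtained from a finite connected graph by taking, for each vertex, either a point or a closed manifold whose universal cover is a rank-1 symmetric space and, for each edge, a unit interval whose two ends are glued to points of the corresponding vertex spaces; $Z$ carries the induced length metric. An \emph{ideal model geometry} is a proper geodesic metric space $X$ isometric to the universal cover $\tilde Z$ of an ideal graph of spaces $Z$; equivalently, $X$ is a tree of spaces whose vertex spaces are points and rank-1 symmetric spaces and whose edges are unit intervals, with the gluing metric, and some group of isometries preserving this decomposition acts on $X$ freely, properly and cocompactly. Equip $\operatorname{Isom}(X)$ with the compact-open topology (equivalently, that of pointwise convergence). A \emph{uniform lattice} of $\operatorname{Isom}(X)$ is a discrete subgroup $\Gamma$ with $\operatorname{Isom}(X)/\Gamma$ compact. \textbf{Theorem.} Let $X$ be an ideal model geometry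 that is neither a rank-1 symmetric space nor isometric to the real line $\mathbb{R}$. Let $\Gamma$ and $\Gamma'$ be uniform lattices of $\operatorname{Isom}(X)$. If $\Gamma$ and $\Gamma'$ are residually finite, then they are weakly commensurable in $\operatorname{Isom}(X)$: there is $g\in\operatorname{Isom}(X)$ such that $g\Gamma g^{-1}\cap\Gamma'$ has finite index in both $g\Gamma g^{-1}$ and $\Gamma'$. -/

import Mathlib

/-! ### Rank-one symmetric spaces of noncompact type -/

/-- The Cayley octonions, as the Cayley–Dickson double of Hamilton's quaternions. -/
@[ext]
structure Octonion where
  fst : Quaternion ℝ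
  snd : Quaternion ℝ

namespace Octonion

/-- Cayley–Dickson multiplication `(a, b)(c, d) = (ac - d̄b, da + bc̄)`. -/
noncomputable instance : Mul Octonion :=
  ⟨fun p q => ⟨p.fst * q.fst - star q.snd * p.snd, q.snd * p.fst + p.snd * star q.fst⟩⟩

/-- Octonionic conjugation `(a, b) ↦ (ā, -b)`. -/
noncomputable instance : Star Octonion := ⟨fun p => ⟨star p.fst, -p.snd⟩⟩

/-- The real part of an octonion. -/
def re (p : Octonion) : ℝ := p.fst.re

end Octonion

section Hyperbolic

variable {F : Type*} [Mul F] [Star F]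

/-- The squared Euclidean norm `∑ᵢ |xᵢ|²` of a vector in `Fⁿ`, where `re` is the real part on `F`. -/
def normSqOver (re : F → ℝ) {n : ℕ} (x : Fin n → F) : ℝ :=
  ∑ i, re (x i * star (x i))

/-- For `X = (x, 1)` and `Y = (y, 1)` in `Fⁿ⁺¹` with the form `Φ = diag(1, …, 1, -1)`, this is
`Re tr ((X X* Φ) (Y Y* Φ))`. For associative `F` it is the squared modulus
`|⟨X, Y⟩|² = |1 - ∑ᵢ ȳᵢ xᵢ|²` of the Hermitian form; for the octonions and `n = 2` it is the
trace form of the exceptional Jordan algebra. -/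
def pairingSqOver (re : F → ℝ) {n : ℕ} (x y : Fin n → F) : ℝ :=
  1 - 2 * ∑ i, re (star (y i) * x i) +
    ∑ i, ∑ j, re ((x i * star (x j)) * (y j * star (y i)))

/-- `S` is isometric, up to a constant rescaling of the metric, to the `F`-hyperbolic space
`ℍⁿ_F`, in the projective ball model: the points are the `x ∈ Fⁿ` with `|x| < 1`, and
`cosh² d(x, y) = |⟨X, Y⟩|² / (⟨X, X⟩ ⟨Y, Y⟩)` with `X = (x, 1)`, `Y = (y, 1)`. -/
def IsHyperbolicSpaceOver (re : F → ℝ) (n : ℕ) (S : Type*) [MetricSpace S] : Prop :=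
  ∃ (c : ℝ) (f : S → Fin n → F), 0 < c ∧ Function.Injective f ∧
    Set.range f = {x | normSqOver re x < 1} ∧
    ∀ s t, Real.cosh (dist s t / c) ^ 2 =
      pairingSqOver re (f s) (f t) /
        ((1 - normSqOver re (f s)) * (1 - normSqOver re (f t)))

end Hyperbolic

/-- `S` is a rank-one symmetric space of noncompact type, with any normalization of its metric:
real, complex or quaternionic hyperbolic space of dimension `n ≥ 2` over the respective algebra,
or the Cayley hyperbolic plane. -/
def IsRankOneSymmetricSpace (S : Type*) [MetricSpace S] : Prop :=
  (∃ n ≥ 2, IsHyperbolicSpaceOver (fun a : ℝ => a) n S) ∨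
  (∃ n ≥ 2, IsHyperbolicSpaceOver (fun a : ℂ => a.re) n S) ∨
  (∃ n ≥ 2, IsHyperbolicSpaceOver (fun a : Quaternion ℝ => a.re) n S) ∨
  IsHyperbolicSpaceOver Octonion.re 2 S

/-! ### Isometry groups, lattices, commensurability -/

section Isometries

variable {X : Type*} [MetricSpace X]

/-- The topology of pointwise convergence on `Isom(X)`; on isometries of a metric space it is the
compact-open topology. -/
instance isomTopology : TopologicalSpace (X ≃ᵢ X) :=
  TopologicalSpace.induced (fun g x => g x) (inferInstanceAs (TopologicalSpace (X → X)))

/-- A uniform lattice of `Isom(X)`: a discrete subgroup with compact quotient. -/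
def IsUniformLattice (Γ : Subgroup (X ≃ᵢ X)) : Prop :=
  DiscreteTopology Γ ∧ CompactSpace ((X ≃ᵢ X) ⧸ Γ)

/-- `Γ` acts properly (in the sense of discrete groups) and cocompactly on `X`. -/
def ActsGeometrically (Γ : Subgroup (X ≃ᵢ X)) : Prop :=
  (∀ K : Set X, IsCompact K → {g : X ≃ᵢ X | g ∈ Γ ∧ (g '' K ∩ K).Nonempty}.Finite) ∧
  ∃ K : Set X, IsCompact K ∧ ∀ x, ∃ g ∈ Γ, g x ∈ K

end Isometries

/-- `Γ₁` and `Γ₂` are weakly commensurable in `G`: some conjugate `gΓ₁g⁻¹` is commensurable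
with `Γ₂`. -/
def WeaklyCommensurable {G : Type*} [Group G] (Γ₁ Γ₂ : Subgroup G) : Prop :=
  ∃ g : G, Subgroup.Commensurable (Γ₁.map (MulAut.conj g).toMonoidHom) Γ₂

/-! ### Ideal model geometries -/

/-- `X` is a geodesic metric space. -/
def IsGeodesicSpace (X : Type*) [MetricSpace X] : Prop :=
  ∀ x y : X, ∃ γ : ℝ → X, γ 0 = x ∧ γ (dist x y) = y ∧
    ∀ s ∈ Set.Icc 0 (dist x y), ∀ t ∈ Set.Icc 0 (dist x y), dist (γ s) (γ t) = |s - t|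

/-- A decomposition of the metric space `X` as a tree of spaces whose vertex spaces are points or
rank-one symmetric spaces and whose edges are unit intervals. -/
structure IdealTreeOfSpaces (X : Type*) [MetricSpace X] where
  /-- The vertices of the underlying tree. -/
  V : Type*
  /-- The underlying tree. -/
  tree : SimpleGraph V
  isTree : tree.IsTree
  /-- The vertex spaces. -/
  space : V → Set X
  space_spec : ∀ v, (∃ x, space v = {x}) ∨ IsRankOneSymmetricSpace (space v)
  /-- The unit interval of an oriented edge, parametrized from its initial vertex. -/
  edge : tree.Dart → unitInterval → X
  edge_isometry : ∀ d, Isometry (edge d)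
  edge_symm : ∀ d t, edge d.symm t = edge d (unitInterval.symm t)
  edge_zero_mem : ∀ d, edge d 0 ∈ space d.fst
  cover : ∀ x, (∃ v, x ∈ space v) ∨ ∃ d, x ∈ Set.range (edge d)
  /-- There are no identifications but those of the ends of the intervals with points of the
  vertex spaces. -/
  space_disjoint : ∀ v w, v ≠ w → Disjoint (space v) (space w)
  edge_notMem : ∀ d t, 0 < t → t < 1 → ∀ v, edge d t ∉ space v
  edge_disjoint : ∀ d t d' t', 0 < t → t < 1 → edge d t = edge d' t' → d.edge = d'.edge
  /-- The metric is that of the gluing: the distance of two points is the least length of a chain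
  whose consecutive members lie in a common vertex space or a common edge. -/
  exists_chain : ∀ x y, ∃ (n : ℕ) (z : ℕ → X), z 0 = x ∧ z n = y ∧
    (∀ i < n, (∃ v, z i ∈ space v ∧ z (i + 1) ∈ space v) ∨
      ∃ d, z i ∈ Set.range (edge d) ∧ z (i + 1) ∈ Set.range (edge d)) ∧
    ∑ i ∈ Finset.range n, dist (z i) (z (i + 1)) = dist x y

/-- `X` is an ideal model geometry: a proper geodesic metric space that is the universal cover of
an ideal graph of spaces `Z`. The universal cover is the tree of spaces `D`, and `π` is the group of
deck transformations: it acts freely, properly and cocompactly by isometries and preserves the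
decomposition, so that `Z = π \ X` is a finite graph of spaces whose vertex spaces are points or
closed manifolds covered by rank-one symmetric spaces and whose edges are unit intervals. -/
def IsIdealModelGeometry.{u} (X : Type u) [MetricSpace X] : Prop :=
  ProperSpace X ∧ IsGeodesicSpace X ∧
  ∃ (D : IdealTreeOfSpaces.{u, u} X) (π : Subgroup (X ≃ᵢ X)),
    ActsGeometrically π ∧
    (∀ g ∈ π, ∀ x, g x = x → g = 1) ∧
    ∀ g ∈ π, ∀ v, ∃ w, g '' D.space v = D.space w

/-!
The proof is a Leighton-type argument. The points whose small spheres do not consist of exactly two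
points form an isometry-invariant set, and the union of the vertex spaces is where the distance to
this set is an integer. Hence `Isom(X)` preserves the decomposition and acts on a tree, whose
vertices are the vertex spaces and the attaching points of the edges. In a ball model of a rank-one
symmetric space the functions `cosh² d(s, ·)` lie, up to a common factor, in a finite-dimensional
space, so finitely many attaching points suffice to tell the points of a vertex space apart by
their distances. Therefore only finitely many germs, modulo `Γ'`, of isometries occur at each vertex
of the tree.

Residual finiteness makes it possible to shrink `Γ` and `Γ'` until neither contains a nontrivial
element that preserves an edge of the tree. Counting the germs on the two sides of an edge then
gives matchings between them that are equivariant under `Γ`. A section of the matched germs along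
the tree glues to an isometry `g`, and the elements of `Γ` that preserve the section form a subgroup
of finite index which `g` conjugates into `Γ'`.
-/

/-! ### Walks in trees -/

section Trees

variable {V : Type*} {T : SimpleGraph V}

theorem forall_of_preconnected (hT : T.Preconnected) {p : V → Prop} (v₀ : V) (base : p v₀)
    (step : ∀ u w, T.Adj u w → p u → p w) (v : V) : p v := by
  obtain ⟨q⟩ := hT v₀ v
  induction q with
  | nil => exact base
  | cons h _ ih => exact ih (step _ _ h base)

/-- The state reached at the end of a walk when the initial state `s` is carried along each edge by
the maps `c`. -/
def transportAlong {St : V → Type*} (c : ∀ u w, T.Adj u w → St u → St w) :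
    ∀ {u w : V}, T.Walk u w → St u → St w
  | _, _, .nil, s => s
  | _, _, .cons h p, s => transportAlong c p (c _ _ h s)

theorem transportAlong_concat {St : V → Type*} (c : ∀ u w, T.Adj u w → St u → St w)
    {u v w : V} (p : T.Walk u v) (h : T.Adj v w) (s : St u) :
    transportAlong c (p.concat h) s = c _ _ h (transportAlong c p s) := by
  induction p with
  | nil => rfl
  | cons _ _ ih => exact ih h _

theorem exists_section_of_isTree (hT : T.IsTree) {St : V → Type*}
    {R : ∀ u w, St u → St w → Prop}
    (symm : ∀ u w, T.Adj u w → ∀ s t, R u w s t → R w u t s)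
    (extend : ∀ u w, T.Adj u w → ∀ s, ∃ t, R u w s t) (v₀ : V) (s₀ : St v₀) :
    ∃ σ : ∀ u, St u, σ v₀ = s₀ ∧ ∀ u w, T.Adj u w → R u w (σ u) (σ w) := by
  choose c hc using extend
  choose path isPath _ using fun v => hT.existsUnique_path v₀ v
  have of_mem_support (u w : V) (huw : T.Adj u w) (hu : u ∈ (path w).support) :
      R u w (transportAlong c (path u) s₀) (transportAlong c (path w) s₀) := by
    rw [hT.isAcyclic.path_concat (isPath u) (isPath w) huw hu, transportAlong_concat]
    exact hc _ _ _ _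
  refine ⟨fun v => transportAlong c (path v) s₀, ?_, fun u w huw => ?_⟩
  · have path_nil : path v₀ = .nil :=
      (hT.existsUnique_path v₀ v₀).unique (isPath v₀) SimpleGraph.Walk.IsPath.nil
    simp only [path_nil]
    rfl
  · by_cases hu : u ∈ (path w).support
    · exact of_mem_support u w huw hu
    · exact symm _ _ huw.symm _ _ (of_mem_support w u huw.symm
        (hT.isAcyclic.mem_support_of_ne_mem_support_of_adj_of_isPath (isPath u) (isPath w) huw hu))

variable {V' : Type*} {T' : SimpleGraph V'}

theorem isChain_ne_edges_map {f : T →g T'} (hf : ∀ u, Set.InjOn f (T.neighborSet u)) :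
    ∀ {u w : V} (p : T.Walk u w), p.edges.IsChain (· ≠ ·) → (p.map f).edges.IsChain (· ≠ ·)
  | _, _, .nil, _ => by simp
  | _, _, .cons _ .nil, _ => by simp
  | _, _, .cons (v := v) h (.cons h' p), hp => by
    simp only [SimpleGraph.Walk.edges_cons, List.isChain_cons_cons] at hp
    have ih := isChain_ne_edges_map hf (.cons h' p) hp.2
    simp only [SimpleGraph.Walk.map_cons, SimpleGraph.Walk.edges_cons,
      List.isChain_cons_cons] at ih ⊢
    refine ⟨fun heq => hp.1 ?_, ih⟩
    have key := hf v h.symm h' (Sym2.congr_right.1 (Sym2.eq_swap.trans heq))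
    rw [key, Sym2.eq_swap]

theorem injective_of_injOn_neighborSet (hT : T.IsTree) (hT' : T'.IsAcyclic) {f : T →g T'}
    (hf : ∀ u, Set.InjOn f (T.neighborSet u)) : Function.Injective f := by
  intro u w huw
  obtain ⟨p, hp, -⟩ := hT.existsUnique_path u w
  have isPath_map : ((p.map f).copy rfl huw.symm).IsPath := by
    rw [SimpleGraph.Walk.isPath_copy, hT'.isPath_iff_isChain]
    exact isChain_ne_edges_map hf p ((hT.isAcyclic.isPath_iff_isChain p).1 hp)
  have nil_map := SimpleGraph.Walk.isPath_iff_nil.1 isPath_map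
  rw [SimpleGraph.Walk.nil_copy, SimpleGraph.Walk.nil_map_iff] at nil_map
  exact nil_map.eq

theorem surjective_of_surjOn_neighborSet [Nonempty V] (hT' : T'.Preconnected) {f : V → V'}
    (hf : ∀ u, Set.SurjOn f (T.neighborSet u) (T'.neighborSet (f u))) :
    Function.Surjective f := by
  obtain ⟨v₀⟩ := ‹Nonempty V›
  refine forall_of_preconnected hT' (f v₀) ⟨v₀, rfl⟩ ?_
  rintro _ w' hw ⟨u, rfl⟩
  obtain ⟨w, -, hw'⟩ := hf u hw
  exact ⟨w, hw'⟩

theorem isAcyclic_of_height (ht : V → ℕ) (ht_ne : ∀ u w, T.Adj u w → ht u ≠ ht w)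
    (lower_unique : ∀ u w w', T.Adj u w → T.Adj u w' → ht w < ht u → ht w' < ht u → w = w') :
    T.IsAcyclic := by
  classical
  intro v c hc
  -- The two neighbours of a highest vertex of a cycle would both lie below it.
  obtain ⟨u, hu, hmax⟩ := c.support.toFinset.exists_max_image ht ⟨v, by simp⟩
  simp only [List.mem_toFinset] at hu hmax
  have hc' := hc.rotate hu
  have lower (w : V) (huw : T.Adj u w) (hw : w ∈ (c.rotate u hu).support) : ht w < ht u :=
    lt_of_le_of_ne (hmax w ((c.mem_support_rotate_iff u hu).1 hw)) (ht_ne u w huw).symm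
  have nil : ¬ (c.rotate u hu).Nil := hc'.not_nil
  refine hc'.snd_ne_penultimate (lower_unique u _ _ ?_ ?_ ?_ ?_)
  · exact SimpleGraph.Walk.adj_snd nil
  · exact (SimpleGraph.Walk.adj_penultimate nil).symm
  · exact lower _ (SimpleGraph.Walk.adj_snd nil) (SimpleGraph.Walk.getVert_mem_support _ _)
  · exact lower _ (SimpleGraph.Walk.adj_penultimate nil).symm
      (SimpleGraph.Walk.getVert_mem_support _ _)

theorem eq_of_dist_eq_add_one (hT : T.IsTree) {v₀ v w w' : V} (hw : T.Adj v w) (hw' : T.Adj v w')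
    (h : T.dist v₀ v = T.dist v₀ w + 1) (h' : T.dist v₀ v = T.dist v₀ w' + 1) : w = w' := by
  obtain ⟨p, hp⟩ := (hT.connected v₀ w).exists_walk_length_eq_dist
  obtain ⟨p', hp'⟩ := (hT.connected v₀ w').exists_walk_length_eq_dist
  have isPath := (p.concat hw.symm).isPath_of_length_eq_dist (by simp [hp, h])
  have isPath' := (p'.concat hw'.symm).isPath_of_length_eq_dist (by simp [hp', h'])
  have := hT.isAcyclic.subsingleton_path v₀ v
  have concat_eq := congrArg Subtype.val
    (Subsingleton.elim (⟨_, isPath⟩ : T.Path v₀ v) ⟨_, isPath'⟩)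
  simpa using congrArg SimpleGraph.Walk.penultimate concat_eq

end Trees

/-! ### Equivariant choices and counting of orbits -/

section Orbits

open scoped Pointwise

variable {G Y : Type*} [Group G] [MulAction G Y]

theorem exists_equivariant_choice {A C : Type*} [MulAction G A] [MulAction G C] [Nonempty C]
    {s : Set A} (smul_mem : ∀ g : G, ∀ a ∈ s, g • a ∈ s)
    (free : ∀ a ∈ s, ∀ g : G, g • a = a → g = 1) {P : A → C → Prop}
    (smul_rel : ∀ (g : G) a c, P a c → P (g • a) (g • c)) (exists_rel : ∀ a ∈ s, ∃ c, P a c) :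
    ∃ f : A → C, ∀ a ∈ s, P a (f a) ∧ ∀ g : G, f (g • a) = g • f a := by
  classical
  let rep (a : A) : A := (Quotient.mk (MulAction.orbitRel G A) a).out
  have rep_smul (g : G) (a : A) : rep (g • a) = rep a :=
    congrArg Quotient.out (Quotient.sound (s := MulAction.orbitRel G A) ⟨g, rfl⟩)
  have exists_smul_rep (a : A) : ∃ g : G, g • rep a = a :=
    (MulAction.orbitRel G A).symm (Quotient.mk_out (s := MulAction.orbitRel G A) a)
  choose t ht using exists_smul_rep
  have exists_rel' (a : A) : ∃ c, a ∈ s → P a c := by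
    by_cases ha : a ∈ s
    · exact (exists_rel a ha).imp fun c hc _ => hc
    · exact ⟨Classical.arbitrary C, fun h => absurd h ha⟩
  choose c hc using exists_rel'
  have rep_mem (a : A) (ha : a ∈ s) : rep a ∈ s := by
    rw [← inv_smul_smul (t a) (rep a), ht]
    exact smul_mem _ a ha
  refine ⟨fun a => t a • c (rep a), fun a ha => ⟨?_, fun g => ?_⟩⟩
  · have := smul_rel (t a) _ _ (hc _ (rep_mem a ha))
    rwa [ht] at this
  · have ht_smul : t (g • a) = g * t a := by
      have : ((g * t a)⁻¹ * t (g • a)) • rep a = rep a := by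
        rw [mul_smul, inv_smul_eq_iff, mul_smul, ht, ← rep_smul g a, ht]
      exact (inv_mul_eq_one.1 (free _ (rep_mem a ha) _ this)).symm
    simp only [rep_smul, ht_smul, mul_smul]

/-- The set of orbits of a subgroup, each orbit being a subset of `Y`: unlike the quotient by the
orbit relation, it lets orbits of different subgroups be compared and moved by the group. -/
def orbits (K : Subgroup G) (Y : Type*) [MulAction G Y] : Set (Set Y) :=
  Set.range (MulAction.orbit K)

theorem coe_smul_orbit_of_le {K E : Subgroup G} (hKE : K ≤ E) (y : Y) :
    (E : Set G) • MulAction.orbit K y = MulAction.orbit E y := by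
  ext z
  constructor
  · rintro ⟨e, he, _, ⟨k, rfl⟩, rfl⟩
    exact ⟨⟨e, he⟩ * ⟨k, hKE k.2⟩, mul_smul e (k : G) y⟩
  · rintro ⟨e, rfl⟩
    exact ⟨e, e.2, y, MulAction.mem_orbit_self y, rfl⟩

theorem inv_mul_mem_of_orbit_inv_smul_eq {K E : Subgroup G} (hKE : K ≤ E) {e e' : G}
    (he : e ∈ E) (he' : e' ∈ E) {y : Y} (free : ∀ f ∈ E, f • y = y → f = 1)
    (h : MulAction.orbit K (e⁻¹ • y) = MulAction.orbit K (e'⁻¹ • y)) : e⁻¹ * e' ∈ K := by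
  obtain ⟨⟨k, hk⟩, hke : k • e'⁻¹ • y = e⁻¹ • y⟩ := MulAction.orbit_eq_iff.1 h
  have fixes_y : (e * k * e'⁻¹) • y = y := by
    rw [mul_smul, mul_smul, hke, smul_inv_smul]
  have eq_one := free _ (E.mul_mem (E.mul_mem he (hKE hk)) (E.inv_mem he')) fixes_y
  rw [← mul_inv_eq_one.1 eq_one, inv_mul_cancel_left]
  exact hk

theorem exists_orbits_equiv_prod {K E : Subgroup G} (hKE : K ≤ E)
    (free : ∀ e ∈ E, ∀ y : Y, e • y = y → e = 1) :
    ∃ φ : orbits K Y ≃ orbits E Y × (E ⧸ K.subgroupOf E),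
      ∀ O, ((φ O).1 : Set Y) = (E : Set G) • (O : Set Y) := by
  choose rep hrep using fun C : orbits E Y => C.2
  let ψ (p : orbits E Y × (E ⧸ K.subgroupOf E)) : orbits K Y :=
    ⟨MulAction.orbit K ((p.2.out : G)⁻¹ • rep p.1), _, rfl⟩
  have smul_ψ (p) : (E : Set G) • (ψ p : Set Y) = p.1 := by
    rw [coe_smul_orbit_of_le hKE, ← hrep p.1]
    exact MulAction.orbit_eq_iff.2 ⟨p.2.out⁻¹, rfl⟩
  have injective : Function.Injective ψ := by
    rintro ⟨C, q⟩ ⟨C', q'⟩ h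
    obtain rfl : C = C' := Subtype.ext (by rw [← smul_ψ (C, q), h, smul_ψ])
    refine Prod.ext rfl ?_
    rw [← QuotientGroup.out_eq' q, ← QuotientGroup.out_eq' q', QuotientGroup.eq,
      Subgroup.mem_subgroupOf]
    exact inv_mul_mem_of_orbit_inv_smul_eq hKE q.out.2 q'.out.2 (free · · (rep C))
      (congrArg Subtype.val h)
  have surjective : Function.Surjective ψ := by
    rintro ⟨_, y, rfl⟩
    let C : orbits E Y := ⟨MulAction.orbit E y, y, rfl⟩
    obtain ⟨e, he⟩ : y ∈ MulAction.orbit E (rep C) := by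
      rw [hrep C]
      exact MulAction.mem_orbit_self y
    obtain ⟨k, hk⟩ := QuotientGroup.mk_out_eq_mul (K.subgroupOf E) e⁻¹
    refine ⟨(C, (e⁻¹ : E)), Subtype.ext (MulAction.orbit_eq_iff.2 ⟨⟨_, k.2⟩⁻¹, ?_⟩)⟩
    simp only [hk, Subgroup.coe_mul, Subgroup.coe_inv, mul_inv_rev, inv_inv, mul_smul, ← he]
    rfl
  let ψ' := Equiv.ofBijective ψ ⟨injective, surjective⟩
  refine ⟨ψ'.symm, fun O => ?_⟩
  rw [← smul_ψ]
  exact congrArg (fun O' : orbits K Y => (E : Set G) • (O' : Set Y)) (ψ'.apply_symm_apply O)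

theorem exists_labelled_orbits_equiv [Nonempty Y] {K K' E : Subgroup G} (hKE : K ≤ E)
    (hKE' : K' ≤ E) (free : ∀ e ∈ E, ∀ y : Y, e • y = y → e = 1) [Finite (orbits K Y)]
    [Finite (orbits K' Y)] {b b' : ℕ}
    (hb : Nat.card (orbits K Y) * b = Nat.card (orbits K' Y) * b') :
    ∃ β : orbits K Y × Fin b ≃ orbits K' Y × Fin b',
      ∀ p, (E : Set G) • ((β p).1 : Set Y) = (E : Set G) • (p.1 : Set Y) := by
  obtain ⟨φ, hφ⟩ := exists_orbits_equiv_prod hKE free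
  obtain ⟨φ', hφ'⟩ := exists_orbits_equiv_prod hKE' free
  obtain ⟨y⟩ := ‹Nonempty Y›
  let C : orbits E Y := ⟨MulAction.orbit E y, y, rfl⟩
  have : Nonempty (orbits E Y) := ⟨C⟩
  have := Finite.of_equiv _ φ
  have := Finite.of_equiv _ φ'
  have : Finite (orbits E Y) :=
    Finite.of_surjective (fun p : orbits E Y × (E ⧸ K.subgroupOf E) => p.1) Prod.fst_surjective
  have : Finite (E ⧸ K.subgroupOf E) := Finite.of_injective _ (Prod.mk_right_injective C)
  have : Finite (E ⧸ K'.subgroupOf E) := Finite.of_injective _ (Prod.mk_right_injective C)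
  have card_eq : Nat.card ((E ⧸ K.subgroupOf E) × Fin b) =
      Nat.card ((E ⧸ K'.subgroupOf E) × Fin b') := by
    rw [Nat.card_congr φ, Nat.card_congr φ', Nat.card_prod, Nat.card_prod, mul_assoc,
      mul_assoc] at hb
    rw [Nat.card_prod, Nat.card_prod, Nat.card_fin, Nat.card_fin]
    exact Nat.eq_of_mul_eq_mul_left Nat.card_pos hb
  obtain ⟨ε⟩ := Finite.card_eq.1 card_eq
  refine ⟨(φ.prodCongr (Equiv.refl _)).trans ((Equiv.prodAssoc _ _ _).trans
    (((Equiv.refl _).prodCongr ε).trans ((Equiv.prodAssoc _ _ _).symm.trans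
      (φ'.symm.prodCongr (Equiv.refl _))))), fun p => ?_⟩
  rw [← hφ, ← hφ']
  simp

end Orbits

/-! ### Lattices acting on a tree -/

section TreeLattice

open scoped Pointwise

variable {G U Y : Type*} [Group G] [MulAction G U] [MulAction G Y]

/-- The pointwise stabilizer in `G` of the closed ball of radius one around `u`. -/
def starFixer (G : Type*) [Group G] [MulAction G U] (T : SimpleGraph U) (u : U) : Subgroup G :=
  fixingSubgroup G (insert u (T.neighborSet u))

theorem starFixer_le_of_adj {T : SimpleGraph U} {u w : U} (huw : T.Adj u w) :
    starFixer G T u ≤ fixingSubgroup G {u, w} :=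
  fixingSubgroup_antitone G U (Set.insert_subset_insert (Set.singleton_subset_iff.2 huw))

theorem starFixer_le_of_adj' {T : SimpleGraph U} {u w : U} (huw : T.Adj u w) :
    starFixer G T w ≤ fixingSubgroup G {u, w} :=
  Set.pair_comm u w ▸ starFixer_le_of_adj huw.symm

/-- A labelled orbit on `Y` of the star fixer of a vertex. For `Y = G ⧸ Γ'` the orbit of the coset
of `h` records the restriction of `h⁻¹` to the star of the vertex up to postcomposition with
elements of `Γ'`; the label tells apart several copies of this datum. -/
@[ext]
structure Germ (U Y : Type*) where
  vertex : U
  orbit : Set Y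
  label : ℕ

instance : MulAction G (Germ U Y) where
  smul g x := ⟨g • x.vertex, g • x.orbit, x.label⟩
  one_smul _ := Germ.ext (one_smul G _) (one_smul G _) rfl
  mul_smul g h _ := Germ.ext (mul_smul g h _) (mul_smul g h _) rfl

/-- The germs at the vertex `u`, each orbit being taken with `b u` labels. -/
def germsAt (G : Type*) [Group G] [MulAction G U] (Y : Type*) [MulAction G Y]
    (T : SimpleGraph U) (b : U → ℕ) (u : U) : Set (Germ U Y) :=
  {x | x.vertex = u ∧ x.orbit ∈ orbits (starFixer G T u) Y ∧ x.label < b u}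

/-- `M` is the graph of an involution that exchanges the germs at the two ends of the edge `e`
and relates only germs that agree up to the pointwise stabilizer of `e`. -/
structure IsMatching (G : Type*) [Group G] [MulAction G U] [MulAction G Y] (T : SimpleGraph U)
    (b : U → ℕ) (e : Set U) (M : Set (Germ U Y × Germ U Y)) : Prop where
  swap_mem : ∀ x y, (x, y) ∈ M → (y, x) ∈ M
  exists_mem : ∀ u w, e = {u, w} → ∀ x ∈ germsAt G Y T b u, ∃ y ∈ germsAt G Y T b w, (x, y) ∈ M
  eq_of_mem : ∀ x y y', (x, y) ∈ M → (x, y') ∈ M → y = y'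
  exists_smul_mem : ∀ x y, (x, y) ∈ M → ∀ a ∈ x.orbit, ∃ g ∈ fixingSubgroup G e, g • a ∈ y.orbit

variable {T : SimpleGraph U} {b : U → ℕ}

theorem finite_germsAt {u : U} [Finite (orbits (starFixer G T u) Y)] :
    (germsAt G Y T b u).Finite := by
  refine ((Set.toFinite (orbits (starFixer G T u) Y)).prod (Set.finite_lt_nat (b u))).image
    (fun p => (⟨u, p.1, p.2⟩ : Germ U Y)) |>.subset ?_
  rintro ⟨_, O, i⟩ ⟨rfl, hO, hi⟩
  exact ⟨(O, i), ⟨hO, hi⟩, rfl⟩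

theorem exists_smul_mem_of_smul_eq {H : Subgroup G} {O O' : Set Y}
    (h : (H : Set G) • O = (H : Set G) • O') {y : Y} (hy : y ∈ O) : ∃ g ∈ H, g • y ∈ O' := by
  obtain ⟨g, hg, y', hy', rfl⟩ : y ∈ (H : Set G) • O' := h ▸ ⟨1, H.one_mem, y, hy, one_smul G y⟩
  exact ⟨g⁻¹, H.inv_mem hg, (inv_smul_smul g y').symm ▸ hy'⟩

theorem exists_isMatching [Nonempty Y] {u w : U} (huw : T.Adj u w)
    (free : ∀ g ∈ fixingSubgroup G ({u, w} : Set U), ∀ y : Y, g • y = y → g = 1)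
    [Finite (orbits (starFixer G T u) Y)] [Finite (orbits (starFixer G T w) Y)]
    (hb : Nat.card (orbits (starFixer G T u) Y) * b u =
      Nat.card (orbits (starFixer G T w) Y) * b w) :
    ∃ M, IsMatching (Y := Y) G T b {u, w} M := by
  obtain ⟨β, hβ⟩ := exists_labelled_orbits_equiv (starFixer_le_of_adj huw)
    (starFixer_le_of_adj' huw) free hb
  let germ (v : U) (p : orbits (starFixer G T v) Y × Fin (b v)) : Germ U Y := ⟨v, p.1, p.2⟩
  have germ_mem (v) (p) : germ v p ∈ germsAt G Y T b v := ⟨rfl, p.1.2, p.2.2⟩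
  have exists_germ (v) : ∀ x ∈ germsAt G Y T b v, ∃ p, germ v p = x := by
    rintro ⟨_, O, i⟩ ⟨rfl, hO, hi⟩
    exact ⟨(⟨O, hO⟩, ⟨i, hi⟩), rfl⟩
  have germ_injective (v) : Function.Injective (germ v) := fun p q hpq =>
    Prod.ext (Subtype.ext (congrArg Germ.orbit hpq)) (Fin.ext (congrArg Germ.label hpq))
  have hne := huw.ne
  refine ⟨{z | ∃ p, z = (germ u p, germ w (β p)) ∨ z = (germ w (β p), germ u p)}, ?_, ?_, ?_, ?_⟩
  · rintro x y ⟨p, h | h⟩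
    all_goals obtain ⟨rfl, rfl⟩ := Prod.ext_iff.1 h
    · exact ⟨p, Or.inr rfl⟩
    · exact ⟨p, Or.inl rfl⟩
  · intro u' w' he x hx
    rcases Set.pair_eq_pair_iff.1 he with ⟨rfl, rfl⟩ | ⟨rfl, rfl⟩
    · obtain ⟨p, rfl⟩ := exists_germ _ x hx
      exact ⟨_, germ_mem _ _, p, Or.inl rfl⟩
    · obtain ⟨p, rfl⟩ := exists_germ _ x hx
      refine ⟨_, germ_mem _ (β.symm p), β.symm p, Or.inr ?_⟩
      rw [β.apply_symm_apply]
  · rintro x y y' ⟨p, h | h⟩ ⟨q, h' | h'⟩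
    all_goals
      obtain ⟨rfl, rfl⟩ := Prod.ext_iff.1 h
      obtain ⟨h₁, rfl⟩ := Prod.ext_iff.1 h'
    · rw [germ_injective u h₁]
    · exact absurd (congrArg Germ.vertex h₁) hne
    · exact absurd (congrArg Germ.vertex h₁) hne.symm
    · rw [β.injective (germ_injective w h₁)]
  · rintro x y ⟨p, h | h⟩
    all_goals obtain ⟨rfl, rfl⟩ := Prod.ext_iff.1 h
    · exact fun _ => exists_smul_mem_of_smul_eq (hβ p).symm
    · exact fun _ => exists_smul_mem_of_smul_eq (hβ p)

variable (hG : ∀ (g : G) u w, T.Adj (g • u) (g • w) ↔ T.Adj u w)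

include hG

theorem smul_mem_star_iff (g : G) (u z : U) :
    g • z ∈ insert (g • u) (T.neighborSet (g • u)) ↔ z ∈ insert u (T.neighborSet u) := by
  simp only [Set.mem_insert_iff, smul_left_cancel_iff, SimpleGraph.mem_neighborSet, hG]

theorem smul_mem_orbits_starFixer (g : G) (u : U) {O : Set Y}
    (hO : O ∈ orbits (starFixer G T u) Y) : g • O ∈ orbits (starFixer G T (g • u)) Y := by
  obtain ⟨y, rfl⟩ := hO
  have conj_mem (v : U) (h : G) (k : starFixer G T v) : h * k * h⁻¹ ∈ starFixer G T (h • v) := by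
    refine (mem_fixingSubgroup_iff G).2 fun z hz => ?_
    have hz' : h⁻¹ • z ∈ insert v (T.neighborSet v) := by
      rwa [← smul_mem_star_iff hG h, smul_inv_smul]
    rw [mul_smul, mul_smul, (mem_fixingSubgroup_iff G).1 k.2 _ hz', smul_inv_smul]
  refine ⟨g • y, ?_⟩
  ext z
  rw [Set.mem_smul_set_iff_inv_smul_mem]
  constructor
  · rintro ⟨k, rfl⟩
    have := conj_mem _ g⁻¹ k
    rw [inv_smul_smul, inv_inv] at this
    exact ⟨⟨_, this⟩, by simp only [Subgroup.smul_def, mul_smul]⟩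
  · rintro ⟨k, hk⟩
    refine ⟨⟨_, conj_mem _ g k⟩, ?_⟩
    rw [eq_inv_smul_iff] at hk
    simp only [Subgroup.smul_def, mul_smul, inv_smul_smul] at hk ⊢
    exact hk

theorem card_orbits_starFixer_smul (g : G) (u : U) :
    Nat.card (orbits (starFixer G T (g • u)) Y) = Nat.card (orbits (starFixer G T u) Y) := by
  have inv_smul_mem (O : orbits (starFixer G T (g • u)) Y) :
      g⁻¹ • O.1 ∈ orbits (starFixer G T u) Y := by
    have := smul_mem_orbits_starFixer hG g⁻¹ (g • u) O.2
    rwa [inv_smul_smul] at this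
  exact (Nat.card_congr ⟨fun O => ⟨g • O.1, smul_mem_orbits_starFixer hG g u O.2⟩,
    fun O => ⟨g⁻¹ • O.1, inv_smul_mem O⟩, fun O => Subtype.ext (inv_smul_smul g O.1),
    fun O => Subtype.ext (smul_inv_smul g O.1)⟩).symm

theorem smul_mem_germsAt (hb : ∀ (g : G) u, b (g • u) = b u) (g : G) {u : U} {x : Germ U Y}
    (hx : x ∈ germsAt G Y T b u) : g • x ∈ germsAt G Y T b (g • u) := by
  obtain ⟨rfl, hO, hi⟩ := hx
  exact ⟨rfl, smul_mem_orbits_starFixer hG g _ hO, (hb g x.vertex).symm ▸ hi⟩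

theorem IsMatching.smul (hb : ∀ (g : G) u, b (g • u) = b u) (g : G) {e : Set U}
    {M : Set (Germ U Y × Germ U Y)} (hM : IsMatching G T b e M) :
    IsMatching G T b (g • e) (g • M) := by
  have mem_smul_iff (x y : Germ U Y) : (x, y) ∈ g • M ↔ (g⁻¹ • x, g⁻¹ • y) ∈ M :=
    Set.mem_smul_set_iff_inv_smul_mem
  refine ⟨fun x y h => ?_, fun u w he x hx => ?_, fun x y y' h h' => ?_, fun x y h a ha => ?_⟩
  · exact (mem_smul_iff _ _).2 (hM.swap_mem _ _ ((mem_smul_iff _ _).1 h))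
  · have he' : e = {g⁻¹ • u, g⁻¹ • w} := by
      rw [← inv_smul_smul g e, he, Set.smul_set_insert, Set.smul_set_singleton]
    obtain ⟨y, hy, hxy⟩ := hM.exists_mem _ _ he' _ (smul_mem_germsAt hG hb g⁻¹ hx)
    refine ⟨g • y, ?_, (mem_smul_iff _ _).2 (by rwa [inv_smul_smul])⟩
    have := smul_mem_germsAt hG hb g hy
    rwa [smul_inv_smul] at this
  · exact smul_left_cancel _
      (hM.eq_of_mem _ _ _ ((mem_smul_iff _ _).1 h) ((mem_smul_iff _ _).1 h'))
  · obtain ⟨k, hk, hka⟩ := hM.exists_smul_mem _ _ ((mem_smul_iff _ _).1 h) (g⁻¹ • a)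
      (Set.smul_mem_smul_set ha)
    refine ⟨g * k * g⁻¹, (mem_fixingSubgroup_iff G).2 fun z hz => ?_, ?_⟩
    · rw [mul_smul, mul_smul, (mem_fixingSubgroup_iff G).1 hk _
        (Set.mem_smul_set_iff_inv_smul_mem.1 hz), smul_inv_smul]
    · rwa [mul_smul, mul_smul, ← Set.mem_inv_smul_set_iff]

theorem exists_equivariant_matching [Nonempty Y]
    (free : ∀ u w, T.Adj u w → ∀ g ∈ fixingSubgroup G ({u, w} : Set U), ∀ y : Y, g • y = y → g = 1)
    (finite : ∀ u, Finite (orbits (starFixer G T u) Y)) {s : ℕ}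
    (hbs : ∀ u, Nat.card (orbits (starFixer G T u) Y) * b u = s)
    (hb : ∀ (g : G) u, b (g • u) = b u) (Γ : Subgroup G)
    (hΓ : ∀ γ ∈ Γ, ∀ u w, T.Adj u w → γ • ({u, w} : Set U) = {u, w} → γ = 1) :
    ∃ M : Set U → Set (Germ U Y × Germ U Y), ∀ u w, T.Adj u w →
      IsMatching G T b {u, w} (M {u, w}) ∧
      ∀ γ ∈ Γ, M {γ • u, γ • w} = γ • M {u, w} := by
  have smul_pair (γ : Γ) (u w : U) : γ • ({u, w} : Set U) = {γ • u, γ • w} := by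
    rw [Set.smul_set_insert, Set.smul_set_singleton]
  have smul_mem (γ : Γ) : ∀ e ∈ {e : Set U | ∃ u w, T.Adj u w ∧ e = {u, w}},
      γ • e ∈ {e : Set U | ∃ u w, T.Adj u w ∧ e = {u, w}} := by
    rintro _ ⟨u, w, huw, rfl⟩
    exact ⟨γ • u, γ • w, (hG γ u w).2 huw, smul_pair γ u w⟩
  have free_on_edges : ∀ e ∈ {e : Set U | ∃ u w, T.Adj u w ∧ e = {u, w}}, ∀ γ : Γ,
      γ • e = e → γ = 1 := by
    rintro _ ⟨u, w, huw, rfl⟩ γ hγ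
    exact Subtype.ext (hΓ γ γ.2 u w huw hγ)
  have exists_matching : ∀ e ∈ {e : Set U | ∃ u w, T.Adj u w ∧ e = {u, w}},
      ∃ M, IsMatching (Y := Y) G T b e M := by
    rintro _ ⟨u, w, huw, rfl⟩
    exact exists_isMatching huw (free u w huw) ((hbs u).trans (hbs w).symm)
  obtain ⟨M, hM⟩ := exists_equivariant_choice smul_mem free_on_edges
    (fun γ _ _ hM => hM.smul hG hb (γ : G)) exists_matching
  refine ⟨M, fun u w huw => ?_⟩
  obtain ⟨isMatching, smul_eq⟩ := hM {u, w} ⟨u, w, huw, rfl⟩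
  refine ⟨isMatching, fun γ hγ => ?_⟩
  exact (congrArg M (smul_pair ⟨γ, hγ⟩ u w)).symm.trans (smul_eq ⟨γ, hγ⟩)

end TreeLattice

section GermSection

open scoped Pointwise

variable {G U Y : Type*} [Group G] [MulAction G U] [MulAction G Y]

/-- A choice of a germ at every vertex such that the germs at the ends of each edge `e` are related
by `M e`. -/
structure IsGermSection (G : Type*) [Group G] [MulAction G U] [MulAction G Y] (T : SimpleGraph U)
    (b : U → ℕ) (M : Set U → Set (Germ U Y × Germ U Y)) (σ : U → Germ U Y) : Prop where
  mem_germsAt : ∀ u, σ u ∈ germsAt G Y T b u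
  mem_matching : ∀ u w, T.Adj u w → (σ u, σ w) ∈ M {u, w}

variable {T : SimpleGraph U} {b : U → ℕ} {M : Set U → Set (Germ U Y × Germ U Y)}

theorem exists_isGermSection (hT : T.IsTree)
    (hM : ∀ u w, T.Adj u w → IsMatching G T b {u, w} (M {u, w})) {u₀ : U}
    (hu₀ : (germsAt G Y T b u₀).Nonempty) : ∃ σ, IsGermSection G T b M σ := by
  obtain ⟨x₀, hx₀⟩ := hu₀
  obtain ⟨σ, -, hσ⟩ := exists_section_of_isTree hT (St := fun u => germsAt G Y T b u)
    (R := fun u w x y => (x.1, y.1) ∈ M {u, w})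
    (fun u w huw x y hxy => Set.pair_comm u w ▸ (hM u w huw).swap_mem _ _ hxy)
    (fun u w huw x => by
      obtain ⟨y, hy, hxy⟩ := (hM u w huw).exists_mem u w rfl x x.2
      exact ⟨⟨y, hy⟩, hxy⟩) u₀ ⟨x₀, hx₀⟩
  exact ⟨fun u => σ u, fun u => (σ u).2, hσ⟩

namespace IsGermSection

variable {σ σ' : U → Germ U Y}

theorem eq_of_apply_eq (hσ : IsGermSection G T b M σ) (hσ' : IsGermSection G T b M σ')
    (hT : T.Preconnected) (hM : ∀ u w, T.Adj u w → IsMatching G T b {u, w} (M {u, w})) {u₀ : U}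
    (h : σ u₀ = σ' u₀) : σ = σ' :=
  funext <| forall_of_preconnected hT (p := fun u => σ u = σ' u) u₀ h fun u w huw hu =>
    (hM u w huw).eq_of_mem _ _ _ (hσ.mem_matching u w huw) (hu ▸ hσ'.mem_matching u w huw)

theorem smul (hσ : IsGermSection G T b M σ)
    (hG : ∀ (g : G) u w, T.Adj (g • u) (g • w) ↔ T.Adj u w) (hb : ∀ (g : G) u, b (g • u) = b u)
    {γ : G} (hMγ : ∀ u w, T.Adj u w → M {γ • u, γ • w} = γ • M {u, w}) :
    IsGermSection G T b M fun u => γ • σ (γ⁻¹ • u) where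
  mem_germsAt u := by
    have := smul_mem_germsAt hG hb γ (hσ.mem_germsAt (γ⁻¹ • u))
    rwa [smul_inv_smul] at this
  mem_matching u w huw := by
    have huw' : T.Adj (γ⁻¹ • u) (γ⁻¹ • w) := (hG _ _ _).2 huw
    have := hMγ _ _ huw'
    rw [smul_inv_smul, smul_inv_smul] at this
    rw [this]
    exact Set.smul_mem_smul_set (hσ.mem_matching _ _ huw')

end IsGermSection

/-- The elements of `G` that commute with `σ`. -/
def equivarianceSubgroup (G : Type*) [Group G] [MulAction G U] [MulAction G Y]
    (σ : U → Germ U Y) : Subgroup G where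
  carrier := {g | ∀ u, σ (g • u) = g • σ u}
  one_mem' u := by rw [one_smul, one_smul]
  mul_mem' hg hh u := by rw [mul_smul, mul_smul, hg, hh]
  inv_mem' {g} hg u := by rw [eq_inv_smul_iff, ← hg, smul_inv_smul]

theorem relIndex_ne_zero_of_finite_range {A : Type*} {Γ Δ : Subgroup G} (f : Γ → A)
    (hfin : (Set.range f).Finite) (hf : ∀ γ δ : Γ, f γ = f δ → (γ⁻¹ * δ : G) ∈ Δ) :
    Δ.relIndex Γ ≠ 0 := by
  have : Finite (Set.range f) := hfin
  have : Finite (Γ ⧸ Δ.subgroupOf Γ) := by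
    refine Finite.of_injective (fun q => (⟨f q.out, q.out, rfl⟩ : Set.range f)) fun q q' h => ?_
    rw [← QuotientGroup.out_eq' q, ← QuotientGroup.out_eq' q', QuotientGroup.eq]
    exact hf _ _ (congrArg Subtype.val h)
  exact Subgroup.index_ne_zero_of_finite

theorem IsGermSection.relIndex_equivarianceSubgroup_ne_zero {σ : U → Germ U Y}
    (hσ : IsGermSection G T b M σ) (hT : T.IsTree)
    (hG : ∀ (g : G) u w, T.Adj (g • u) (g • w) ↔ T.Adj u w) (hb : ∀ (g : G) u, b (g • u) = b u)
    (hfin : ∃ u, (germsAt G Y T b u).Finite) (Γ : Subgroup G)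
    (hM : ∀ u w, T.Adj u w → IsMatching G T b {u, w} (M {u, w}) ∧
      ∀ γ ∈ Γ, M {γ • u, γ • w} = γ • M {u, w}) :
    (equivarianceSubgroup G σ).relIndex Γ ≠ 0 := by
  obtain ⟨u₀, hu₀⟩ := hfin
  have smul_isGermSection (γ : Γ) := hσ.smul hG hb fun u w huw => (hM u w huw).2 γ γ.2
  refine relIndex_ne_zero_of_finite_range (fun γ : Γ => (γ : G) • σ ((γ : G)⁻¹ • u₀))
    (hu₀.subset ?_) fun γ δ h u => ?_
  · rintro _ ⟨γ, rfl⟩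
    exact (smul_isGermSection γ).mem_germsAt u₀
  · have := congrFun ((smul_isGermSection γ).eq_of_apply_eq (smul_isGermSection δ)
      hT.preconnected (fun u w huw => (hM u w huw).1) h) ((δ : G) • u)
    rw [inv_smul_smul] at this
    rw [Subgroup.coe_inv, mul_smul, mul_smul, ← this, inv_smul_smul]

end GermSection

section Conjugation

open scoped Pointwise

variable {G U : Type*} [Group G] [MulAction G U] {T : SimpleGraph U} {b : U → ℕ} {Γ' : Subgroup G}
  {M : Set U → Set (Germ U (G ⧸ Γ') × Germ U (G ⧸ Γ'))} {σ : U → Germ U (G ⧸ Γ')}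

theorem IsGermSection.exists_smul_eq_inv_smul (hσ : IsGermSection G T b M σ) (hT : T.IsTree)
    (hM : ∀ u w, T.Adj u w → IsMatching G T b {u, w} (M {u, w}))
    (hglue : ∀ k : U → G, (∀ u w, T.Adj u w → k u • w = k w • w) →
      ∃ g : G, ∀ u, g • u = k u • u) :
    ∃ g : G, ∀ u, ∃ h : G, (h : G ⧸ Γ') ∈ (σ u).orbit ∧
      ∀ z ∈ insert u (T.neighborSet u), g • z = h⁻¹ • z := by
  obtain ⟨u₀⟩ := hT.nonempty
  have orbit_nonempty : ∃ h₀ : G, (h₀ : G ⧸ Γ') ∈ (σ u₀).orbit := by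
    obtain ⟨q, hq⟩ := (hσ.mem_germsAt u₀).2.1
    exact ⟨q.out, by rw [QuotientGroup.out_eq', ← hq]; exact MulAction.mem_orbit_self q⟩
  obtain ⟨h₀, hh₀⟩ := orbit_nonempty
  obtain ⟨h, -, hh⟩ := exists_section_of_isTree hT
    (St := fun u => {h : G // (h : G ⧸ Γ') ∈ (σ u).orbit})
    (R := fun u w h h' => h'.1 * h.1⁻¹ ∈ fixingSubgroup G ({u, w} : Set U))
    (fun u w _ h h' hhh' => by
      rw [Set.pair_comm]
      simpa only [mul_inv_rev, inv_inv] using inv_mem hhh')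
    (fun u w huw h => by
      obtain ⟨k, hk, hkh⟩ := (hM u w huw).exists_smul_mem _ _ (hσ.mem_matching u w huw) _ h.2
      exact ⟨⟨k * h, hkh⟩, by rwa [mul_inv_cancel_right]⟩) u₀ ⟨h₀, hh₀⟩
  have inv_smul_eq (u w) (huw : T.Adj u w) (z) (hz : z ∈ ({u, w} : Set U)) :
      (h u : G)⁻¹ • z = (h w : G)⁻¹ • z := by
    rw [eq_inv_smul_iff, ← mul_smul]
    exact (mem_fixingSubgroup_iff G).1 (hh u w huw) z hz
  obtain ⟨g, hg⟩ := hglue (fun u => (h u : G)⁻¹) fun u w huw => inv_smul_eq u w huw w (by simp)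
  refine ⟨g, fun u => ⟨h u, (h u).2, ?_⟩⟩
  rintro z (rfl | huz)
  · exact hg z
  · rw [hg z, inv_smul_eq u z huz z (by simp)]

theorem IsGermSection.conj_mem (hσ : IsGermSection G T b M σ) (hT : T.IsTree)
    (hG : ∀ (g : G) u w, T.Adj (g • u) (g • w) ↔ T.Adj u w)
    (hΓ' : ∀ γ ∈ Γ', ∀ u w, T.Adj u w → γ • u = u → γ • w = w → γ = 1)
    (faithful : ∀ g : G, (∀ u : U, g • u = u) → g = 1) {g : G}
    (hg : ∀ u, ∃ h : G, (h : G ⧸ Γ') ∈ (σ u).orbit ∧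
      ∀ z ∈ insert u (T.neighborSet u), g • z = h⁻¹ • z)
    {δ : G} (hδ : δ ∈ equivarianceSubgroup G σ) : g * δ * g⁻¹ ∈ Γ' := by
  have exists_mem_star (u : U) : ∃ κ ∈ Γ', ∀ z ∈ insert u (T.neighborSet u),
      κ • g • z = g • δ • z := by
    obtain ⟨h, hh, hgh⟩ := hg u
    obtain ⟨h', hh', hgh'⟩ := hg (δ • u)
    have hδh : ((δ * h : G) : G ⧸ Γ') ∈ (σ (δ • u)).orbit :=
      hδ u ▸ Set.smul_mem_smul_set hh
    obtain ⟨q, hq⟩ := (hσ.mem_germsAt (δ • u)).2.1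
    rw [← hq] at hh' hδh
    obtain ⟨⟨ξ, hξ⟩, hξh : ((ξ * (δ * h) : G) : G ⧸ Γ') = h'⟩ :=
      MulAction.orbit_eq_iff.1 ((MulAction.orbit_eq_iff.2 hh').trans
        (MulAction.orbit_eq_iff.2 hδh).symm)
    refine ⟨h'⁻¹ * (ξ * (δ * h)), QuotientGroup.eq.1 hξh.symm, fun z hz => ?_⟩
    have hδz := (smul_mem_star_iff hG δ u z).2 hz
    rw [hgh z hz, hgh' _ hδz, mul_smul, mul_smul, mul_smul, smul_inv_smul,
      (mem_fixingSubgroup_iff G).1 hξ _ hδz]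
  choose κ hκ hκg using exists_mem_star
  obtain ⟨u₀⟩ := hT.nonempty
  have κ_eq : ∀ u, κ u = κ u₀ :=
    forall_of_preconnected hT.preconnected (p := fun u => κ u = κ u₀) u₀ rfl
      fun u w huw hu => by
        rw [← hu, eq_comm, ← inv_mul_eq_one]
        refine hΓ' _ (mul_mem (inv_mem (hκ u)) (hκ w)) _ _ ((hG g u w).2 huw) ?_ ?_
        all_goals rw [mul_smul, hκg w _ (by simp [huw.symm]), inv_smul_eq_iff,
          hκg u _ (by simp [huw])]
  have conj_eq : (g * δ * g⁻¹)⁻¹ * κ u₀ = 1 := faithful _ fun u => by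
    have := hκg (g⁻¹ • u) (g⁻¹ • u) (Set.mem_insert _ _)
    rw [smul_inv_smul, κ_eq] at this
    rw [mul_smul, this, inv_smul_eq_iff, mul_smul, mul_smul]
  exact inv_mul_eq_one.1 conj_eq ▸ hκ u₀

theorem eq_one_of_smul_quotient_eq
    (hG : ∀ (g : G) u w, T.Adj (g • u) (g • w) ↔ T.Adj u w)
    (hΓ' : ∀ γ ∈ Γ', ∀ u w, T.Adj u w → γ • u = u → γ • w = w → γ = 1) {u w : U}
    (huw : T.Adj u w) {g : G} (hg : g ∈ fixingSubgroup G ({u, w} : Set U)) {y : G ⧸ Γ'}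
    (hy : g • y = y) : g = 1 := by
  obtain ⟨h, rfl⟩ := QuotientGroup.mk_surjective y
  have conj_mem : h⁻¹ * (g * h) ∈ Γ' := QuotientGroup.eq.1 hy.symm
  have conj_fixes (z : U) (hz : z ∈ ({u, w} : Set U)) : (h⁻¹ * (g * h)) • h⁻¹ • z = h⁻¹ • z := by
    rw [mul_smul, mul_smul, smul_inv_smul, (mem_fixingSubgroup_iff G).1 hg z hz]
  have conj_eq_one := hΓ' _ conj_mem _ _ ((hG h⁻¹ u w).2 huw) (conj_fixes u (by simp))
    (conj_fixes w (by simp))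
  exact mul_eq_right.1 (inv_mul_eq_one.1 conj_eq_one).symm

theorem exists_card_orbits_mul_eq {Y : Type*} [MulAction G Y] [Nonempty Y]
    (hG : ∀ (g : G) u w, T.Adj (g • u) (g • w) ↔ T.Adj u w)
    (finite : ∀ u, Finite (orbits (starFixer G T u) Y))
    (cofinite : ∃ F : Set U, F.Finite ∧ ∀ u, ∃ g : G, g • u ∈ F) :
    ∃ (b : U → ℕ) (s : ℕ), (∀ u, 0 < b u) ∧ (∀ (g : G) u, b (g • u) = b u) ∧
      ∀ u, Nat.card (orbits (starFixer G T u) Y) * b u = s := by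
  obtain ⟨F, hF, hGF⟩ := cofinite
  have card_pos (u : U) : 0 < Nat.card (orbits (starFixer G T u) Y) :=
    have : Nonempty (orbits (starFixer G T u) Y) := (Set.range_nonempty _).to_subtype
    Nat.card_pos
  let s := ∏ v ∈ hF.toFinset, Nat.card (orbits (starFixer G T v) Y)
  have card_dvd (u : U) : Nat.card (orbits (starFixer G T u) Y) ∣ s := by
    obtain ⟨g, hg⟩ := hGF u
    rw [← card_orbits_starFixer_smul hG g u]
    exact Finset.dvd_prod_of_mem _ (hF.mem_toFinset.2 hg)
  have s_pos : 0 < s := Finset.prod_pos fun v _ => card_pos v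
  exact ⟨fun u => s / Nat.card (orbits (starFixer G T u) Y), s,
    fun u => Nat.div_pos (Nat.le_of_dvd s_pos (card_dvd u)) (card_pos u),
    fun g u => by simp only [card_orbits_starFixer_smul hG],
    fun u => Nat.mul_div_cancel' (card_dvd u)⟩

/-- Leighton's counting argument. The germs are finite in number at each vertex, so edgewise
matchings of germs exist by counting, can be chosen `Γ`-equivariantly because `Γ` acts freely on
edges, and have only finitely many sections; the elements of `Γ` that fix one section are carried
into `Γ'` by the element of `G` glued from it. -/
theorem exists_relIndex_map_conj_ne_zero_of_isTree (hT : T.IsTree)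
    (hG : ∀ (g : G) u w, T.Adj (g • u) (g • w) ↔ T.Adj u w)
    (faithful : ∀ g : G, (∀ u : U, g • u = u) → g = 1)
    (cofinite : ∃ F : Set U, F.Finite ∧ ∀ u, ∃ g : G, g • u ∈ F)
    (hglue : ∀ k : U → G, (∀ u w, T.Adj u w → k u • w = k w • w) →
      ∃ g : G, ∀ u, g • u = k u • u)
    {Γ : Subgroup G} (hΓ : ∀ γ ∈ Γ, ∀ u w, T.Adj u w → γ • ({u, w} : Set U) = {u, w} → γ = 1)
    (hΓ' : ∀ γ ∈ Γ', ∀ u w, T.Adj u w → γ • u = u → γ • w = w → γ = 1)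
    (finite : ∀ u, Finite (orbits (starFixer G T u) (G ⧸ Γ'))) :
    ∃ g : G, Γ'.relIndex (Γ.map (MulAut.conj g).toMonoidHom) ≠ 0 := by
  obtain ⟨b, s, b_pos, hb, hbs⟩ := exists_card_orbits_mul_eq hG finite cofinite
  obtain ⟨M, hM⟩ := exists_equivariant_matching (Y := G ⧸ Γ') hG
    (fun u w huw g hg y hy => eq_one_of_smul_quotient_eq hG hΓ' huw hg hy) finite hbs hb Γ hΓ
  have isMatching u w huw := (hM u w huw).1
  obtain ⟨u₀⟩ := hT.nonempty
  obtain ⟨σ, hσ⟩ := exists_isGermSection hT isMatching (u₀ := u₀)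
    ⟨⟨u₀, _, 0⟩, rfl, ⟨((1 : G) : G ⧸ Γ'), rfl⟩, b_pos u₀⟩
  obtain ⟨g, hg⟩ := hσ.exists_smul_eq_inv_smul hT isMatching hglue
  refine ⟨g, ne_zero_of_dvd_ne_zero ?_ (Subgroup.relIndex_dvd_of_le_left
    (H := (equivarianceSubgroup G σ).map (MulAut.conj g).toMonoidHom) _ ?_)⟩
  · rw [Subgroup.relIndex_map_map_of_injective _ _ (MulAut.conj g).injective]
    exact hσ.relIndex_equivarianceSubgroup_ne_zero hT hG hb ⟨u₀, finite_germsAt⟩ Γ hM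
  · rintro _ ⟨δ, hδ, rfl⟩
    exact hσ.conj_mem hT hG hΓ' faithful hg hδ

end Conjugation

/-! ### Ball models of rank-one symmetric spaces -/

section BallModels

open scoped RealInnerProductSpace Topology

theorem exists_finite_evaluations {α : Type*} (W : Submodule ℝ (α → ℝ)) [FiniteDimensional ℝ W]
    (A : Set α) : ∃ F : Set α, F.Finite ∧ F ⊆ A ∧
      ∀ w ∈ W, (∀ y ∈ F, w y = 0) → ∀ y ∈ A, w y = 0 := by
  induction hn : Module.finrank ℝ W using Nat.strong_induction_on generalizing W with
  | _ n ih =>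
  by_cases h : ∀ w ∈ W, ∀ y ∈ A, w y = 0
  · exact ⟨∅, Set.finite_empty, Set.empty_subset _, fun w hw _ => h w hw⟩
  · push Not at h
    obtain ⟨w₀, hw₀, a, ha, hwa⟩ := h
    let W' : Submodule ℝ (α → ℝ) := W ⊓ LinearMap.ker (LinearMap.proj a : (α → ℝ) →ₗ[ℝ] ℝ)
    have hlt : W' < W := by
      refine lt_of_le_of_ne inf_le_left fun h => hwa ?_
      rw [← h] at hw₀
      exact hw₀.2
    have hfin : FiniteDimensional ℝ W' := Submodule.finiteDimensional_of_le hlt.le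
    obtain ⟨F, hF, hFA, H⟩ := ih _ (hn ▸ Submodule.finrank_lt_finrank_of_lt hlt) W' rfl
    refine ⟨insert a F, hF.insert a, Set.insert_subset ha hFA, fun w hw hwF => ?_⟩
    exact H w ⟨hw, hwF a (Set.mem_insert _ _)⟩ fun y hy => hwF y (Set.mem_insert_of_mem _ hy)

variable {E : Type*} [NormedAddCommGroup E] [InnerProductSpace ℝ E]

theorem eq_of_inv_one_sub_norm_sq_smul_eq {x y : E} (hx : ‖x‖ < 1) (hy : ‖y‖ < 1)
    (h : (1 - ‖x‖ ^ 2)⁻¹ • x = (1 - ‖y‖ ^ 2)⁻¹ • y) : x = y := by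
  have hx' : 0 < 1 - ‖x‖ ^ 2 := by nlinarith [norm_nonneg x]
  have hy' : 0 < 1 - ‖y‖ ^ 2 := by nlinarith [norm_nonneg y]
  have hnorm := congrArg norm h
  rw [norm_smul, norm_smul, Real.norm_of_nonneg (inv_pos.2 hx').le,
    Real.norm_of_nonneg (inv_pos.2 hy').le, inv_mul_eq_iff_eq_mul₀ hx'.ne',
    mul_left_comm, eq_inv_mul_iff_mul_eq₀ hy'.ne'] at hnorm
  have hfactor : (‖x‖ - ‖y‖) * (1 + ‖x‖ * ‖y‖) = 0 := by linear_combination hnorm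
  have norm_eq : ‖x‖ = ‖y‖ :=
    sub_eq_zero.1 ((mul_eq_zero.1 hfactor).resolve_right (by positivity))
  rw [norm_eq] at h
  exact smul_right_injective E (inv_pos.2 hy').ne' h

/-- The directions `ξ` of the unit sphere for which the form `1 - 2⟪x, a⟫ + q x a` is at least
`(1 - ⟪x, a⟫)²` for all `x` on the line through `ξ`. -/
def idealDirections (q : E → E → ℝ) : Set E :=
  {ξ | ‖ξ‖ = 1 ∧ ∀ (t : ℝ) a, (t * ⟪a, ξ⟫) ^ 2 ≤ q (t • ξ) a}

/-- The properties of the quartic part `q` of the squared Hermitian form of a projective ball model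
that are used here; they hold for all four families of rank-one symmetric spaces. -/
structure IsBallForm (q : E → E → ℝ) : Prop where
  continuous : Continuous fun p : E × E => q p.1 p.2
  neg_right : ∀ x y, q x (-y) = q x y
  exists_finiteDimensional : ∃ W : Submodule ℝ (E → ℝ), FiniteDimensional ℝ W ∧ ∀ x, q x ∈ W
  span_idealDirections : Submodule.span ℝ (idealDirections q) = ⊤

theorem neg_mem_idealDirections {q : E → E → ℝ} {ξ : E} (hξ : ξ ∈ idealDirections q) :
    -ξ ∈ idealDirections q := by
  refine ⟨(norm_neg ξ).trans hξ.1, fun t a => ?_⟩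
  have := hξ.2 (-t) a
  rwa [neg_smul, ← smul_neg, neg_mul_comm, ← inner_neg_right] at this

/-- A metric space with a projective ball model whose squared Hermitian form has quartic
part `q`. -/
structure BallModel (q : E → E → ℝ) (S : Type*) [MetricSpace S] where
  scale : ℝ
  coord : S → E
  scale_pos : 0 < scale
  injective : Function.Injective coord
  range_eq : Set.range coord = Metric.ball 0 1
  cosh_sq : ∀ s t, Real.cosh (dist s t / scale) ^ 2 =
    (1 - 2 * ⟪coord s, coord t⟫ + q (coord s) (coord t)) /
      ((1 - ‖coord s‖ ^ 2) * (1 - ‖coord t‖ ^ 2))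

namespace BallModel

variable {q : E → E → ℝ} {S : Type*} [MetricSpace S]

theorem norm_lt (m : BallModel q S) (s : S) : ‖m.coord s‖ < 1 := by
  rw [← mem_ball_zero_iff, ← m.range_eq]
  exact Set.mem_range_self s

theorem one_sub_pos (m : BallModel q S) (s : S) : 0 < 1 - ‖m.coord s‖ ^ 2 := by
  nlinarith [m.norm_lt s, norm_nonneg (m.coord s)]

theorem exists_eq (m : BallModel q S) {x : E} (hx : ‖x‖ < 1) : ∃ s, m.coord s = x := by
  change x ∈ Set.range m.coord
  rwa [m.range_eq, mem_ball_zero_iff]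

/-- The inverse of the coordinate map. -/
noncomputable def point (m : BallModel q S) (x : Metric.ball (0 : E) 1) : S :=
  (m.exists_eq (mem_ball_zero_iff.1 x.2)).choose

theorem coord_point (m : BallModel q S) (x : Metric.ball (0 : E) 1) : m.coord (m.point x) = x :=
  (m.exists_eq (mem_ball_zero_iff.1 x.2)).choose_spec

theorem point_surjective (m : BallModel q S) : Function.Surjective m.point := fun s =>
  ⟨⟨m.coord s, mem_ball_zero_iff.2 (m.norm_lt s)⟩, m.injective (m.coord_point _)⟩

theorem pairing_eq (m : BallModel q S) (s t : S) :
    1 - 2 * ⟪m.coord s, m.coord t⟫ + q (m.coord s) (m.coord t) =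
      Real.cosh (dist s t / m.scale) ^ 2 * ((1 - ‖m.coord s‖ ^ 2) * (1 - ‖m.coord t‖ ^ 2)) := by
  rw [m.cosh_sq, div_mul_cancel₀]
  exact (mul_pos (m.one_sub_pos s) (m.one_sub_pos t)).ne'

theorem dist_le_scale_mul_sqrt (m : BallModel q S) (s t : S) :
    dist s t ≤ m.scale * √(Real.cosh (dist s t / m.scale) ^ 2 - 1) := by
  rw [← div_le_iff₀' m.scale_pos, Real.cosh_sq, add_sub_cancel_right]
  have hd : 0 ≤ dist s t / m.scale := div_nonneg dist_nonneg m.scale_pos.le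
  exact Real.le_sqrt_of_sq_le (pow_le_pow_left₀ hd (Real.self_le_sinh_iff.2 hd) 2)

theorem continuous_point (m : BallModel q S) (hq : Continuous fun p : E × E => q p.1 p.2) :
    Continuous m.point := by
  refine continuous_iff_continuousAt.2 fun z₀ => tendsto_iff_dist_tendsto_zero.2 ?_
  have cosh_eq (z : Metric.ball (0 : E) 1) :
      Real.cosh (dist (m.point z) (m.point z₀) / m.scale) ^ 2 =
        (1 - 2 * ⟪(z : E), (z₀ : E)⟫ + q z z₀) / ((1 - ‖(z : E)‖ ^ 2) * (1 - ‖(z₀ : E)‖ ^ 2)) := by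
    rw [m.cosh_sq, m.coord_point, m.coord_point]
  have one_sub_pos (z : Metric.ball (0 : E) 1) : 0 < 1 - ‖(z : E)‖ ^ 2 :=
    m.coord_point z ▸ m.one_sub_pos (m.point z)
  have continuous_cosh : Continuous fun z =>
      Real.cosh (dist (m.point z) (m.point z₀) / m.scale) ^ 2 := by
    simp_rw [cosh_eq]
    have : Continuous fun z : Metric.ball (0 : E) 1 => q z z₀ :=
      hq.comp (continuous_subtype_val.prodMk continuous_const)
    exact Continuous.div (by fun_prop) (by fun_prop)
      fun z => (mul_pos (one_sub_pos z) (one_sub_pos z₀)).ne'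
  have continuous_bound : Continuous fun z =>
      m.scale * √(Real.cosh (dist (m.point z) (m.point z₀) / m.scale) ^ 2 - 1) := by
    fun_prop
  refine squeeze_zero (fun _ => dist_nonneg) (fun z => m.dist_le_scale_mul_sqrt _ _) ?_
  simpa using continuous_bound.tendsto z₀

theorem preconnectedSpace (m : BallModel q S) (hq : Continuous fun p : E × E => q p.1 p.2) :
    PreconnectedSpace S := by
  have : PreconnectedSpace (Metric.ball (0 : E) 1) :=
    isPreconnected_iff_preconnectedSpace.1 (convex_ball (0 : E) 1).isPreconnected
  exact m.point_surjective.denseRange.preconnectedSpace (m.continuous_point hq)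

theorem exists_dist_eq (m : BallModel q S) (hq : Continuous fun p : E × E => q p.1 p.2) (s : S)
    {v : E} (hv : ‖v‖ = 1) : ∃ ε₀ > 0, ∀ ε, 0 < ε → ε < ε₀ →
      ∃ t, ∃ τ > (0 : ℝ), m.coord t = m.coord s + τ • v ∧ dist s t = ε := by
  obtain ⟨δ, hδ, hδ_lt⟩ : ∃ δ > 0, ‖m.coord s‖ + δ < 1 := by
    obtain ⟨r, hr, hr'⟩ := exists_between (m.norm_lt s)
    exact ⟨r - ‖m.coord s‖, sub_pos.2 hr, by rwa [add_sub_cancel]⟩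
  have mem_ball (τ : Set.Icc 0 δ) : m.coord s + (τ : ℝ) • v ∈ Metric.ball (0 : E) 1 := by
    rw [mem_ball_zero_iff]
    calc ‖m.coord s + (τ : ℝ) • v‖ ≤ ‖m.coord s‖ + ‖(τ : ℝ) • v‖ := norm_add_le _ _
      _ = ‖m.coord s‖ + τ := by rw [norm_smul, hv, mul_one, Real.norm_of_nonneg τ.2.1]
      _ < 1 := by linarith [τ.2.2]
  let path : Set.Icc 0 δ → S := fun τ => m.point ⟨m.coord s + (τ : ℝ) • v, mem_ball τ⟩
  have continuous_path : Continuous path :=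
    (m.continuous_point hq).comp (Continuous.subtype_mk (by fun_prop) _)
  have coord_path (τ) : m.coord (path τ) = m.coord s + (τ : ℝ) • v := m.coord_point _
  have path_eq_iff (τ) : path τ = s ↔ (τ : ℝ) = 0 := by
    rw [← m.injective.eq_iff, coord_path, add_eq_left, smul_eq_zero,
      or_iff_left (norm_ne_zero_iff.1 (hv ▸ one_ne_zero))]
  let g : ℝ → ℝ := fun τ => dist s (path (Set.projIcc 0 δ hδ.le τ))
  have continuous_g : Continuous g :=
    continuous_const.dist (continuous_path.comp continuous_projIcc)
  have g_zero : g 0 = 0 := by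
    rw [dist_eq_zero, eq_comm, path_eq_iff, Set.projIcc_left]
  have g_pos : 0 < g δ := by
    rw [dist_pos, ne_comm, Ne, path_eq_iff, Set.projIcc_right]
    exact hδ.ne'
  refine ⟨g δ, g_pos, fun ε hε hεg => ?_⟩
  obtain ⟨τ, hτ, rfl⟩ := intermediate_value_Icc hδ.le continuous_g.continuousOn
    ⟨g_zero.trans_le hε.le, hεg.le⟩
  refine ⟨path ⟨τ, hτ⟩, τ, hτ.1.lt_of_ne ?_, coord_path _, ?_⟩
  · rintro rfl
    exact hε.ne' g_zero
  · simp only [g, Set.projIcc_of_mem hδ.le hτ]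

theorem exists_three_dist_eq (m : BallModel q S) (hq : Continuous fun p : E × E => q p.1 p.2)
    (hE : 2 ≤ Module.finrank ℝ E) (s : S) : ∃ ε₀ > 0, ∀ ε, 0 < ε → ε < ε₀ →
      ∃ t₁ t₂ t₃ : S, t₁ ≠ t₂ ∧ t₁ ≠ t₃ ∧ t₂ ≠ t₃ ∧
        dist s t₁ = ε ∧ dist s t₂ = ε ∧ dist s t₃ = ε := by
  have : FiniteDimensional ℝ E := Module.finite_of_finrank_pos (by lia)
  let basis := stdOrthonormalBasis ℝ E
  obtain ⟨u, v, hu, hv, huv⟩ : ∃ u v : E, ‖u‖ = 1 ∧ ‖v‖ = 1 ∧ ⟪u, v⟫ = 0 :=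
    ⟨basis ⟨0, by lia⟩, basis ⟨1, by lia⟩, basis.orthonormal.1 _, basis.orthonormal.1 _,
      basis.orthonormal.2 (by simp)⟩
  obtain ⟨ε₁, hε₁, H₁⟩ := m.exists_dist_eq hq s hu
  obtain ⟨ε₂, hε₂, H₂⟩ := m.exists_dist_eq hq s hv
  obtain ⟨ε₃, hε₃, H₃⟩ := m.exists_dist_eq hq s ((norm_neg u).trans hu)
  refine ⟨min ε₁ (min ε₂ ε₃), by positivity, fun ε hε hlt => ?_⟩
  simp only [lt_min_iff] at hlt
  obtain ⟨t₁, τ₁, hτ₁, hf₁, hd₁⟩ := H₁ ε hε hlt.1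
  obtain ⟨t₂, τ₂, -, hf₂, hd₂⟩ := H₂ ε hε hlt.2.1
  obtain ⟨t₃, τ₃, hτ₃, hf₃, hd₃⟩ := H₃ ε hε hlt.2.2
  have inner_self : ⟪u, u⟫ = 1 := by rw [real_inner_self_eq_norm_sq, hu, one_pow]
  have inner₁ : ⟪u, m.coord t₁⟫ = ⟪u, m.coord s⟫ + τ₁ := by
    rw [hf₁, inner_add_right, inner_smul_right, inner_self, mul_one]
  have inner₂ : ⟪u, m.coord t₂⟫ = ⟪u, m.coord s⟫ := by
    rw [hf₂, inner_add_right, inner_smul_right, huv, mul_zero, add_zero]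
  have inner₃ : ⟪u, m.coord t₃⟫ = ⟪u, m.coord s⟫ - τ₃ := by
    rw [hf₃, inner_add_right, inner_smul_right, inner_neg_right, inner_self, mul_neg_one,
      sub_eq_add_neg]
  refine ⟨t₁, t₂, t₃, ?_, ?_, ?_, hd₁, hd₂, hd₃⟩ <;> rintro rfl <;> linarith

theorem norm_sub_sq_le (m : BallModel q S) {s : S} {ξ : E} (hξ : ξ ∈ idealDirections q) {t : ℝ}
    (hs : m.coord s = t • ξ) (a : S) : ‖m.coord s - m.coord a‖ ^ 2 ≤
      2 * (Real.cosh (dist s a / m.scale) * √(1 - ‖m.coord s‖ ^ 2)) := by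
  have lower : (1 - ⟪m.coord s, m.coord a⟫) ^ 2 ≤
      1 - 2 * ⟪m.coord s, m.coord a⟫ + q (m.coord s) (m.coord a) := by
    have := hξ.2 t (m.coord a)
    rw [← hs, real_inner_comm, ← real_inner_smul_left, ← hs] at this
    linarith
  have upper : 1 - 2 * ⟪m.coord s, m.coord a⟫ + q (m.coord s) (m.coord a) ≤
      (Real.cosh (dist s a / m.scale) * √(1 - ‖m.coord s‖ ^ 2)) ^ 2 := by
    rw [m.pairing_eq, mul_pow, Real.sq_sqrt (m.one_sub_pos s).le]
    gcongr
    exact mul_le_of_le_one_right (m.one_sub_pos s).le (sub_le_self 1 (sq_nonneg _))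
  have one_sub_inner_le := (abs_le.1 (abs_le_of_sq_le_sq (lower.trans upper) (by positivity))).2
  rw [norm_sub_sq_real]
  nlinarith [m.one_sub_pos s, m.one_sub_pos a]

theorem mem_closure_of_coarselyDense (m : BallModel q S) {A : Set S} {R : ℝ}
    (hA : ∀ s, ∃ a ∈ A, dist s a ≤ R) {ξ : E} (hξ : ξ ∈ idealDirections q) :
    ξ ∈ closure (m.coord '' A) := by
  let bound (t : ℝ) : ℝ := |1 - t| + √(2 * (Real.cosh (R / m.scale) * √(1 - t ^ 2)))
  have bound_tendsto : Filter.Tendsto bound (𝓝[<] 1) (𝓝 0) := by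
    have : Continuous bound := by fun_prop
    simpa [bound] using (this.tendsto 1).mono_left nhdsWithin_le_nhds
  refine Metric.mem_closure_iff.2 fun ε hε => ?_
  obtain ⟨t, ht_bound, ht⟩ := ((bound_tendsto.eventually_lt_const hε).and
    (Ioo_mem_nhdsLT zero_lt_one)).exists
  have norm_smul_eq : ‖t • ξ‖ = t := by
    rw [norm_smul, hξ.1, mul_one, Real.norm_of_nonneg ht.1.le]
  obtain ⟨s, hs⟩ := m.exists_eq (norm_smul_eq.trans_lt ht.2)
  obtain ⟨a, ha, hsa⟩ := hA s
  have cosh_le : Real.cosh (dist s a / m.scale) ≤ Real.cosh (R / m.scale) := by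
    have := m.scale_pos
    rw [Real.cosh_le_cosh, abs_of_nonneg (by positivity),
      abs_of_nonneg (div_nonneg (dist_nonneg.trans hsa) this.le)]
    gcongr
  refine ⟨m.coord a, Set.mem_image_of_mem _ ha, lt_of_le_of_lt ?_ ht_bound⟩
  calc dist ξ (m.coord a) ≤ dist ξ (t • ξ) + dist (t • ξ) (m.coord a) := dist_triangle _ _ _
    _ ≤ |1 - t| + √(2 * (Real.cosh (R / m.scale) * √(1 - t ^ 2))) := by
      gcongr
      · rw [dist_eq_norm, ← one_smul ℝ ξ, smul_smul, mul_one, ← sub_smul, norm_smul, hξ.1,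
          mul_one, Real.norm_eq_abs]
      · rw [dist_eq_norm, ← hs]
        refine Real.le_sqrt_of_sq_le ((m.norm_sub_sq_le hξ hs a).trans ?_)
        rw [hs, norm_smul_eq]
        gcongr

/-- On the unit ball this is the function `cosh² d(s, ·)` up to a factor that does not depend
on `s`; it extends continuously to `E`. -/
noncomputable def potential (m : BallModel q S) (s : S) (y : E) : ℝ :=
  (1 - ‖m.coord s‖ ^ 2)⁻¹ * (1 - 2 * ⟪m.coord s, y⟫ + q (m.coord s) y)

theorem potential_coord (m : BallModel q S) (s a : S) :
    m.potential s (m.coord a) =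
      Real.cosh (dist s a / m.scale) ^ 2 * (1 - ‖m.coord a‖ ^ 2) := by
  rw [potential, m.pairing_eq, mul_left_comm, inv_mul_cancel_left₀ (m.one_sub_pos s).ne']

theorem continuous_potential (m : BallModel q S)
    (hq : Continuous fun p : E × E => q p.1 p.2) (s : S) : Continuous (m.potential s) := by
  have : Continuous (q (m.coord s)) := hq.comp (continuous_const.prodMk continuous_id)
  unfold potential
  fun_prop

theorem exists_finiteDimensional_potential (m : BallModel q S) [FiniteDimensional ℝ E]
    (hq : IsBallForm q) :
    ∃ W : Submodule ℝ (E → ℝ), FiniteDimensional ℝ W ∧ ∀ s, m.potential s ∈ W := by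
  obtain ⟨W, hW, hqW⟩ := hq.exists_finiteDimensional
  let innerFun : E →ₗ[ℝ] (E → ℝ) :=
    { toFun := fun x y => ⟪x, y⟫
      map_add' := fun x y => funext fun z => inner_add_left x y z
      map_smul' := fun r x => funext fun z => real_inner_smul_left x z r }
  refine ⟨W ⊔ LinearMap.range innerFun ⊔ Submodule.span ℝ {1}, inferInstance, fun s => ?_⟩
  have potential_eq : m.potential s =
      (1 - ‖m.coord s‖ ^ 2)⁻¹ • (1 - (2 : ℝ) • innerFun (m.coord s) + q (m.coord s)) := rfl
  rw [potential_eq]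
  have one_mem := Submodule.mem_sup_right (S := W ⊔ LinearMap.range innerFun)
    (Submodule.mem_span_singleton_self (R := ℝ) (1 : E → ℝ))
  have inner_mem := Submodule.mem_sup_left (T := Submodule.span ℝ {(1 : E → ℝ)})
    (Submodule.mem_sup_right (S := W) (LinearMap.mem_range_self innerFun (m.coord s)))
  have q_mem := Submodule.mem_sup_left (T := Submodule.span ℝ {(1 : E → ℝ)})
    (Submodule.mem_sup_left (T := LinearMap.range innerFun) (hqW (m.coord s)))
  exact Submodule.smul_mem _ _
    (Submodule.add_mem _ (Submodule.sub_mem _ one_mem (Submodule.smul_mem _ _ inner_mem)) q_mem)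

/-- Comparing the values at opposite ideal directions removes the quartic part. -/
theorem eq_of_potential_eqOn_idealDirections (m : BallModel q S) (hq : IsBallForm q) {s t : S}
    (h : Set.EqOn (m.potential s) (m.potential t) (idealDirections q)) : s = t := by
  refine m.injective (eq_of_inv_one_sub_norm_sq_smul_eq (m.norm_lt s) (m.norm_lt t) ?_)
  refine ext_inner_right ℝ fun z => ?_
  have hz : z ∈ Submodule.span ℝ (idealDirections q) := hq.span_idealDirections ▸ Submodule.mem_top
  refine LinearMap.eqOn_span (f := innerₗ E _) (g := innerₗ E _) (fun ξ hξ => ?_) hz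
  have at_ξ := h hξ
  have at_neg_ξ := h (neg_mem_idealDirections hξ)
  simp only [potential, hq.neg_right, inner_neg_right] at at_ξ at_neg_ξ
  simp only [innerₗ_apply_apply, real_inner_smul_left]
  linarith

theorem exists_finite_resolving (m : BallModel q S) [FiniteDimensional ℝ E] (hq : IsBallForm q)
    {A : Set S} {R : ℝ} (hA : ∀ s, ∃ a ∈ A, dist s a ≤ R) :
    ∃ F : Set S, F.Finite ∧ F ⊆ A ∧ ∀ s t, (∀ a ∈ F, dist s a = dist t a) → s = t := by
  obtain ⟨W, hW, hmW⟩ := m.exists_finiteDimensional_potential hq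
  obtain ⟨F, hF, hFA, hFW⟩ := exists_finite_evaluations W (m.coord '' A)
  refine ⟨m.coord ⁻¹' F, hF.preimage m.injective.injOn, ?_, fun s t hst => ?_⟩
  · intro a ha
    obtain ⟨a', ha', h⟩ := hFA ha
    exact m.injective h ▸ ha'
  have eqOn_image : Set.EqOn (m.potential s) (m.potential t) (m.coord '' A) := fun y hy => by
    refine sub_eq_zero.1 (hFW _ (W.sub_mem (hmW s) (hmW t)) (fun z hz => ?_) y hy)
    obtain ⟨a, -, rfl⟩ := hFA hz
    rw [Pi.sub_apply, potential_coord, potential_coord, hst a hz, sub_self]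
  refine m.eq_of_potential_eqOn_idealDirections hq fun ξ hξ => ?_
  exact eqOn_image.closure (m.continuous_potential hq.continuous s)
    (m.continuous_potential hq.continuous t) (m.mem_closure_of_coarselyDense hA hξ)

end BallModel

end BallModels

section Algebras

open scoped RealInnerProductSpace

/-- A product, a conjugation and a real part on a Euclidean space, related to its inner product as
on `ℝ`, `ℂ`, the quaternions and the octonions. The product need not be associative. -/
structure ConjugationAlgebra (A : Type*) [NormedAddCommGroup A] [InnerProductSpace ℝ A] where
  mul : A →ₗ[ℝ] A →ₗ[ℝ] A
  conj : A →ₗ[ℝ] A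
  re : A →ₗ[ℝ] ℝ
  one : A
  one_mul_one : mul one one = one
  re_one : re one = 1
  mul_conj : ∀ x, mul x (conj x) = ‖x‖ ^ 2 • one
  re_conj_mul : ∀ x y, re (mul (conj y) x) = ⟪x, y⟫

namespace ConjugationAlgebra

variable {A : Type*} [NormedAddCommGroup A] [InnerProductSpace ℝ A] (α : ConjugationAlgebra A)
  {n : ℕ}

/-- The quartic part of `pairingSqOver` on vectors over `A`. -/
def quarticForm (x y : PiLp 2 fun _ : Fin n => A) : ℝ :=
  ∑ i, ∑ j, α.re (α.mul (α.mul (x i) (α.conj (x j))) (α.mul (y j) (α.conj (y i))))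

theorem re_mul_conj_mul_mul_conj (x y : A) :
    α.re (α.mul (α.mul x (α.conj x)) (α.mul y (α.conj y))) = ‖x‖ ^ 2 * ‖y‖ ^ 2 := by
  simp only [mul_conj, map_smul, LinearMap.smul_apply, one_mul_one, re_one, smul_eq_mul, mul_one]
  ring

theorem re_mul_conj (x : A) : α.re (α.mul x (α.conj x)) = ‖x‖ ^ 2 := by
  rw [mul_conj, map_smul, re_one, smul_eq_mul, mul_one]

theorem quarticForm_smul_single (t : ℝ) (i : Fin n) (e : A) (a : PiLp 2 fun _ : Fin n => A) :
    α.quarticForm (t • PiLp.single 2 i e) a = t ^ 2 * (‖e‖ ^ 2 * ‖a i‖ ^ 2) := by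
  rw [quarticForm, Finset.sum_eq_single_of_mem i (Finset.mem_univ i),
    Finset.sum_eq_single_of_mem i (Finset.mem_univ i)]
  · rw [PiLp.smul_apply, PiLp.single_eq_same, re_mul_conj_mul_mul_conj, norm_smul, mul_pow,
      Real.norm_eq_abs, sq_abs, mul_assoc]
  · intro j _ hj
    simp [hj]
  · intro j _ hj
    exact Finset.sum_eq_zero fun k _ => by simp [hj]

theorem single_mem_idealDirections (i : Fin n) {e : A} (he : ‖e‖ = 1) :
    PiLp.single 2 i e ∈ idealDirections (α.quarticForm (n := n)) := by
  refine ⟨by rw [PiLp.norm_single, he], fun t a => ?_⟩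
  have inner_eq : ⟪a, PiLp.single 2 i e⟫ = ⟪a i, e⟫ := by
    rw [PiLp.inner_apply, Finset.sum_eq_single_of_mem i (Finset.mem_univ i), PiLp.single_eq_same]
    intro j _ hj
    rw [PiLp.single_eq_of_ne _ hj, inner_zero_right]
  have inner_sq_le : ⟪a i, e⟫ ^ 2 ≤ ‖a i‖ ^ 2 :=
    sq_le_sq' (neg_le_of_abs_le (by simpa [he] using abs_real_inner_le_norm (a i) e))
      (by simpa [he] using real_inner_le_norm (a i) e)
  rw [quarticForm_smul_single, he, one_pow, one_mul, mul_pow, inner_eq]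
  exact mul_le_mul_of_nonneg_left inner_sq_le (sq_nonneg t)

theorem span_idealDirections_quarticForm :
    Submodule.span ℝ (idealDirections (α.quarticForm (n := n))) = ⊤ := by
  refine eq_top_iff.2 fun x _ => ?_
  have x_eq : x = ∑ i, ‖x i‖ • PiLp.single 2 i (‖x i‖⁻¹ • x i) := by
    ext j
    rw [WithLp.ofLp_sum, Finset.sum_apply, Finset.sum_eq_single_of_mem j (Finset.mem_univ j)]
    · rw [PiLp.smul_apply, PiLp.single_eq_same]
      by_cases hj : x j = 0
      · simp [hj]
      · rw [smul_inv_smul₀ (norm_ne_zero_iff.2 hj)]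
    · intro i _ hi
      rw [PiLp.smul_apply, PiLp.single_eq_of_ne _ hi.symm, smul_zero]
  rw [x_eq]
  refine Submodule.sum_mem _ fun i _ => ?_
  by_cases hi : x i = 0
  · rw [hi, norm_zero, zero_smul]
    exact Submodule.zero_mem _
  · exact Submodule.smul_mem _ _ (Submodule.subset_span
      (α.single_mem_idealDirections i (norm_smul_inv_norm (𝕜 := ℝ) hi)))

include α in
theorem two_le_finrank_piLp [FiniteDimensional ℝ A] (hn : 2 ≤ n) :
    2 ≤ Module.finrank ℝ (PiLp 2 fun _ : Fin n => A) := by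
  have : Nontrivial A := nontrivial_of_ne α.one 0 fun h => by simpa [h] using α.re_one
  rw [(WithLp.linearEquiv 2 ℝ (Fin n → A)).finrank_eq, Module.finrank_pi_fintype,
    Finset.sum_const, Finset.card_univ, Fintype.card_fin, smul_eq_mul]
  exact hn.trans (Nat.le_mul_of_pos_right n Module.finrank_pos)

theorem isBallForm_quarticForm [FiniteDimensional ℝ A] :
    IsBallForm (α.quarticForm (n := n)) where
  continuous := by
    let mulL : A →L[ℝ] A →L[ℝ] A :=
      LinearMap.toContinuousLinearMap (LinearMap.toContinuousLinearMap.toLinearMap ∘ₗ α.mul)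
    let conjL : A →L[ℝ] A := LinearMap.toContinuousLinearMap α.conj
    let reL : A →L[ℝ] ℝ := LinearMap.toContinuousLinearMap α.re
    change Continuous fun p : (PiLp 2 fun _ : Fin n => A) × (PiLp 2 fun _ : Fin n => A) =>
      ∑ i, ∑ j, reL (mulL (mulL (p.1 i) (conjL (p.1 j))) (mulL (p.2 j) (conjL (p.2 i))))
    fun_prop
  neg_right x y := by simp [quarticForm]
  exists_finiteDimensional := by
    let ofMatrix : (Fin n → Fin n → A) →ₗ[ℝ] ((PiLp 2 fun _ : Fin n => A) → ℝ) :=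
      { toFun := fun M y => ∑ i, ∑ j, α.re (α.mul (M i j) (α.mul (y j) (α.conj (y i))))
        map_add' := fun M N => by ext y; simp [Finset.sum_add_distrib]
        map_smul' := fun r M => by ext y; simp [Finset.mul_sum] }
    exact ⟨LinearMap.range ofMatrix, inferInstance,
      fun x => ⟨fun i j => α.mul (x i) (α.conj (x j)), rfl⟩⟩
  span_idealDirections := α.span_idealDirections_quarticForm

theorem nonempty_ballModel {F : Type*} [Mul F] [Star F] {re : F → ℝ} (φ : F ≃ A)
    (map_mul : ∀ a b, φ (a * b) = α.mul (φ a) (φ b)) (map_star : ∀ a, φ (star a) = α.conj (φ a))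
    (map_re : ∀ a, re a = α.re (φ a)) {S : Type*} [MetricSpace S]
    (hS : IsHyperbolicSpaceOver re n S) :
    Nonempty (BallModel (α.quarticForm (n := n)) S) := by
  obtain ⟨c, f, hc, hf, hrange, hcosh⟩ := hS
  let Φ : (Fin n → F) ≃ PiLp 2 fun _ : Fin n => A :=
    (Equiv.piCongrRight fun _ => φ).trans (WithLp.equiv 2 _).symm
  have Φ_apply (x i) : Φ x i = φ (x i) := rfl
  have normSq_eq (x) : normSqOver re x = ‖Φ x‖ ^ 2 := by
    simp only [PiLp.norm_sq_eq_of_L2, normSqOver, map_re, map_mul, map_star, re_mul_conj, Φ_apply]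
  have pairingSq_eq (x y) : pairingSqOver re x y =
      1 - 2 * ⟪Φ x, Φ y⟫ + α.quarticForm (Φ x) (Φ y) := by
    simp only [PiLp.inner_apply, pairingSqOver, quarticForm, map_re, map_mul, map_star,
      re_conj_mul, Φ_apply]
  refine ⟨⟨c, fun s => Φ (f s), hc, Φ.injective.comp hf, ?_, fun s t => ?_⟩⟩
  · ext z
    obtain ⟨x, rfl⟩ := Φ.surjective z
    have mem_range_iff : Φ x ∈ Set.range (fun s => Φ (f s)) ↔ x ∈ Set.range f := by
      simp only [Set.mem_range, Φ.apply_eq_iff_eq]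
    rw [mem_range_iff, hrange, mem_ball_zero_iff, Set.mem_ofPred_eq, normSq_eq,
      sq_lt_one_iff₀ (norm_nonneg _)]
  · rw [hcosh, pairingSq_eq, normSq_eq, normSq_eq]

end ConjugationAlgebra

/-- The octonions as a Euclidean space: pairs of quaternions with the `L²` norm. -/
abbrev Octonion.L2 : Type := WithLp 2 (Quaternion ℝ × Quaternion ℝ)

namespace Octonion

/-- The identification of `Octonion` with a Euclidean space. -/
def equivL2 : Octonion ≃ L2 where
  toFun p := WithLp.toLp 2 (p.fst, p.snd)
  invFun p := ⟨p.fst, p.snd⟩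
  left_inv _ := rfl
  right_inv _ := rfl

/-- The structure of `Octonion`, transported to `Octonion.L2`. -/
noncomputable def conjugationAlgebra : ConjugationAlgebra L2 where
  mul := LinearMap.mk₂ ℝ
    (fun p q => WithLp.toLp 2
      (p.fst * q.fst - star q.snd * p.snd, q.snd * p.fst + p.snd * star q.fst))
    (fun p p' q => (WithLp.equiv 2 _).injective <| by
      simp only [WithLp.equiv_apply, WithLp.ofLp_add, Prod.mk_add_mk, WithLp.add_fst,
        WithLp.add_snd, add_mul, mul_add]
      exact congrArg₂ Prod.mk (by abel) (by abel))
    (fun r p q => (WithLp.equiv 2 _).injective (Prod.ext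
      (by simp [smul_sub]) (by simp [smul_add])))
    (fun p q q' => (WithLp.equiv 2 _).injective <| by
      simp only [WithLp.equiv_apply, WithLp.ofLp_add, Prod.mk_add_mk, WithLp.add_fst,
        WithLp.add_snd, star_add, add_mul,
        mul_add]
      exact congrArg₂ Prod.mk (by abel) (by abel))
    (fun r p q => (WithLp.equiv 2 _).injective (Prod.ext
      (by simp [smul_sub]) (by simp [smul_add])))
  conj :=
    { toFun := fun p => WithLp.toLp 2 (star p.fst, -p.snd)
      map_add' := fun p q => (WithLp.equiv 2 _).injective (Prod.ext (by simp)
        (neg_add p.snd q.snd))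
      map_smul' := fun r p => (WithLp.equiv 2 _).injective (Prod.ext (by simp) (by simp)) }
  re :=
    { toFun := fun p => p.fst.re
      map_add' := fun _ _ => rfl
      map_smul' := fun _ _ => rfl }
  one := WithLp.toLp 2 (1, 0)
  one_mul_one := (WithLp.equiv 2 _).injective (Prod.ext (by simp) (by simp))
  re_one := rfl
  mul_conj x := by
    refine (WithLp.equiv 2 _).injective (Prod.ext ?_ (by simp))
    change x.fst * star x.fst - star (-x.snd) * x.snd = ‖x‖ ^ 2 • (1 : Quaternion ℝ)
    rw [star_neg, neg_mul, sub_neg_eq_add, Quaternion.self_mul_star, Quaternion.star_mul_self,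
      ← Quaternion.coe_add, Quaternion.normSq_eq_norm_mul_self, Quaternion.normSq_eq_norm_mul_self,
      ← sq, ← sq, ← WithLp.prod_norm_sq_eq_of_L2, ← Quaternion.coe_mul_eq_smul, mul_one]
  re_conj_mul x y := by
    change (star y.fst * x.fst - star x.snd * -y.snd).re = _
    rw [WithLp.prod_inner_apply, Quaternion.inner_def, Quaternion.inner_def]
    simp only [mul_neg, sub_neg_eq_add, neg_mul, Quaternion.re_add, Quaternion.re_mul,
      Quaternion.re_star, Quaternion.imI_star, Quaternion.imJ_star, Quaternion.imK_star,
      WithLp.ofLp_fst, WithLp.ofLp_snd]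
    ring

end Octonion

/-- The real numbers with the trivial conjugation. -/
noncomputable def realConjugationAlgebra : ConjugationAlgebra ℝ where
  mul := LinearMap.mul ℝ ℝ
  conj := LinearMap.id
  re := LinearMap.id
  one := 1
  one_mul_one := one_mul 1
  re_one := rfl
  mul_conj x := by simp [sq]
  re_conj_mul x y := by simp [mul_comm]

/-- The complex numbers with complex conjugation. -/
noncomputable def complexConjugationAlgebra : ConjugationAlgebra ℂ where
  mul := LinearMap.mul ℝ ℂ
  conj := Complex.conjAe.toLinearMap
  re := Complex.reLm
  one := 1
  one_mul_one := one_mul 1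
  re_one := rfl
  mul_conj x := by simp [Complex.mul_conj, Complex.normSq_eq_norm_sq]
  re_conj_mul x y := by simp [Complex.inner]

/-- Hamilton's quaternions with their standard conjugation. -/
noncomputable def quaternionConjugationAlgebra : ConjugationAlgebra (Quaternion ℝ) where
  mul := LinearMap.mul ℝ (Quaternion ℝ)
  conj := ⟨⟨star, star_add⟩, Quaternion.star_smul⟩
  re := ⟨⟨fun a => a.re, fun _ _ => rfl⟩, fun _ _ => rfl⟩
  one := 1
  one_mul_one := one_mul 1
  re_one := rfl
  mul_conj x := by
    change x * star x = _
    rw [Quaternion.self_mul_star, Quaternion.normSq_eq_norm_mul_self, ← sq,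
      ← Quaternion.coe_mul_eq_smul, mul_one]
  re_conj_mul x y := by
    change (star y * x).re = _
    rw [Quaternion.inner_def, Quaternion.re_mul, Quaternion.re_mul]
    simp only [mul_neg, sub_neg_eq_add, neg_mul, Quaternion.re_star, Quaternion.imI_star,
      Quaternion.imJ_star, Quaternion.imK_star]
    ring

namespace IsRankOneSymmetricSpace

variable {S : Type*} [MetricSpace S]

theorem exists_ballModel (h : IsRankOneSymmetricSpace S) :
    ∃ (E : Type) (_ : NormedAddCommGroup E) (_ : InnerProductSpace ℝ E) (q : E → E → ℝ),
      2 ≤ Module.finrank ℝ E ∧ IsBallForm q ∧ Nonempty (BallModel q S) := by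
  obtain ⟨n, hn, h⟩ | ⟨n, hn, h⟩ | ⟨n, hn, h⟩ | h := h
  · exact ⟨_, _, _, _, realConjugationAlgebra.two_le_finrank_piLp hn,
      realConjugationAlgebra.isBallForm_quarticForm,
      realConjugationAlgebra.nonempty_ballModel (Equiv.refl ℝ) (fun _ _ => rfl) (fun _ => rfl)
        (fun _ => rfl) h⟩
  · exact ⟨_, _, _, _, complexConjugationAlgebra.two_le_finrank_piLp hn,
      complexConjugationAlgebra.isBallForm_quarticForm,
      complexConjugationAlgebra.nonempty_ballModel (Equiv.refl ℂ) (fun _ _ => rfl)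
        (fun _ => rfl) (fun _ => rfl) h⟩
  · exact ⟨_, _, _, _, quaternionConjugationAlgebra.two_le_finrank_piLp hn,
      quaternionConjugationAlgebra.isBallForm_quarticForm,
      quaternionConjugationAlgebra.nonempty_ballModel (Equiv.refl _) (fun _ _ => rfl)
        (fun _ => rfl) (fun _ => rfl) h⟩
  · exact ⟨_, _, _, _, Octonion.conjugationAlgebra.two_le_finrank_piLp le_rfl,
      Octonion.conjugationAlgebra.isBallForm_quarticForm,
      Octonion.conjugationAlgebra.nonempty_ballModel Octonion.equivL2 (fun _ _ => rfl)
        (fun _ => rfl) (fun _ => rfl) h⟩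

theorem nonempty (h : IsRankOneSymmetricSpace S) : Nonempty S := by
  obtain ⟨E, _, _, q, -, -, ⟨m⟩⟩ := h.exists_ballModel
  exact ⟨(m.exists_eq (x := 0) (by simp)).choose⟩

theorem preconnectedSpace (h : IsRankOneSymmetricSpace S) : PreconnectedSpace S := by
  obtain ⟨E, _, _, q, -, hq, ⟨m⟩⟩ := h.exists_ballModel
  exact m.preconnectedSpace hq.continuous

theorem exists_three_dist_eq (h : IsRankOneSymmetricSpace S) (s : S) :
    ∃ ε₀ > 0, ∀ ε, 0 < ε → ε < ε₀ → ∃ t₁ t₂ t₃ : S, t₁ ≠ t₂ ∧ t₁ ≠ t₃ ∧ t₂ ≠ t₃ ∧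
      dist s t₁ = ε ∧ dist s t₂ = ε ∧ dist s t₃ = ε := by
  obtain ⟨E, _, _, q, hE, hq, ⟨m⟩⟩ := h.exists_ballModel
  exact m.exists_three_dist_eq hq.continuous hE s

theorem exists_finite_resolving (h : IsRankOneSymmetricSpace S) {A : Set S} {R : ℝ}
    (hA : ∀ s, ∃ a ∈ A, dist s a ≤ R) :
    ∃ F : Set S, F.Finite ∧ F ⊆ A ∧ ∀ s t, (∀ a ∈ F, dist s a = dist t a) → s = t := by
  obtain ⟨E, _, _, q, hE, hq, ⟨m⟩⟩ := h.exists_ballModel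
  have : FiniteDimensional ℝ E := Module.finite_of_finrank_pos (by omega)
  exact m.exists_finite_resolving hq hA

end IsRankOneSymmetricSpace

end Algebras

section Decompositions

namespace IdealTreeOfSpaces

variable {X : Type*} [MetricSpace X] (D : IdealTreeOfSpaces X)

theorem edge_one_eq (d : D.tree.Dart) : D.edge d 1 = D.edge d.symm 0 := by
  rw [D.edge_symm, unitInterval.symm_zero]

theorem edge_one_mem (d : D.tree.Dart) : D.edge d 1 ∈ D.space d.snd := by
  rw [D.edge_one_eq]
  exact D.edge_zero_mem d.symm

theorem dist_edge (d : D.tree.Dart) (s t : unitInterval) :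
    dist (D.edge d s) (D.edge d t) = |(s : ℝ) - t| :=
  (D.edge_isometry d).dist_eq s t

theorem eq_of_mem_space {v w : D.V} {x : X} (hv : x ∈ D.space v) (hw : x ∈ D.space w) : v = w :=
  by_contra fun h => Set.disjoint_left.1 (D.space_disjoint v w h) hv hw

theorem space_nonempty (v : D.V) : (D.space v).Nonempty := by
  obtain ⟨x, hx⟩ | h := D.space_spec v
  · exact hx ▸ Set.singleton_nonempty x
  · exact Set.nonempty_coe_sort.1 h.nonempty

theorem isPreconnected_space (v : D.V) : IsPreconnected (D.space v) := by
  obtain ⟨x, hx⟩ | h := D.space_spec v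
  · exact hx ▸ isPreconnected_singleton
  · exact isPreconnected_iff_preconnectedSpace.2 h.preconnectedSpace

/-- The interior of the interval of an edge. -/
def openEdge (d : D.tree.Dart) : Set X := D.edge d '' Set.Ioo 0 1

theorem mem_openEdge {d : D.tree.Dart} {t : unitInterval} (ht₀ : t ≠ 0) (ht₁ : t ≠ 1) :
    D.edge d t ∈ D.openEdge d :=
  ⟨t, ⟨unitInterval.pos_iff_ne_zero.2 ht₀, unitInterval.lt_one_iff_ne_one.2 ht₁⟩, rfl⟩

theorem notMem_space_of_mem_openEdge {d : D.tree.Dart} {x : X} (hx : x ∈ D.openEdge d) (v : D.V) :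
    x ∉ D.space v := by
  obtain ⟨t, ⟨ht₀, ht₁⟩, rfl⟩ := hx
  exact D.edge_notMem d t ht₀ ht₁ v

theorem eq_zero_or_eq_one_of_edge_mem_space {d : D.tree.Dart} {t : unitInterval} {v : D.V}
    (h : D.edge d t ∈ D.space v) : (t = 0 ∧ v = d.fst) ∨ (t = 1 ∧ v = d.snd) := by
  rcases eq_or_ne t 0 with rfl | ht₀
  · exact Or.inl ⟨rfl, D.eq_of_mem_space h (D.edge_zero_mem d)⟩
  rcases eq_or_ne t 1 with rfl | ht₁
  · exact Or.inr ⟨rfl, D.eq_of_mem_space h (D.edge_one_mem d)⟩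
  · exact (D.notMem_space_of_mem_openEdge (D.mem_openEdge ht₀ ht₁) v h).elim

theorem exists_mem_openEdge {x : X} (hx : ∀ v, x ∉ D.space v) : ∃ d, x ∈ D.openEdge d := by
  obtain ⟨d, t, rfl⟩ := (D.cover x).resolve_left fun ⟨v, hv⟩ => hx v hv
  refine ⟨d, D.mem_openEdge ?_ ?_⟩
  · rintro rfl
    exact hx _ (D.edge_zero_mem d)
  · rintro rfl
    exact hx _ (D.edge_one_mem d)

theorem eq_or_eq_symm_of_edge_eq_edge {d d' : D.tree.Dart} {t t' : unitInterval}
    (ht : t ∈ Set.Ioo 0 1) (h : D.edge d t = D.edge d' t') :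
    (d' = d ∧ t' = t) ∨ (d' = d.symm ∧ t' = unitInterval.symm t) := by
  rcases (SimpleGraph.dart_edge_eq_iff d d').1 (D.edge_disjoint d t d' t' ht.1 ht.2 h)
    with rfl | rfl
  · exact Or.inl ⟨rfl, (D.edge_isometry d).injective h.symm⟩
  · rw [D.edge_symm] at h
    exact Or.inr ⟨(SimpleGraph.Dart.symm_symm _).symm, (D.edge_isometry d').injective h.symm⟩

theorem openEdge_symm (d : D.tree.Dart) : D.openEdge d.symm = D.openEdge d := by
  have symm_subset (d) : D.openEdge d.symm ⊆ D.openEdge d := by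
    rintro _ ⟨t, ⟨ht₀, ht₁⟩, rfl⟩
    rw [D.edge_symm]
    exact D.mem_openEdge (by simpa using ht₁.ne) (by simpa using ht₀.ne')
  exact (symm_subset d).antisymm (by simpa using symm_subset d.symm)

theorem openEdge_eq_of_mem {d d' : D.tree.Dart} {x : X} (hx : x ∈ D.openEdge d)
    (hx' : x ∈ D.openEdge d') : D.openEdge d = D.openEdge d' := by
  obtain ⟨t, ht, rfl⟩ := hx
  obtain ⟨t', -, ht'⟩ := hx'
  obtain ⟨rfl, -⟩ | ⟨rfl, -⟩ := D.eq_or_eq_symm_of_edge_eq_edge ht ht'.symm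
  · rfl
  · exact (D.openEdge_symm d).symm

theorem exists_glue {Y : Type*} (onSpace : D.V → X → Y) (onEdge : D.tree.Dart → unitInterval → Y)
    (onEdge_zero : ∀ d, onEdge d 0 = onSpace d.fst (D.edge d 0))
    (onEdge_symm : ∀ d t, onEdge d.symm t = onEdge d (unitInterval.symm t)) :
    ∃ f : X → Y, (∀ v, ∀ x ∈ D.space v, f x = onSpace v x) ∧
      ∀ d t, f (D.edge d t) = onEdge d t := by
  have onEdge_one (d) : onEdge d 1 = onSpace d.snd (D.edge d 1) := by
    rw [D.edge_one_eq, ← unitInterval.symm_zero, ← onEdge_symm]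
    exact onEdge_zero d.symm
  have exists_value (x) : ∃ y, (∀ v, x ∈ D.space v → y = onSpace v x) ∧
      ∀ d t, D.edge d t = x → y = onEdge d t := by
    by_cases hx : ∃ v, x ∈ D.space v
    · obtain ⟨v, hv⟩ := hx
      refine ⟨onSpace v x, fun w hw => by rw [D.eq_of_mem_space hv hw], ?_⟩
      rintro d t rfl
      obtain ⟨rfl, rfl⟩ | ⟨rfl, rfl⟩ := D.eq_zero_or_eq_one_of_edge_mem_space hv
      · exact (onEdge_zero d).symm
      · exact (onEdge_one d).symm
    · obtain ⟨d, t, ht, rfl⟩ := D.exists_mem_openEdge (not_exists.1 hx)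
      refine ⟨onEdge d t, fun v hv => (hx ⟨v, hv⟩).elim, fun d' t' h => ?_⟩
      obtain ⟨rfl, rfl⟩ | ⟨rfl, rfl⟩ := D.eq_or_eq_symm_of_edge_eq_edge ht h.symm
      · rfl
      · rw [onEdge_symm, unitInterval.symm_symm]
  choose f hf_space hf_edge using exists_value
  exact ⟨f, fun v x hx => hf_space x v hx, fun d t => hf_edge _ d t rfl⟩

theorem dist_le_of_pieces {Y : Type*} [PseudoMetricSpace Y] (f : X → Y)
    (le_on_space : ∀ v, ∀ x ∈ D.space v, ∀ y ∈ D.space v, dist (f x) (f y) ≤ dist x y)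
    (le_on_edge : ∀ d s t, dist (f (D.edge d s)) (f (D.edge d t)) ≤ dist s t) (x y : X) :
    dist (f x) (f y) ≤ dist x y := by
  obtain ⟨n, z, rfl, rfl, hz, hsum⟩ := D.exists_chain x y
  rw [← hsum]
  refine (dist_le_range_sum_dist (fun i => f (z i)) n).trans (Finset.sum_le_sum fun i hi => ?_)
  obtain ⟨v, hi, hi'⟩ | ⟨d, ⟨s, hs⟩, t, ht⟩ := hz i (Finset.mem_range.1 hi)
  · exact le_on_space v _ hi _ hi'
  · rw [← hs, ← ht, (D.edge_isometry d).dist_eq]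
    exact le_on_edge d s t

/-- Functions of this kind bound the distance of `X` from below. -/
theorem exists_lipschitz_extension (Φ : D.V → ℝ) (onEdge : D.tree.Dart → unitInterval → ℝ)
    (onEdge_zero : ∀ d, onEdge d 0 = Φ d.fst)
    (onEdge_symm : ∀ d t, onEdge d.symm t = onEdge d (unitInterval.symm t))
    (onEdge_lipschitz : ∀ d s t, |onEdge d s - onEdge d t| ≤ |(s : ℝ) - t|) :
    ∃ f : X → ℝ, (∀ v, ∀ x ∈ D.space v, f x = Φ v) ∧ (∀ d t, f (D.edge d t) = onEdge d t) ∧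
      ∀ x y, |f x - f y| ≤ dist x y := by
  obtain ⟨f, hf_space, hf_edge⟩ := D.exists_glue (fun v _ => Φ v) onEdge onEdge_zero onEdge_symm
  refine ⟨f, hf_space, hf_edge, D.dist_le_of_pieces f ?_ ?_⟩
  · intro v x hx y hy
    rw [hf_space v x hx, hf_space v y hy, dist_self]
    exact dist_nonneg
  · intro d s t
    rw [hf_edge, hf_edge]
    exact onEdge_lipschitz d s t

theorem exists_affine_extension (Φ : D.V → ℝ) (hΦ : ∀ d : D.tree.Dart, |Φ d.snd - Φ d.fst| ≤ 1) :
    ∃ f : X → ℝ, (∀ v, ∀ x ∈ D.space v, f x = Φ v) ∧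
      (∀ d (t : unitInterval), f (D.edge d t) = (1 - (t : ℝ)) * Φ d.fst + t * Φ d.snd) ∧
      ∀ x y, |f x - f y| ≤ dist x y := by
  refine D.exists_lipschitz_extension Φ (fun d t => (1 - (t : ℝ)) * Φ d.fst + t * Φ d.snd)
    (fun d => by simp) (fun d t => ?_) (fun d s t => ?_)
  · rw [unitInterval.coe_symm_eq, sub_sub_cancel, add_comm]
    rfl
  · have sub_eq : (1 - (s : ℝ)) * Φ d.fst + s * Φ d.snd - ((1 - (t : ℝ)) * Φ d.fst + t * Φ d.snd) =
        (s - t) * (Φ d.snd - Φ d.fst) := by ring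
    rw [sub_eq, abs_mul]
    exact mul_le_of_le_one_right (abs_nonneg _) (hΦ d)

theorem abs_min_add_sub_min_add_le (a b s t : ℝ) :
    |min (a + s) (b + (1 - s)) - min (a + t) (b + (1 - t))| ≤ |s - t| := by
  refine (abs_min_sub_min_le_max _ _ _ _).trans (max_le (by rw [add_sub_add_left_eq_sub]) ?_)
  rw [add_sub_add_left_eq_sub, sub_sub_sub_cancel_left, abs_sub_comm]

theorem exists_vertex_bump (v : D.V) : ∃ f : X → ℝ, (∀ x ∈ D.space v, f x = 1) ∧
    (∀ w ≠ v, ∀ x ∈ D.space w, f x = 0) ∧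
    (∀ d : D.tree.Dart, d.fst ≠ v → d.snd ≠ v → ∀ t, f (D.edge d t) = 0) ∧
    ∀ x y, |f x - f y| ≤ dist x y := by
  classical
  obtain ⟨f, hf_space, hf_edge, hf⟩ := D.exists_affine_extension (fun u => if u = v then 1 else 0)
    (fun d => by split_ifs <;> norm_num)
  exact ⟨f, fun x hx => by simp [hf_space v x hx], fun w hw x hx => by simp [hf_space w x hx, hw],
    fun d h₁ h₂ t => by simp [hf_edge, h₁, h₂], hf⟩

theorem one_le_dist {v w : D.V} (hvw : v ≠ w) {x y : X} (hx : x ∈ D.space v) (hy : y ∈ D.space w) :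
    1 ≤ dist x y := by
  obtain ⟨f, hf_one, hf_zero, -, hf⟩ := D.exists_vertex_bump v
  simpa [hf_one x hx, hf_zero w hvw.symm y hy] using hf x y

theorem one_le_dist_edge {v : D.V} {x : X} (hx : x ∈ D.space v) {d : D.tree.Dart}
    (hfst : d.fst ≠ v) (hsnd : d.snd ≠ v) (t : unitInterval) : 1 ≤ dist x (D.edge d t) := by
  obtain ⟨f, hf_one, -, hf_zero, hf⟩ := D.exists_vertex_bump v
  simpa [hf_one x hx, hf_zero d hfst hsnd] using hf x (D.edge d t)

theorem exists_edge_bump (d : D.tree.Dart) : ∃ f : X → ℝ,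
    (∀ t : unitInterval, f (D.edge d t) = min (t : ℝ) (1 - t)) ∧ (∀ x ∉ D.openEdge d, f x = 0) ∧
      ∀ x y, |f x - f y| ≤ dist x y := by
  classical
  obtain ⟨f, hf_space, hf_edge, hf⟩ := D.exists_lipschitz_extension (fun _ => 0)
    (fun d' t => if d'.edge = d.edge then min (t : ℝ) (1 - t) else 0)
    (fun d' => by simp)
    (fun d' t => by simp [min_comm])
    (fun d' s t => by
      split_ifs
      · simpa using abs_min_add_sub_min_add_le 0 0 s t
      · simp)
  refine ⟨f, fun t => by simp [hf_edge], fun x hx => ?_, hf⟩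
  by_cases hv : ∃ v, x ∈ D.space v
  · obtain ⟨v, hv⟩ := hv
    exact hf_space v x hv
  · obtain ⟨d', hd'⟩ := D.exists_mem_openEdge (not_exists.1 hv)
    obtain ⟨t, -, rfl⟩ := id hd'
    rw [hf_edge, if_neg]
    intro h
    obtain rfl | rfl := (SimpleGraph.dart_edge_eq_iff d' d).1 h
    · exact hx hd'
    · exact hx (by rwa [D.openEdge_symm] at hd')

theorem min_le_dist {d : D.tree.Dart} (t : unitInterval) {y : X} (hy : y ∉ D.openEdge d) :
    min (t : ℝ) (1 - t) ≤ dist (D.edge d t) y := by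
  obtain ⟨f, hf_edge, hf_zero, hf⟩ := D.exists_edge_bump d
  simpa [hf_edge, hf_zero y hy] using (le_abs_self _).trans (hf (D.edge d t) y)

theorem isOpen_openEdge (d : D.tree.Dart) : IsOpen (D.openEdge d) := by
  refine Metric.isOpen_iff.2 ?_
  rintro _ ⟨t, ⟨ht₀, ht₁⟩, rfl⟩
  refine ⟨min (t : ℝ) (1 - t), lt_min ht₀ (sub_pos.2 ht₁), fun y hy => ?_⟩
  by_contra h
  exact (D.min_le_dist t h).not_gt (Metric.mem_ball'.1 hy)

end IdealTreeOfSpaces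

theorem finite_setOf_mem_closedBall {X : Type*} [PseudoMetricSpace X] [ProperSpace X] {ι : Type*}
    (p : ι → X) {ε : ℝ} (hε : 0 < ε) (hp : ∀ i j, i ≠ j → ε ≤ dist (p i) (p j)) (x : X) (R : ℝ) :
    {i | p i ∈ Metric.closedBall x R}.Finite := by
  obtain ⟨t, -, ht, hcover⟩ := (isCompact_closedBall x R).finite_cover_balls (half_pos hε)
  have subsingleton (y) : {i | p i ∈ Metric.ball y (ε / 2)}.Subsingleton := by
    intro i hi j hj
    by_contra hij
    have := dist_triangle_right (p i) (p j) y
    linarith [hp i j hij, Metric.mem_ball.1 hi, Metric.mem_ball.1 hj]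
  refine (ht.biUnion fun y _ => (subsingleton y).finite).subset fun i hi => ?_
  simpa using hcover hi

namespace IdealTreeOfSpaces

variable {X : Type*} [MetricSpace X] (D : IdealTreeOfSpaces X)

theorem finite_vertices [ProperSpace X] (x : X) (R : ℝ) :
    {v | (D.space v ∩ Metric.closedBall x R).Nonempty}.Finite := by
  have exists_point (v) : ∃ y ∈ D.space v,
      (D.space v ∩ Metric.closedBall x R).Nonempty → y ∈ Metric.closedBall x R := by
    by_cases h : (D.space v ∩ Metric.closedBall x R).Nonempty
    · exact ⟨h.some, h.some_mem.1, fun _ => h.some_mem.2⟩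
    · exact ⟨_, (D.space_nonempty v).some_mem, fun h' => (h h').elim⟩
  choose p hp_space hp_ball using exists_point
  exact (finite_setOf_mem_closedBall p one_pos
    (fun v w hvw => D.one_le_dist hvw (hp_space v) (hp_space w)) x R).subset hp_ball

theorem finite_darts [ProperSpace X] (x : X) (R : ℝ) :
    {d | D.edge d 0 ∈ Metric.closedBall x R}.Finite := by
  refine Set.Finite.of_finite_image (f := SimpleGraph.Dart.toProd) ?_
    (SimpleGraph.Dart.toProd_injective.injOn)
  refine ((D.finite_vertices x R).prod (D.finite_vertices x (R + 1))).subset ?_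
  rintro _ ⟨d, hd, rfl⟩
  refine ⟨⟨_, D.edge_zero_mem d, hd⟩, _, D.edge_one_mem d, ?_⟩
  have dist_one_zero : dist (D.edge d 1) (D.edge d 0) = 1 := by simp [D.dist_edge]
  have hd : dist (D.edge d 0) x ≤ R := hd
  have : dist (D.edge d 1) x ≤ R + 1 := by
    linarith [dist_triangle (D.edge d 1) (D.edge d 0) x]
  exact this

end IdealTreeOfSpaces

end Decompositions

section Line

/-- A point near which the space is an open interval, in the sense that all small spheres consist
of two points. -/
def IsLinearPoint {X : Type*} [MetricSpace X] (x : X) : Prop :=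
  ∃ ε₀ > 0, ∀ ε, 0 < ε → ε < ε₀ → (Metric.sphere x ε).ncard = 2

theorem isLinearPoint_apply_iff {X : Type*} [MetricSpace X] (g : X ≃ᵢ X) {x : X} :
    IsLinearPoint (g x) ↔ IsLinearPoint x := by
  simp only [IsLinearPoint, ← g.image_sphere, Set.ncard_image_of_injective _ g.injective]

theorem IsRankOneSymmetricSpace.not_isLinearPoint {X : Type*} [MetricSpace X] {S : Set X}
    (hS : IsRankOneSymmetricSpace S) {x : X} (hx : x ∈ S) : ¬ IsLinearPoint x := by
  rintro ⟨ε₀, hε₀, two_points⟩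
  obtain ⟨ε₁, hε₁, three_points⟩ := hS.exists_three_dist_eq ⟨x, hx⟩
  obtain ⟨ε, hε, hlt⟩ := exists_between (lt_min hε₀ hε₁)
  have ncard_sphere := two_points ε hε (hlt.trans_le (min_le_left _ _))
  obtain ⟨t₁, t₂, t₃, h₁₂, h₁₃, h₂₃, dist_eq⟩ :=
    three_points ε hε (hlt.trans_le (min_le_right _ _))
  have subset_sphere : ({t₁.1, t₂.1, t₃.1} : Set X) ⊆ Metric.sphere x ε := by
    simpa [Set.insert_subset_iff, dist_comm, Subtype.dist_eq] using dist_eq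
  have ncard_le := Set.ncard_le_ncard subset_sphere
    (Set.finite_of_ncard_ne_zero (by rw [ncard_sphere]; exact two_ne_zero))
  rw [Set.ncard_eq_three.2 ⟨_, _, _, Subtype.coe_ne_coe.2 h₁₂, Subtype.coe_ne_coe.2 h₁₃,
    Subtype.coe_ne_coe.2 h₂₃, rfl⟩, ncard_sphere] at ncard_le
  omega

theorem exists_successor {V : Type*} {T : SimpleGraph V} (hT : T.IsTree)
    (h2 : ∀ v, (T.neighborSet v).ncard = 2) :
    ∃ r : V → V, (∀ v, T.Adj v (r v)) ∧ ∀ v w, T.Adj v w → (w = r v ↔ r w ≠ v) := by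
  have exists_ne (v w : V) : ∃ t : T.neighborSet v, t.1 ≠ w := by
    obtain ⟨t, ht, hne⟩ := Set.exists_ne_of_one_lt_ncard (by rw [h2 v]; exact one_lt_two) w
    exact ⟨⟨t, ht⟩, hne⟩
  obtain ⟨v₀⟩ := hT.nonempty
  obtain ⟨σ, -, hσ⟩ := exists_section_of_isTree hT (St := fun v => T.neighborSet v)
    (R := fun u w s t => w = s.1 ↔ t.1 ≠ u)
    (fun u w _ s t h => (eq_comm.trans (not_iff_comm.1 h.symm).symm).trans (not_congr eq_comm))
    (fun u w huw s => by
      by_cases hw : w = s.1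
      · obtain ⟨t, ht⟩ := exists_ne w u
        exact ⟨t, by simp [hw, ht]⟩
      · exact ⟨⟨u, huw.symm⟩, by simp [hw]⟩) v₀ (exists_ne v₀ v₀).choose
  exact ⟨fun v => σ v, fun v => (σ v).2, hσ⟩

theorem isAcyclic_hasse_int : (SimpleGraph.hasse ℤ).IsAcyclic := by
  refine isAcyclic_of_height Int.natAbs ?_ ?_ <;>
    simp only [SimpleGraph.hasse_adj, Order.covBy_iff_add_one_eq] <;> omega

theorem exists_successor_height {V : Type*} {T : SimpleGraph V} (hT : T.IsTree)
    (h2 : ∀ v, (T.neighborSet v).ncard = 2) : ∃ (r : V → V) (n : V → ℤ), (∀ u, T.Adj u (r u)) ∧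
      (∀ u, n (r u) = n u + 1) ∧ ∀ u w, T.Adj u w → w ≠ r u → n u = n w + 1 := by
  obtain ⟨r, adj_r, hr⟩ := exists_successor hT h2
  obtain ⟨v₀⟩ := hT.nonempty
  obtain ⟨n, -, hn⟩ := exists_section_of_isTree hT (St := fun _ => ℤ)
    (R := fun u w s t => (w = r u → t = s + 1) ∧ (u = r w → s = t + 1))
    (fun _ _ _ _ _ h => h.symm)
    (fun u w huw s => by
      by_cases hw : w = r u
      · exact ⟨s + 1, fun _ => rfl, fun hu => ((hr u w huw).1 hw hu.symm).elim⟩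
      · exact ⟨s - 1, fun hw' => (hw hw').elim, fun _ => (sub_add_cancel s 1).symm⟩) v₀ 0
  exact ⟨r, n, adj_r, fun u => (hn u _ (adj_r u)).1 rfl, fun u w huw hw =>
    (hn u w huw).2 (not_not.1 fun hu => hw ((hr u w huw).2 fun h => hu h.symm))⟩

theorem nonempty_iso_hasse_int {V : Type*} {T : SimpleGraph V} (hT : T.IsTree)
    (h2 : ∀ v, (T.neighborSet v).ncard = 2) : Nonempty (T ≃g SimpleGraph.hasse ℤ) := by
  obtain ⟨r, n, adj_r, n_next, n_prev⟩ := exists_successor_height hT h2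
  have prev_unique {u w w'} (huw : T.Adj u w) (huw' : T.Adj u w') (hw : w ≠ r u)
      (hw' : w' ≠ r u) : w = w' := by
    obtain ⟨a, b, -, hab⟩ := Set.ncard_eq_two.1 (h2 u)
    have mem_pair {z} (hz : T.Adj u z) : z = a ∨ z = b := by
      simpa [hab] using (T.mem_neighborSet u z).2 hz
    grind [mem_pair huw, mem_pair huw', mem_pair (adj_r u)]
  let f : T →g SimpleGraph.hasse ℤ := ⟨n, fun {u w} huw => by
    rw [SimpleGraph.hasse_adj, Order.covBy_iff_add_one_eq, Order.covBy_iff_add_one_eq]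
    by_cases hw : w = r u
    · exact Or.inl (hw ▸ n_next u).symm
    · exact Or.inr (n_prev u w huw hw).symm⟩
  have injOn (u) : Set.InjOn f (T.neighborSet u) := by
    intro w hw w' hw' (h : n w = n w')
    by_cases h₁ : w = r u <;> by_cases h₂ : w' = r u
    · exact h₁.trans h₂.symm
    · linarith [h₁ ▸ n_next u, n_prev u w' hw' h₂]
    · linarith [n_prev u w hw h₁, h₂ ▸ n_next u]
    · exact prev_unique hw hw' h₁ h₂
  have surjOn (u) : Set.SurjOn f (T.neighborSet u) ((SimpleGraph.hasse ℤ).neighborSet (f u)) := by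
    intro k hk
    rw [SimpleGraph.mem_neighborSet, SimpleGraph.hasse_adj, Order.covBy_iff_add_one_eq,
      Order.covBy_iff_add_one_eq] at hk
    obtain hk | hk := hk
    · exact ⟨r u, adj_r u, (n_next u).trans hk⟩
    · obtain ⟨w, hw, hne⟩ := Set.exists_ne_of_one_lt_ncard (by rw [h2 u]; exact one_lt_two) (r u)
      exact ⟨w, hw, add_right_cancel ((n_prev u w hw hne).symm.trans hk.symm)⟩
  have injective := injective_of_injOn_neighborSet hT isAcyclic_hasse_int injOn
  have := hT.nonempty
  have surjective := surjective_of_surjOn_neighborSet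
    (SimpleGraph.hasse_preconnected_of_succ ℤ) surjOn
  refine ⟨⟨Equiv.ofBijective f ⟨injective, surjective⟩, fun {u w} => ⟨fun h => ?_, f.map_adj⟩⟩⟩
  obtain ⟨w', hw', h⟩ := surjOn u h
  exact injective h ▸ hw'

theorem dist_intervals_le {X : Type*} [PseudoMetricSpace X] {c : ℤ → unitInterval → X}
    (hc : ∀ k, Isometry (c k)) (glue : ∀ k, c k 1 = c (k + 1) 0) (k : ℤ) (s : unitInterval)
    (n : ℕ) : dist (c k s) (c (k + n) 1) ≤ n + (1 - s) := by
  induction n with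
  | zero =>
    simp [(hc k).dist_eq, Subtype.dist_eq, Real.dist_eq, abs_of_nonpos (sub_nonpos.2 s.2.2)]
  | succ n ih =>
    have unit_length (l : ℤ) : dist (c l 0) (c l 1) = 1 := by
      simp [(hc l).dist_eq, Subtype.dist_eq, Real.dist_eq]
    rw [Nat.cast_succ, Nat.cast_succ, ← add_assoc]
    have := dist_triangle (c k s) (c (k + n) 1) (c (k + n + 1) 1)
    rw [glue (k + n), unit_length] at this
    rw [glue (k + n)] at ih
    linarith

theorem nonempty_isometryEquiv_real_of_intervals {X : Type*} [MetricSpace X]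
    {c : ℤ → unitInterval → X} (hc : ∀ k, Isometry (c k)) (glue : ∀ k, c k 1 = c (k + 1) 0)
    (cover : ∀ x, ∃ k t, c k t = x) {F : X → ℝ} (hF : ∀ x y, |F x - F y| ≤ dist x y)
    (hFc : ∀ k t, F (c k t) = k + t) : Nonempty (X ≃ᵢ ℝ) := by
  have dist_le {x y : X} (hxy : F x ≤ F y) : dist x y ≤ F y - F x := by
    obtain ⟨k, s, rfl⟩ := cover x
    obtain ⟨l, t, rfl⟩ := cover y
    rw [hFc, hFc] at hxy ⊢
    obtain hlk | rfl | hkl := lt_trichotomy l k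
    · have hlk' : (l : ℝ) + 1 ≤ k := by exact_mod_cast hlk
      have hs : s = 0 := Subtype.ext (show (s : ℝ) = 0 by linarith [s.2.1, t.2.2])
      have ht : t = 1 := Subtype.ext (show (t : ℝ) = 1 by linarith [s.2.1, t.2.2])
      obtain rfl : k = l + 1 := by
        have : (k : ℝ) ≤ l + 1 := by linarith [s.2.1, t.2.2]
        exact le_antisymm (by exact_mod_cast this) hlk
      subst hs ht
      simp [glue]
    · rw [(hc l).dist_eq, Subtype.dist_eq, Real.dist_eq, abs_of_nonpos] <;> linarith
    · obtain ⟨n, rfl⟩ : ∃ n : ℕ, l = k + n + 1 := ⟨(l - k - 1).toNat, by omega⟩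
      have last : dist (c (k + n) 1) (c (k + n + 1) t) = t := by
        simp [glue, (hc _).dist_eq, Subtype.dist_eq, Real.dist_eq, abs_of_nonneg t.2.1]
      have := dist_triangle (c k s) (c (k + n) 1) (c (k + n + 1) t)
      push_cast
      linarith [dist_intervals_le hc glue k s n]
  have isometry : Isometry F := by
    refine Isometry.of_dist_eq fun x y => le_antisymm (hF x y) ?_
    rw [Real.dist_eq]
    obtain hxy | hxy := le_total (F x) (F y)
    · exact abs_sub_comm (F x) _ ▸ (dist_le hxy).trans (le_abs_self _)
    · exact dist_comm x y ▸ (dist_le hxy).trans (le_abs_self _)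
  refine ⟨⟨Equiv.ofBijective F ⟨isometry.injective, fun r => ?_⟩, isometry⟩⟩
  exact ⟨c ⌊r⌋ ⟨Int.fract r, Int.fract_nonneg r, (Int.fract_lt_one r).le⟩,
    (hFc _ _).trans (Int.floor_add_fract r)⟩

namespace IdealTreeOfSpaces

variable {X : Type*} [MetricSpace X] (D : IdealTreeOfSpaces X)

theorem isLinearPoint_of_mem_openEdge {d : D.tree.Dart} {x : X} (hx : x ∈ D.openEdge d) :
    IsLinearPoint x := by
  obtain ⟨t, ⟨ht₀, ht₁⟩, rfl⟩ := hx
  refine ⟨min (t : ℝ) (1 - t), lt_min ht₀ (sub_pos.2 ht₁), fun ε hε hlt => ?_⟩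
  have near {y} (hy : dist (D.edge d t) y = ε) : y ∈ D.openEdge d := by
    by_contra h
    exact (D.min_le_dist t h).not_gt (hy.trans_lt hlt)
  obtain ⟨hεt, hεt'⟩ := lt_min_iff.1 hlt
  let a : unitInterval := ⟨t - ε, by linarith, by linarith⟩
  let b : unitInterval := ⟨t + ε, by linarith, by linarith⟩
  have hab : a ≠ b := fun h => by linarith [show (t : ℝ) - ε = t + ε from congrArg Subtype.val h]
  refine Set.ncard_eq_two.2 ⟨_, _, (D.edge_isometry d).injective.ne hab, ?_⟩
  ext y
  rw [Metric.mem_sphere']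
  constructor
  · intro hy
    obtain ⟨s, -, rfl⟩ := near hy
    rw [D.dist_edge, abs_eq hε.le] at hy
    obtain h | h := hy
    · exact Or.inl (congrArg _ (Subtype.ext (show (s : ℝ) = t - ε by linarith)))
    · exact Or.inr (congrArg _ (Subtype.ext (show (s : ℝ) = t + ε by linarith)))
  · rintro (rfl | rfl) <;> simp [D.dist_edge, a, b, abs_of_pos hε]

theorem sphere_subset_image_edge {v : D.V} {x : X} (hv : D.space v = {x}) {t : unitInterval}
    (ht₀ : 0 < t) (ht₁ : t < 1) {y : X} (hy : y ∈ Metric.sphere x t) :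
    ∃ d : D.tree.Dart, d.fst = v ∧ D.edge d t = y := by
  have hxv : x ∈ D.space v := hv ▸ Set.mem_singleton x
  rw [Metric.mem_sphere'] at hy
  have hy_space (w) : y ∉ D.space w := by
    intro hw
    obtain rfl | hvw := eq_or_ne v w
    · rw [hv] at hw
      rw [Set.mem_singleton_iff.1 hw, dist_self] at hy
      exact (show (0 : ℝ) < t from ht₀).ne hy
    · exact (D.one_le_dist hvw hxv hw).not_gt (hy.trans_lt ht₁)
  obtain ⟨d, s, -, rfl⟩ := D.exists_mem_openEdge hy_space
  have eq_of_fst {d : D.tree.Dart} {s : unitInterval} (hd : d.fst = v)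
      (h : dist x (D.edge d s) = t) : D.edge d t = D.edge d s := by
    have edge_zero := D.edge_zero_mem d
    rw [hd, hv, Set.mem_singleton_iff] at edge_zero
    rw [← edge_zero, D.dist_edge] at h
    congr 1
    exact Subtype.ext (by simpa [abs_of_nonneg s.2.1] using h.symm)
  by_cases hfst : d.fst = v
  · exact ⟨d, hfst, eq_of_fst hfst hy⟩
  by_cases hsnd : d.snd = v
  · have edge_eq : D.edge d s = D.edge d.symm (unitInterval.symm s) := by
      rw [D.edge_symm, unitInterval.symm_symm]
    rw [edge_eq] at hy ⊢
    exact ⟨d.symm, hsnd, eq_of_fst hsnd hy⟩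
  · exact ((D.one_le_dist_edge hxv hfst hsnd s).not_gt (hy.trans_lt ht₁)).elim

theorem ncard_neighborSet_eq_two {v : D.V} {x : X} (hv : D.space v = {x})
    (hx : IsLinearPoint x) : (D.tree.neighborSet v).ncard = 2 := by
  obtain ⟨ε₀, hε₀, ncard_sphere⟩ := hx
  obtain ⟨ε, hε, hlt⟩ := exists_between (lt_min hε₀ one_pos)
  obtain ⟨hlt, hε₁⟩ := lt_min_iff.1 hlt
  lift ε to unitInterval using ⟨hε.le, hε₁.le⟩
  rw [← ncard_sphere ε hε hlt]
  refine Set.ncard_congr (fun w hw => D.edge ⟨(v, w), hw⟩ ε) (fun w hw => ?_) ?_ ?_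
  · have edge_zero := D.edge_zero_mem ⟨(v, w), hw⟩
    rw [show D.space _ = {x} from hv, Set.mem_singleton_iff] at edge_zero
    rw [Metric.mem_sphere', ← edge_zero, D.dist_edge]
    simp [abs_of_pos hε]
  · intro w w' hw hw' h
    obtain ⟨h, -⟩ | ⟨h, -⟩ := D.eq_or_eq_symm_of_edge_eq_edge ⟨hε, hε₁⟩ h
    · exact congrArg (·.snd) h.symm
    · exact (hw.ne (congrArg (·.fst) h)).elim
  · intro y hy
    obtain ⟨d, rfl, rfl⟩ := D.sphere_subset_image_edge hv hε hε₁ hy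
    exact ⟨d.snd, d.adj, rfl⟩

theorem nonempty_isometryEquiv_real (D : IdealTreeOfSpaces X) (h : ∀ x : X, IsLinearPoint x) :
    Nonempty (X ≃ᵢ ℝ) := by
  have exists_point (v) : ∃ x, D.space v = {x} := (D.space_spec v).resolve_right fun hv => by
    obtain ⟨x, hx⟩ := D.space_nonempty v
    exact hv.not_isLinearPoint hx (h x)
  choose pt space_eq using exists_point
  have eq_pt {v x} (hx : x ∈ D.space v) : x = pt v := by rwa [space_eq v] at hx
  obtain ⟨e⟩ := nonempty_iso_hasse_int D.isTree fun v =>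
    D.ncard_neighborSet_eq_two (space_eq v) (h _)
  have adj_iff (v w) : D.tree.Adj v w ↔ e v + 1 = e w ∨ e w + 1 = e v := by
    rw [← e.map_adj_iff, SimpleGraph.hasse_adj, Order.covBy_iff_add_one_eq,
      Order.covBy_iff_add_one_eq]
  let d (k : ℤ) : D.tree.Dart := ⟨(e.symm k, e.symm (k + 1)), (adj_iff _ _).2 (by simp)⟩
  have eq_d {d' : D.tree.Dart} (hd' : e d'.fst + 1 = e d'.snd) : d (e d'.fst) = d' :=
    SimpleGraph.Dart.ext _ _ (Prod.ext (by simp [d]) (by simp [d, hd']))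
  obtain ⟨F, -, F_edge, hF⟩ := D.exists_affine_extension (fun v => (e v : ℝ)) fun d' => by
    obtain h | h := (adj_iff _ _).1 d'.adj <;> simp [← h]
  refine nonempty_isometryEquiv_real_of_intervals (c := fun k => D.edge (d k))
    (fun k => D.edge_isometry _) (fun k => ?_) (fun x => ?_) hF (fun k t => ?_)
  · exact (eq_pt (D.edge_one_mem (d k))).trans (eq_pt (D.edge_zero_mem (d (k + 1)))).symm
  · obtain ⟨v, hv⟩ | ⟨d', t, rfl⟩ := D.cover x
    · exact ⟨e v, 0, (eq_pt (D.edge_zero_mem _)).trans (by simp [d, eq_pt hv])⟩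
    · obtain h | h := (adj_iff _ _).1 d'.adj
      · exact ⟨_, t, by rw [eq_d h]⟩
      · refine ⟨e d'.symm.fst, unitInterval.symm t, ?_⟩
        rw [eq_d (d' := d'.symm) h, D.edge_symm, unitInterval.symm_symm]
  · simp only [F_edge, d, RelIso.apply_symm_apply]
    push_cast
    ring

end IdealTreeOfSpaces

end Line

section Invariance

/-- The combinatorial distance in `T` from `v` to the set `A`; it is meaningful if `T` is connected
and `A` is nonempty. -/
noncomputable def distToSet {V : Type*} (T : SimpleGraph V) (A : Set V) (v : V) : ℕ :=
  sInf (T.dist v '' A)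

section DistToSet

variable {V : Type*} {T : SimpleGraph V} {A : Set V}

theorem distToSet_le {a : V} (ha : a ∈ A) (v : V) : distToSet T A v ≤ T.dist v a :=
  Nat.sInf_le ⟨a, ha, rfl⟩

theorem exists_dist_eq_distToSet (hA : A.Nonempty) (v : V) :
    ∃ a ∈ A, T.dist v a = distToSet T A v :=
  Nat.sInf_mem (hA.image _)

theorem distToSet_eq_zero_iff (hT : T.Connected) (hA : A.Nonempty) {v : V} :
    distToSet T A v = 0 ↔ v ∈ A := by
  refine ⟨fun h => ?_, fun hv => ?_⟩
  · obtain ⟨a, ha, hav⟩ := exists_dist_eq_distToSet (T := T) hA v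
    rwa [hT.dist_eq_zero_iff.1 (hav.trans h)]
  · simpa using distToSet_le (T := T) hv v

theorem distToSet_le_succ (hT : T.Connected) (hA : A.Nonempty) {v w : V} (hvw : T.Adj v w) :
    distToSet T A v ≤ distToSet T A w + 1 := by
  obtain ⟨a, ha, haw⟩ := exists_dist_eq_distToSet (T := T) hA w
  have := hT.dist_triangle (u := v) (v := w) (w := a)
  rw [SimpleGraph.dist_eq_one_iff_adj.2 hvw, haw] at this
  linarith [distToSet_le (T := T) ha v]

theorem exists_adj_distToSet_eq (hT : T.Connected) (hA : A.Nonempty) {v : V} {k : ℕ}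
    (hv : distToSet T A v = k + 1) : ∃ w, T.Adj v w ∧ distToSet T A w = k := by
  obtain ⟨a, ha, hav⟩ := exists_dist_eq_distToSet (T := T) hA v
  obtain ⟨p, hp⟩ := hT.exists_walk_length_eq_dist v a
  cases p with
  | nil =>
    rw [(distToSet_eq_zero_iff hT hA).2 ha] at hv
    exact (Nat.succ_ne_zero k hv.symm).elim
  | @cons _ w _ h q =>
    have := (distToSet_le ha w).trans (SimpleGraph.dist_le q)
    rw [SimpleGraph.Walk.length_cons, hav, hv] at hp
    exact ⟨w, h, by linarith [distToSet_le_succ hT hA h]⟩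

end DistToSet

/-- The points at which the space is not a line. -/
def branchLocus (X : Type*) [MetricSpace X] : Set X := {x | ¬ IsLinearPoint x}

theorem infDist_branchLocus_apply {X : Type*} [MetricSpace X] (g : X ≃ᵢ X) (x : X) :
    Metric.infDist (g x) (branchLocus X) = Metric.infDist x (branchLocus X) := by
  have image_eq : g '' branchLocus X = branchLocus X := by
    rw [← g.preimage_symm]
    exact Set.ext fun y => not_congr (isLinearPoint_apply_iff g.symm)
  conv_lhs => rw [← image_eq, Metric.infDist_image g.isometry]

namespace IdealTreeOfSpaces

variable {X : Type*} [MetricSpace X] (D : IdealTreeOfSpaces X)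

/-- The vertices whose spaces consist of branch points. -/
def branchVertices : Set D.V := {v | D.space v ⊆ branchLocus X}

theorem exists_mem_space_of_mem_branchLocus {x : X} (hx : x ∈ branchLocus X) :
    ∃ v ∈ D.branchVertices, x ∈ D.space v := by
  have exists_space : ∃ v, x ∈ D.space v := by
    by_contra h
    obtain ⟨d, hd⟩ := D.exists_mem_openEdge (not_exists.1 h)
    exact hx (D.isLinearPoint_of_mem_openEdge hd)
  obtain ⟨v, hv⟩ := exists_space
  refine ⟨v, fun y hy => ?_, hv⟩
  obtain ⟨z, hz⟩ | hsymm := D.space_spec v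
  · rw [hz, Set.mem_singleton_iff] at hv hy
    rwa [hy, ← hv]
  · exact hsymm.not_isLinearPoint hy

theorem branchVertices_nonempty (hN : (branchLocus X).Nonempty) : D.branchVertices.Nonempty := by
  obtain ⟨x, hx⟩ := hN
  obtain ⟨v, hv, -⟩ := D.exists_mem_space_of_mem_branchLocus hx
  exact ⟨v, hv⟩

theorem eq_edge_zero_of_notMem_branchVertices {d : D.tree.Dart} (hd : d.fst ∉ D.branchVertices)
    {x : X} (hx : x ∈ D.space d.fst) : x = D.edge d 0 := by
  obtain ⟨z, hz⟩ | hsymm := D.space_spec d.fst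
  · have h₀ := D.edge_zero_mem d
    rw [hz, Set.mem_singleton_iff] at hx h₀
    exact hx.trans h₀.symm
  · exact (hd fun y hy => hsymm.not_isLinearPoint hy).elim

theorem infDist_le_of_mem_space (hN : (branchLocus X).Nonempty) {v : D.V} {x : X}
    (hx : x ∈ D.space v) :
    Metric.infDist x (branchLocus X) ≤ distToSet D.tree D.branchVertices v := by
  have hA := D.branchVertices_nonempty hN
  have hT := D.isTree.connected
  induction hk : distToSet D.tree D.branchVertices v generalizing v x with
  | zero =>
    rw [Metric.infDist_zero_of_mem ((distToSet_eq_zero_iff hT hA).1 hk hx), Nat.cast_zero]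
  | succ k ih =>
    obtain ⟨w, hvw, hw⟩ := exists_adj_distToSet_eq hT hA hk
    let d : D.tree.Dart := ⟨(v, w), hvw⟩
    have hv : d.fst ∉ D.branchVertices := fun h => by
      rw [(distToSet_eq_zero_iff hT hA).2 h] at hk
      omega
    rw [D.eq_edge_zero_of_notMem_branchVertices hv hx]
    have := Metric.infDist_le_infDist_add_dist (s := branchLocus X) (x := D.edge d 0)
      (y := D.edge d 1)
    rw [D.dist_edge] at this
    push_cast
    norm_num at this
    linarith [ih (D.edge_one_mem d) hw]

theorem infDist_edge_le (hN : (branchLocus X).Nonempty) (d : D.tree.Dart) (t : unitInterval) :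
    Metric.infDist (D.edge d t) (branchLocus X) ≤
      distToSet D.tree D.branchVertices d.fst + (t : ℝ) := by
  have := Metric.infDist_le_infDist_add_dist (s := branchLocus X) (x := D.edge d t)
    (y := D.edge d 0)
  rw [D.dist_edge, Set.Icc.coe_zero, sub_zero, abs_of_nonneg t.2.1] at this
  linarith [D.infDist_le_of_mem_space hN (D.edge_zero_mem d)]

theorem exists_le_infDist_branchLocus (hN : (branchLocus X).Nonempty) : ∃ ρ : X → ℝ,
    (∀ v, ∀ x ∈ D.space v, ρ x = distToSet D.tree D.branchVertices v) ∧
    (∀ d (t : unitInterval), ρ (D.edge d t) =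
      min (distToSet D.tree D.branchVertices d.fst + (t : ℝ))
        (distToSet D.tree D.branchVertices d.snd + (1 - (t : ℝ)))) ∧
    ∀ x, ρ x ≤ Metric.infDist x (branchLocus X) := by
  have hA := D.branchVertices_nonempty hN
  have hT := D.isTree.connected
  obtain ⟨ρ, ρ_space, ρ_edge, hρ⟩ := D.exists_lipschitz_extension
    (fun v => (distToSet D.tree D.branchVertices v : ℝ))
    (fun d t => min (distToSet D.tree D.branchVertices d.fst + (t : ℝ))
      (distToSet D.tree D.branchVertices d.snd + (1 - (t : ℝ))))
    (fun d => by simpa using mod_cast distToSet_le_succ hT hA d.adj)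
    (fun d t => by simp [min_comm])
    (fun d s t => abs_min_add_sub_min_add_le _ _ s t)
  refine ⟨ρ, ρ_space, ρ_edge, fun x => (Metric.le_infDist hN).2 fun y hy => ?_⟩
  obtain ⟨v, hv, hyv⟩ := D.exists_mem_space_of_mem_branchLocus hy
  have ρ_eq_zero : ρ y = 0 := by
    rw [ρ_space v y hyv, (distToSet_eq_zero_iff hT hA).2 hv, Nat.cast_zero]
  simpa [ρ_eq_zero] using (le_abs_self _).trans (hρ x y)

theorem infDist_edge (hN : (branchLocus X).Nonempty) (d : D.tree.Dart) (t : unitInterval) :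
    Metric.infDist (D.edge d t) (branchLocus X) =
      min (distToSet D.tree D.branchVertices d.fst + (t : ℝ))
        (distToSet D.tree D.branchVertices d.snd + (1 - (t : ℝ))) := by
  obtain ⟨ρ, -, ρ_edge, hρ⟩ := D.exists_le_infDist_branchLocus hN
  refine le_antisymm (le_min (D.infDist_edge_le hN d t) ?_) (ρ_edge d t ▸ hρ _)
  simpa [D.edge_symm] using D.infDist_edge_le hN d.symm (unitInterval.symm t)

theorem exists_mem_space_iff (hN : (branchLocus X).Nonempty) (x : X) :
    (∃ v, x ∈ D.space v) ↔ ∃ k : ℕ, Metric.infDist x (branchLocus X) = k := by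
  constructor
  · rintro ⟨v, hv⟩
    obtain ⟨ρ, ρ_space, -, hρ⟩ := D.exists_le_infDist_branchLocus hN
    exact ⟨_, le_antisymm (D.infDist_le_of_mem_space hN hv) (ρ_space v x hv ▸ hρ x)⟩
  · rintro ⟨k, hk⟩
    by_contra h
    obtain ⟨d, t, ⟨ht₀, ht₁⟩, rfl⟩ := D.exists_mem_openEdge (not_exists.1 h)
    have not_nat (m : ℕ) {s : ℝ} (hs₀ : 0 < s) (hs₁ : s < 1) : (k : ℝ) ≠ m + s := by
      intro heq
      have hmk : (m : ℝ) < k := by linarith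
      have hkm : (k : ℝ) < m + 1 := by linarith
      norm_cast at hmk hkm
      omega
    rw [D.infDist_edge hN] at hk
    obtain h | h := min_choice (distToSet D.tree D.branchVertices d.fst + (t : ℝ))
      (distToSet D.tree D.branchVertices d.snd + (1 - (t : ℝ)))
    · exact not_nat _ ht₀ ht₁ (hk.symm.trans h)
    · exact not_nat _ (sub_pos.2 ht₁) (sub_lt_self 1 ht₀) (hk.symm.trans h)

theorem exists_apply_mem_space_iff (hN : (branchLocus X).Nonempty) (g : X ≃ᵢ X) (x : X) :
    (∃ v, g x ∈ D.space v) ↔ ∃ v, x ∈ D.space v := by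
  rw [D.exists_mem_space_iff hN, D.exists_mem_space_iff hN, infDist_branchLocus_apply]

end IdealTreeOfSpaces

theorem exists_subset_of_isPreconnected {X ι : Type*} [TopologicalSpace X] {S : Set X}
    (hS : IsPreconnected S) (hne : S.Nonempty) {U : ι → Set X} (hU : ∀ i, IsOpen (U i))
    (cover : ∀ x ∈ S, ∃ i, x ∈ U i)
    (eq_of_mem : ∀ i j, ∀ x ∈ U i, x ∈ U j → U i = U j) : ∃ i, S ⊆ U i := by
  obtain ⟨x₀, hx₀⟩ := hne
  obtain ⟨i, hi⟩ := cover x₀ hx₀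
  refine ⟨i, hS.subset_left_of_subset_union (hU i)
    (isOpen_biUnion (s := {j | U j ≠ U i}) fun j _ => hU j) ?_ (fun x hx => ?_) ⟨x₀, hx₀, hi⟩⟩
  · refine Set.disjoint_left.2 fun x hxi hx => ?_
    obtain ⟨j, hj, hxj⟩ := Set.mem_iUnion₂.1 hx
    exact hj (eq_of_mem j i x hxj hxi)
  · obtain ⟨j, hj⟩ := cover x hx
    by_cases h : U j = U i
    · exact Or.inl (h ▸ hj)
    · exact Or.inr (Set.mem_biUnion h hj)

theorem unitInterval_isometry_eq {φ : unitInterval → unitInterval} (hφ : Isometry φ) :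
    (∀ t, φ t = t) ∨ ∀ t, φ t = unitInterval.symm t := by
  have dist_eq (s t) : |(φ s : ℝ) - φ t| = |(s : ℝ) - t| := hφ.dist_eq s t
  have dist_ends : |(φ 0 : ℝ) - φ 1| = 1 := by simp [dist_eq]
  obtain h | h := (abs_eq zero_le_one).1 dist_ends
  · have φ_one : (φ 1 : ℝ) = 0 := by linarith [(φ 0).2.2, (φ 1).2.1]
    refine Or.inr fun t => Subtype.ext ?_
    have := dist_eq t 1
    rwa [φ_one, sub_zero, abs_of_nonneg (φ t).2.1, Set.Icc.coe_one,
      abs_of_nonpos (sub_nonpos.2 t.2.2), neg_sub] at this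
  · have φ_zero : (φ 0 : ℝ) = 0 := by linarith [(φ 1).2.2, (φ 0).2.1]
    refine Or.inl fun t => Subtype.ext ?_
    simpa [φ_zero, abs_of_nonneg (φ t).2.1, abs_of_nonneg t.2.1] using dist_eq t 0

namespace IdealTreeOfSpaces

variable {X : Type*} [MetricSpace X] (D : IdealTreeOfSpaces X)

theorem exists_subset_space {S : Set X} (hS : IsPreconnected S) (hne : S.Nonempty)
    (hsub : ∀ x ∈ S, ∃ v, x ∈ D.space v) : ∃ v, S ⊆ D.space v := by
  have self_subset (v) := Metric.self_subset_thickening (one_half_pos (α := ℝ)) (D.space v)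
  have eq_of_mem (v w) (x : X) (hv : x ∈ Metric.thickening (1 / 2) (D.space v))
      (hw : x ∈ Metric.thickening (1 / 2) (D.space w)) : v = w := by
    by_contra hvw
    obtain ⟨y, hy, hxy⟩ := Metric.mem_thickening_iff.1 hv
    obtain ⟨z, hz, hxz⟩ := Metric.mem_thickening_iff.1 hw
    linarith [D.one_le_dist hvw hy hz, dist_triangle_left y z x]
  obtain ⟨v, hv⟩ := exists_subset_of_isPreconnected hS hne
    (fun v => Metric.isOpen_thickening (δ := 1 / 2) (E := D.space v))
    (fun x hx => (hsub x hx).imp fun v hv => self_subset v hv)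
    (fun v w x hxv hxw => by rw [eq_of_mem v w x hxv hxw])
  refine ⟨v, fun x hx => ?_⟩
  obtain ⟨w, hw⟩ := hsub x hx
  rwa [eq_of_mem v w x (hv hx) (self_subset w hw)]

theorem exists_subset_openEdge {S : Set X} (hS : IsPreconnected S) (hne : S.Nonempty)
    (hsub : ∀ x ∈ S, ∀ v, x ∉ D.space v) : ∃ d, S ⊆ D.openEdge d :=
  exists_subset_of_isPreconnected hS hne D.isOpen_openEdge
    (fun x hx => D.exists_mem_openEdge (hsub x hx)) fun _ _ _ => D.openEdge_eq_of_mem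

/-- The decomposition is preserved by all isometries. -/
class IsInvariant : Prop where
  space : ∀ (g : X ≃ᵢ X) v, ∃ w, g '' D.space v = D.space w
  edge : ∀ (g : X ≃ᵢ X) d, ∃ d', ∀ t, g (D.edge d t) = D.edge d' t

theorem exists_image_space_subset (hN : (branchLocus X).Nonempty) (g : X ≃ᵢ X) (v : D.V) :
    ∃ w, g '' D.space v ⊆ D.space w := by
  refine D.exists_subset_space ((D.isPreconnected_space v).image g g.continuous.continuousOn)
    ((D.space_nonempty v).image g) ?_
  rintro _ ⟨x, hx, rfl⟩
  exact (D.exists_apply_mem_space_iff hN g x).2 ⟨v, hx⟩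

theorem exists_image_space_eq (hN : (branchLocus X).Nonempty) (g : X ≃ᵢ X) (v : D.V) :
    ∃ w, g '' D.space v = D.space w := by
  obtain ⟨w, hw⟩ := D.exists_image_space_subset hN g v
  obtain ⟨v', hv'⟩ := D.exists_image_space_subset hN g.symm w
  obtain ⟨x, hx⟩ := D.space_nonempty v
  obtain rfl : v = v' := D.eq_of_mem_space hx (hv' ⟨g x, hw ⟨x, hx, rfl⟩, by simp⟩)
  exact ⟨w, hw.antisymm fun y hy => ⟨g.symm y, hv' ⟨y, hy, rfl⟩, by simp⟩⟩

theorem exists_apply_edge_mem_range (hN : (branchLocus X).Nonempty) (g : X ≃ᵢ X)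
    (d : D.tree.Dart) : ∃ d', ∀ t, g (D.edge d t) ∈ Set.range (D.edge d') := by
  have continuous_edge (d) := (D.edge_isometry d).continuous
  have continuous_g_edge := g.continuous.comp (continuous_edge d)
  obtain ⟨d', hd'⟩ := D.exists_subset_openEdge (S := (g ∘ D.edge d) '' Set.Ioo 0 1)
    (isPreconnected_Ioo.image _ continuous_g_edge.continuousOn)
    ((Set.nonempty_Ioo.2 zero_lt_one).image _) (by
      rintro _ ⟨t, ht, rfl⟩ v hv
      obtain ⟨w, hw⟩ := (D.exists_apply_mem_space_iff hN g _).1 ⟨v, hv⟩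
      exact D.edge_notMem d t ht.1 ht.2 w hw)
  have isClosed : IsClosed ((g ∘ D.edge d) ⁻¹' Set.range (D.edge d')) :=
    (isCompact_range (continuous_edge d')).isClosed.preimage continuous_g_edge
  have closure_subset := isClosed.closure_subset_iff.2
    ((Set.image_subset_iff.1 hd').trans (Set.preimage_mono (Set.image_subset_range _ _)))
  rw [closure_Ioo zero_ne_one] at closure_subset
  exact ⟨d', fun t => closure_subset ⟨t.2.1, t.2.2⟩⟩

theorem exists_apply_edge_eq (hN : (branchLocus X).Nonempty) (g : X ≃ᵢ X) (d : D.tree.Dart) :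
    ∃ d', ∀ t, g (D.edge d t) = D.edge d' t := by
  obtain ⟨d', hd'⟩ := D.exists_apply_edge_mem_range hN g d
  choose φ hφ using hd'
  have isometry : Isometry φ := Isometry.of_dist_eq fun s t => by
    rw [← (D.edge_isometry d').dist_eq, hφ, hφ, g.dist_eq, (D.edge_isometry d).dist_eq]
  obtain h | h := unitInterval_isometry_eq isometry
  · exact ⟨d', fun t => by rw [← hφ, h]⟩
  · exact ⟨d'.symm, fun t => by rw [← hφ, h, D.edge_symm]⟩

theorem isInvariant (hN : (branchLocus X).Nonempty) : D.IsInvariant :=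
  ⟨D.exists_image_space_eq hN, D.exists_apply_edge_eq hN⟩

end IdealTreeOfSpaces

end Invariance

section AttachGraph

namespace IdealTreeOfSpaces

variable {X : Type*} [MetricSpace X] {D : IdealTreeOfSpaces X}

variable (D) in
/-- The points at which edges are attached to the vertex spaces. -/
def attachingPoints : Set X := Set.range fun d => D.edge d 0

variable (D) in
/-- The attaching point of an oriented edge on its initial vertex space. -/
def attachingPoint (d : D.tree.Dart) : D.attachingPoints := ⟨D.edge d 0, d, rfl⟩

theorem exists_mem_space (p : D.attachingPoints) : ∃ v, (p : X) ∈ D.space v := by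
  obtain ⟨_, d, rfl⟩ := p
  exact ⟨_, D.edge_zero_mem d⟩

theorem coe_attachingPoint_symm (d : D.tree.Dart) :
    (D.attachingPoint d.symm : X) = D.edge d 1 := (D.edge_one_eq d).symm

theorem dart_ext {d d' : D.tree.Dart} (h₀ : D.edge d 0 = D.edge d' 0)
    (h₁ : D.edge d 1 = D.edge d' 1) : d = d' :=
  SimpleGraph.Dart.ext _ _ (Prod.ext
    (D.eq_of_mem_space (D.edge_zero_mem d) (h₀ ▸ D.edge_zero_mem d'))
    (D.eq_of_mem_space (D.edge_one_mem d) (h₁ ▸ D.edge_one_mem d')))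

variable (D) in
/-- The vertices of `attachGraph`: the vertices of the tree of spaces and the attaching points. -/
inductive Node
  | vertex (v : D.V)
  | point (p : D.attachingPoints)

open Node

variable (D) in
/-- The tree in which each vertex space is joined to the attaching points on it, and the two ends
of each edge are joined. The attaching points are vertices of their own because a vertex space has
infinitely many of them, and edges attached at different points can be permuted independently;
with this graph, what an isometry does on a vertex space and what it does on the edges at one
attaching point are recorded in the stars of different vertices. -/
def attachGraph : SimpleGraph D.Node where
  Adj
    | vertex v, point p => (p : X) ∈ D.space v
    | point p, vertex v => (p : X) ∈ D.space v
    | point p, point q => ∃ d, D.attachingPoint d = p ∧ D.attachingPoint d.symm = q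
    | vertex _, vertex _ => False
  symm := ⟨by
    rintro (v | p) (w | q) h
    · exact h
    · exact h
    · exact h
    · obtain ⟨d, rfl, rfl⟩ := h
      exact ⟨d.symm, rfl, by rw [SimpleGraph.Dart.symm_symm]⟩⟩
  loopless := ⟨by
    rintro (v | p) h
    · exact h
    · obtain ⟨d, rfl, h⟩ := h
      have edge_one_eq : D.edge d 1 = D.edge d 0 :=
        (coe_attachingPoint_symm d).symm.trans (congrArg Subtype.val h)
      exact one_ne_zero ((D.edge_isometry d).injective edge_one_eq)⟩

theorem attachGraph_adj_vertex_point {v : D.V} {p : D.attachingPoints} :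
    D.attachGraph.Adj (vertex v) (point p) ↔ (p : X) ∈ D.space v := Iff.rfl

theorem attachGraph_adj_attachingPoint (d : D.tree.Dart) :
    D.attachGraph.Adj (point (D.attachingPoint d)) (point (D.attachingPoint d.symm)) :=
  ⟨d, rfl, rfl⟩

theorem attachGraph_adj_vertex_attachingPoint (d : D.tree.Dart) :
    D.attachGraph.Adj (vertex d.fst) (point (D.attachingPoint d)) := D.edge_zero_mem d

theorem preconnected_attachGraph : D.attachGraph.Preconnected := by
  have reachable_vertex (v w : D.V) : D.attachGraph.Reachable (vertex v) (vertex w) := by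
    refine forall_of_preconnected D.isTree.preconnected v (p := fun w =>
      D.attachGraph.Reachable (vertex v) (vertex w)) (.refl _) (fun u w huw h => ?_) w
    let d : D.tree.Dart := ⟨(u, w), huw⟩
    exact h.trans <| (attachGraph_adj_vertex_attachingPoint d).reachable.trans <|
      (attachGraph_adj_attachingPoint d).reachable.trans
        (attachGraph_adj_vertex_attachingPoint d.symm).reachable.symm
  have exists_reachable (u : D.Node) : ∃ v, D.attachGraph.Reachable u (vertex v) := by
    obtain v | p := u
    · exact ⟨v, .refl _⟩
    · obtain ⟨v, hv⟩ := exists_mem_space p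
      exact ⟨v, (attachGraph_adj_vertex_point.2 hv).reachable.symm⟩
  intro u w
  obtain ⟨v, hv⟩ := exists_reachable u
  obtain ⟨v', hv'⟩ := exists_reachable w
  exact hv.trans ((reachable_vertex v v').trans hv'.symm)

/-- `d` points towards the vertex `v₀` of the tree. -/
def IsTowards (v₀ : D.V) (d : D.tree.Dart) : Prop :=
  D.tree.dist v₀ d.fst = D.tree.dist v₀ d.snd + 1

theorem isTowards_or_isTowards_symm (v₀ : D.V) (d : D.tree.Dart) :
    IsTowards v₀ d ∨ IsTowards v₀ d.symm :=
  D.isTree.dist_eq_dist_add_one_of_adj v₀ d.adj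

theorem IsTowards.eq_of_fst_eq {v₀ : D.V} {d d' : D.tree.Dart} (hd : IsTowards v₀ d)
    (hd' : IsTowards v₀ d') (h : d.fst = d'.fst) : d = d' := by
  refine SimpleGraph.Dart.ext _ _ (Prod.ext h ?_)
  exact eq_of_dist_eq_add_one D.isTree d.adj (h ▸ d'.adj) hd (h ▸ hd')

open Classical in
/-- The distance from `vertex v₀` in `attachGraph`. -/
noncomputable def height (v₀ : D.V) : D.Node → ℕ
  | vertex v => 3 * D.tree.dist v₀ v
  | point p =>
    if ∃ d, D.attachingPoint d = p ∧ IsTowards v₀ d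
    then 3 * D.tree.dist v₀ (exists_mem_space p).choose - 1
    else 3 * D.tree.dist v₀ (exists_mem_space p).choose + 1

theorem IsTowards.height_eq {v₀ : D.V} {d : D.tree.Dart} (hd : IsTowards v₀ d) :
    height v₀ (point (D.attachingPoint d)) = 3 * D.tree.dist v₀ d.snd + 2 := by
  have choose_eq : (exists_mem_space (D.attachingPoint d)).choose = d.fst :=
    D.eq_of_mem_space (exists_mem_space _).choose_spec (D.edge_zero_mem d)
  rw [height, if_pos ⟨d, rfl, hd⟩, choose_eq, hd]
  omega

theorem height_eq_of_forall_not_isTowards {v₀ v : D.V} {p : D.attachingPoints}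
    (hp : (p : X) ∈ D.space v) (h : ∀ d, D.attachingPoint d = p → ¬ IsTowards v₀ d) :
    height v₀ (point p) = 3 * D.tree.dist v₀ v + 1 := by
  rw [height, if_neg (by simpa using h), D.eq_of_mem_space (exists_mem_space p).choose_spec hp]

theorem fst_eq_fst {d d' : D.tree.Dart} (h : D.attachingPoint d = D.attachingPoint d') :
    d.fst = d'.fst :=
  D.eq_of_mem_space (D.edge_zero_mem d) (by
    rw [show D.edge d 0 = D.edge d' 0 from congrArg Subtype.val h]
    exact D.edge_zero_mem d')

theorem height_lt_height_vertex_iff {v₀ v : D.V} {p : D.attachingPoints}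
    (hp : (p : X) ∈ D.space v) : height v₀ (point p) < height v₀ (vertex v) ↔
      ∃ d, D.attachingPoint d = p ∧ IsTowards v₀ d := by
  constructor
  · intro hlt
    by_contra! h
    rw [height_eq_of_forall_not_isTowards hp h, height] at hlt
    omega
  · rintro ⟨d, rfl, hd⟩
    rw [hd.height_eq, height, ← D.eq_of_mem_space (D.edge_zero_mem d) hp, hd]
    omega

theorem height_lt_height_of_isTowards {v₀ : D.V} {d : D.tree.Dart} (hd : IsTowards v₀ d) :
    height v₀ (point (D.attachingPoint d.symm)) < height v₀ (point (D.attachingPoint d)) := by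
  rw [hd.height_eq]
  by_cases h : ∃ d', D.attachingPoint d' = D.attachingPoint d.symm ∧ IsTowards v₀ d'
  · obtain ⟨d', h', hd'⟩ := h
    have fst_eq : d'.fst = d.snd := fst_eq_fst h'
    rw [← h', hd'.height_eq, ← fst_eq, hd']
    omega
  · push Not at h
    rw [height_eq_of_forall_not_isTowards (D.edge_zero_mem d.symm) h]
    exact Nat.lt_succ_self _

theorem isTowards_iff_height_lt {v₀ : D.V} {d : D.tree.Dart} :
    height v₀ (point (D.attachingPoint d.symm)) < height v₀ (point (D.attachingPoint d)) ↔
      IsTowards v₀ d := by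
  refine ⟨fun h => (isTowards_or_isTowards_symm v₀ d).resolve_right fun hd => ?_,
    height_lt_height_of_isTowards⟩
  have := height_lt_height_of_isTowards hd
  rw [SimpleGraph.Dart.symm_symm] at this
  exact this.asymm h

theorem height_ne_height (v₀ : D.V) (u w : D.Node) (h : D.attachGraph.Adj u w) :
    height v₀ u ≠ height v₀ w := by
  have vertex_ne_point {v : D.V} {p : D.attachingPoints} (hp : (p : X) ∈ D.space v) :
      height v₀ (vertex v) ≠ height v₀ (point p) := by
    by_cases h : ∃ d, D.attachingPoint d = p ∧ IsTowards v₀ d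
    · exact ((height_lt_height_vertex_iff hp).2 h).ne'
    · push Not at h
      rw [height_eq_of_forall_not_isTowards hp h]
      exact (Nat.lt_succ_self _).ne
  obtain v | p := u <;> obtain w | q := w
  · exact h.elim
  · exact vertex_ne_point h
  · exact (vertex_ne_point h).symm
  · obtain ⟨d, rfl, rfl⟩ := h
    obtain hd | hd := isTowards_or_isTowards_symm v₀ d
    · exact (height_lt_height_of_isTowards hd).ne'
    · simpa using (height_lt_height_of_isTowards hd).ne

theorem eq_of_height_lt {v₀ : D.V} {u w w' : D.Node} (hw : D.attachGraph.Adj u w)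
    (hw' : D.attachGraph.Adj u w') (hlt : height v₀ w < height v₀ u)
    (hlt' : height v₀ w' < height v₀ u) : w = w' := by
  have not_vertex_and_point {v : D.V} {d : D.tree.Dart}
      (hv : (D.attachingPoint d : X) ∈ D.space v) (hd : IsTowards v₀ d)
      (hlt : height v₀ (vertex v) < height v₀ (point (D.attachingPoint d))) : False :=
    hlt.asymm ((height_lt_height_vertex_iff hv).2 ⟨d, rfl, hd⟩)
  obtain v | p := u <;> obtain w | q := w <;> obtain w' | q' := w'
  · exact hw.elim
  · exact hw.elim
  · exact hw'.elim
  · obtain ⟨d, rfl, hd⟩ := (height_lt_height_vertex_iff hw).1 hlt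
    obtain ⟨d', rfl, hd'⟩ := (height_lt_height_vertex_iff hw').1 hlt'
    rw [hd.eq_of_fst_eq hd' ((D.eq_of_mem_space (D.edge_zero_mem d) hw).trans
      (D.eq_of_mem_space (D.edge_zero_mem d') hw').symm)]
  · rw [D.eq_of_mem_space hw hw']
  · obtain ⟨d, rfl, rfl⟩ := hw'
    exact (not_vertex_and_point hw (isTowards_iff_height_lt.1 hlt') hlt).elim
  · obtain ⟨d, rfl, rfl⟩ := hw
    exact (not_vertex_and_point hw' (isTowards_iff_height_lt.1 hlt) hlt').elim
  · obtain ⟨d, rfl, rfl⟩ := hw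
    obtain ⟨d', h', rfl⟩ := hw'
    rw [← h'] at hlt'
    rw [(isTowards_iff_height_lt.1 hlt).eq_of_fst_eq (isTowards_iff_height_lt.1 hlt')
      (fst_eq_fst h').symm]

theorem isTree_attachGraph : D.attachGraph.IsTree := by
  obtain ⟨v₀⟩ := D.isTree.nonempty
  have : Nonempty D.Node := ⟨vertex v₀⟩
  exact ⟨⟨preconnected_attachGraph⟩, isAcyclic_of_height (height v₀) (height_ne_height v₀)
    fun _ _ _ => eq_of_height_lt⟩

namespace IsInvariant

/-- The action of an isometry on the vertices of the tree of spaces. -/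
noncomputable def act (hD : D.IsInvariant) (g : X ≃ᵢ X) (v : D.V) : D.V :=
  (hD.space g v).choose

theorem image_space (hD : D.IsInvariant) (g : X ≃ᵢ X) (v : D.V) :
    g '' D.space v = D.space (hD.act g v) := (hD.space g v).choose_spec

theorem apply_mem_space (hD : D.IsInvariant) (g : X ≃ᵢ X) {v : D.V} {x : X}
    (hx : x ∈ D.space v) : g x ∈ D.space (hD.act g v) :=
  hD.image_space g v ▸ Set.mem_image_of_mem g hx

theorem act_eq_of_mem (hD : D.IsInvariant) {g : X ≃ᵢ X} {v w : D.V} {x : X}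
    (hx : x ∈ D.space v) (hgx : g x ∈ D.space w) : hD.act g v = w :=
  D.eq_of_mem_space (hD.apply_mem_space g hx) hgx

theorem apply_mem_attachingPoints (hD : D.IsInvariant) (g : X ≃ᵢ X) {x : X}
    (hx : x ∈ D.attachingPoints) : g x ∈ D.attachingPoints := by
  obtain ⟨d, rfl⟩ := hx
  obtain ⟨d', hd'⟩ := hD.edge g d
  exact ⟨d', (hd' 0).symm⟩

theorem apply_edge_eq_apply_edge (hD : D.IsInvariant) {g g' : X ≃ᵢ X} {d : D.tree.Dart}
    (h₀ : g (D.edge d 0) = g' (D.edge d 0)) (h₁ : g (D.edge d 1) = g' (D.edge d 1))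
    (t : unitInterval) : g (D.edge d t) = g' (D.edge d t) := by
  obtain ⟨d₁, hd₁⟩ := hD.edge g d
  obtain ⟨d₂, hd₂⟩ := hD.edge g' d
  rw [hd₁, hd₂] at h₀ h₁ ⊢
  rw [dart_ext h₀ h₁]

end IsInvariant

variable [hD : D.IsInvariant]

noncomputable instance : MulAction (X ≃ᵢ X) D.Node where
  smul g
    | vertex v => vertex (hD.act g v)
    | point p => point ⟨g p, hD.apply_mem_attachingPoints g p.2⟩
  one_smul
    | vertex v => by
      obtain ⟨x, hx⟩ := D.space_nonempty v
      exact congrArg vertex (hD.act_eq_of_mem hx hx)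
    | point p => rfl
  mul_smul g h
    | vertex v => by
      obtain ⟨x, hx⟩ := D.space_nonempty v
      exact congrArg vertex (hD.act_eq_of_mem hx
        (hD.apply_mem_space g (hD.apply_mem_space h hx)))
    | point p => rfl

theorem smul_vertex (g : X ≃ᵢ X) (v : D.V) :
    g • (vertex v : D.Node) = vertex (hD.act g v) := rfl

theorem smul_point (g : X ≃ᵢ X) (p : D.attachingPoints) :
    g • (point p : D.Node) = point ⟨g p, hD.apply_mem_attachingPoints g p.2⟩ := rfl

theorem smul_point_eq_smul_point_iff {g g' : X ≃ᵢ X} {p p' : D.attachingPoints} :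
    g • (point p : D.Node) = g' • point p' ↔ g p = g' p' := by
  simp only [smul_point, Node.point.injEq, Subtype.mk.injEq]

theorem smul_vertex_eq_smul_vertex_iff {g g' : X ≃ᵢ X} {v v' : D.V} :
    g • (vertex v : D.Node) = g' • vertex v' ↔ hD.act g v = hD.act g' v' := by
  simp only [smul_vertex, Node.vertex.injEq]

theorem attachGraph_adj_smul_iff (g : X ≃ᵢ X) (u w : D.Node) :
    D.attachGraph.Adj (g • u) (g • w) ↔ D.attachGraph.Adj u w := by
  have adj_smul (g : X ≃ᵢ X) (u w : D.Node) (h : D.attachGraph.Adj u w) :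
      D.attachGraph.Adj (g • u) (g • w) := by
    obtain v | p := u <;> obtain w | q := w
    · exact h
    · exact hD.apply_mem_space g h
    · exact hD.apply_mem_space g h
    · obtain ⟨d, rfl, rfl⟩ := h
      obtain ⟨d', hd'⟩ := hD.edge g d
      refine ⟨d', Subtype.ext (hd' 0).symm, Subtype.ext ?_⟩
      simp only [coe_attachingPoint_symm, hd']
  refine ⟨fun h => ?_, adj_smul g u w⟩
  simpa only [inv_smul_smul] using adj_smul g⁻¹ _ _ h

end IdealTreeOfSpaces

end AttachGraph

section Gluing

section General

variable {G U : Type*} [Group G] [MulAction G U] {T : SimpleGraph U}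

theorem bijective_smul_of_forall_adj (hT : T.IsTree)
    (hG : ∀ (g : G) u w, T.Adj (g • u) (g • w) ↔ T.Adj u w) {k : U → G}
    (hk : ∀ u w, T.Adj u w → k u • w = k w • w) : Function.Bijective fun u => k u • u := by
  have := hT.nonempty
  let f : T →g T := ⟨fun u => k u • u, fun {u w} huw => by
    rw [← hk u w huw, hG]
    exact huw⟩
  refine ⟨injective_of_injOn_neighborSet hT hT.isAcyclic (f := f) fun u w hw w' hw' h => ?_,
    surjective_of_surjOn_neighborSet (T := T) hT.preconnected fun u z hz => ?_⟩
  · have h' : k w • w = k w' • w' := h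
    rwa [← hk u w hw, ← hk u w' hw', smul_left_cancel_iff] at h'
  · have hz' : T.Adj u ((k u)⁻¹ • z) := by
      rw [← hG (k u), smul_inv_smul]
      exact hz
    exact ⟨_, hz', (hk _ _ hz').symm.trans (smul_inv_smul (k u) z)⟩

theorem inv_smul_eq_inv_smul_of_adj
    (hG : ∀ (g : G) u w, T.Adj (g • u) (g • w) ↔ T.Adj u w) {k k' : U → G}
    (hk : ∀ u w, T.Adj u w → k u • w = k w • w) (bijective : Function.Bijective fun u => k u • u)
    (hk' : ∀ u, k' (k u • u) = (k u)⁻¹) (u w : U) (huw : T.Adj u w) : k' u • w = k' w • w := by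
  obtain ⟨a, rfl⟩ := bijective.surjective u
  have adj : T.Adj a ((k a)⁻¹ • w) := by rwa [← hG (k a), smul_inv_smul]
  have hb := hk a _ adj
  rw [smul_inv_smul] at hb
  generalize (k a)⁻¹ • w = b at adj hb
  subst hb
  simp only [hk', ← hk a b adj, inv_smul_smul]
  rw [hk a b adj, hk', inv_smul_smul]

end General

namespace IdealTreeOfSpaces

open Node

variable {X : Type*} [MetricSpace X] {D : IdealTreeOfSpaces X}

/-- `f` is glued from the isometries `k u`, that is, it coincides with `k u` on the vertex space
of `u`, or on the edges at the attaching point `u`. -/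
structure IsGluedFrom (k : D.Node → X ≃ᵢ X) (f : X → X) : Prop where
  apply_space : ∀ v, ∀ x ∈ D.space v, f x = k (vertex v) x
  apply_edge : ∀ d t, f (D.edge d t) = k (point (D.attachingPoint d)) (D.edge d t)

theorem IsGluedFrom.dist_le {k : D.Node → X ≃ᵢ X} {f : X → X} (hf : IsGluedFrom k f) (x y : X) :
    dist (f x) (f y) ≤ dist x y := by
  refine D.dist_le_of_pieces f (fun v x hx y hy => ?_) (fun d s t => ?_) x y
  · rw [hf.apply_space v x hx, hf.apply_space v y hy, (k _).dist_eq]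
  · rw [hf.apply_edge, hf.apply_edge, (k _).dist_eq, (D.edge_isometry d).dist_eq]

variable [hD : D.IsInvariant]

theorem exists_isGluedFrom {k : D.Node → X ≃ᵢ X}
    (hk : ∀ u w, D.attachGraph.Adj u w → k u • w = k w • w) : ∃ f, IsGluedFrom k f := by
  obtain ⟨f, hf_space, hf_edge⟩ := D.exists_glue (fun v x => k (vertex v) x)
    (fun d t => k (point (D.attachingPoint d)) (D.edge d t))
    (fun d => (smul_point_eq_smul_point_iff.1
      (hk _ _ (attachGraph_adj_vertex_attachingPoint d))).symm)
    (fun d t => by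
      have agree_zero := smul_point_eq_smul_point_iff.1
        (hk _ _ (attachGraph_adj_attachingPoint d).symm)
      have agree_one := smul_point_eq_smul_point_iff.1
        (hk _ _ (attachGraph_adj_attachingPoint d))
      rw [coe_attachingPoint_symm] at agree_one
      rw [D.edge_symm]
      exact hD.apply_edge_eq_apply_edge agree_zero agree_one.symm _)
  exact ⟨f, hf_space, hf_edge⟩

theorem IsGluedFrom.leftInverse {k k' : D.Node → X ≃ᵢ X} (hk' : ∀ u, k' (k u • u) = (k u)⁻¹)
    {f f' : X → X} (hf : IsGluedFrom k f) (hf' : IsGluedFrom k' f') :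
    Function.LeftInverse f' f := by
  intro x
  obtain ⟨v, hv⟩ | ⟨d, t, rfl⟩ := D.cover x
  · rw [hf.apply_space v x hv, hf'.apply_space _ _ (hD.apply_mem_space (k (vertex v)) hv),
      ← smul_vertex, hk']
    exact (k _).symm_apply_apply x
  · obtain ⟨d', hd'⟩ := hD.edge (k (point (D.attachingPoint d))) d
    have attachingPoint_eq : k (point (D.attachingPoint d)) • point (D.attachingPoint d) =
        point (D.attachingPoint d') := congrArg point (Subtype.ext (hd' 0))
    rw [hf.apply_edge, hd', hf'.apply_edge, ← attachingPoint_eq, hk', ← hd']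
    exact (k _).symm_apply_apply _

theorem IsGluedFrom.smul_eq {k : D.Node → X ≃ᵢ X} {g : X ≃ᵢ X} (hg : IsGluedFrom k g)
    (u : D.Node) : g • u = k u • u := by
  obtain v | ⟨_, d, rfl⟩ := u
  · obtain ⟨x, hx⟩ := D.space_nonempty v
    refine smul_vertex_eq_smul_vertex_iff.2 (hD.act_eq_of_mem hx ?_)
    rw [hg.apply_space v x hx]
    exact hD.apply_mem_space _ hx
  · exact smul_point_eq_smul_point_iff.2 (hg.apply_edge d 0)

theorem exists_isometry_smul_eq {k : D.Node → X ≃ᵢ X}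
    (hk : ∀ u w, D.attachGraph.Adj u w → k u • w = k w • w) :
    ∃ g : X ≃ᵢ X, ∀ u : D.Node, g • u = k u • u := by
  have bijective := bijective_smul_of_forall_adj isTree_attachGraph attachGraph_adj_smul_iff hk
  let φ := Equiv.ofBijective _ bijective
  let k' : D.Node → X ≃ᵢ X := fun u => (k (φ.symm u))⁻¹
  have hk' (u) : k' (k u • u) = (k u)⁻¹ :=
    congrArg (fun u => (k u)⁻¹) (φ.symm_apply_apply u)
  have hk'' (u) : k (k' u • u) = (k' u)⁻¹ := by
    obtain ⟨a, rfl⟩ := bijective.surjective u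
    simp only [hk', inv_smul_smul, inv_inv]
  obtain ⟨f, hf⟩ := exists_isGluedFrom hk
  obtain ⟨f', hf'⟩ := exists_isGluedFrom
    (inv_smul_eq_inv_smul_of_adj attachGraph_adj_smul_iff hk bijective hk')
  have left_inv := hf.leftInverse hk' hf'
  let g : X ≃ᵢ X := ⟨⟨f, f', left_inv, hf'.leftInverse hk'' hf⟩, Isometry.of_dist_eq fun x y =>
    le_antisymm (hf.dist_le x y) (by simpa only [left_inv _] using hf'.dist_le (f x) (f y))⟩
  exact ⟨g, IsGluedFrom.smul_eq (g := g) hf⟩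

end IdealTreeOfSpaces

end Gluing

/-! ### Discrete cobounded groups of isometries -/

section Lattices

open scoped Topology

theorem exists_normal_finiteIndex_forall_notMem {G : Type*} [Group G] [Group.ResiduallyFinite G]
    {S : Set G} (hS : S.Finite) (one_notMem : 1 ∉ S) :
    ∃ N : Subgroup G, N.Normal ∧ N.FiniteIndex ∧ ∀ g ∈ S, g ∉ N := by
  have exists_notMem (s : S) : ∃ N : Subgroup G, N.Normal ∧ N.FiniteIndex ∧ (s : G) ∉ N := by
    obtain ⟨N, hN⟩ := Group.exists_finiteIndexNormalSubgroup_notMem (s : G)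
      fun h => one_notMem (h ▸ s.2)
    exact ⟨N.toSubgroup, inferInstance, inferInstance, hN⟩
  choose N normal finiteIndex notMem using exists_notMem
  have : Finite S := hS
  exact ⟨⨅ s, N s, Subgroup.normal_iInf_normal normal, Subgroup.finiteIndex_iInf finiteIndex,
    fun g hg h => notMem ⟨g, hg⟩ (Subgroup.mem_iInf.1 h _)⟩

variable {X : Type*} [MetricSpace X] {Γ Δ : Subgroup (X ≃ᵢ X)}

/-- The orbits of `Γ` are `R`-dense in `X`, with the same `R` for all orbits. -/
def ActsCoboundedly (Γ : Subgroup (X ≃ᵢ X)) : Prop :=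
  ∃ R : ℝ, ∀ x y, ∃ g ∈ Γ, dist (g x) y ≤ R

/-- Only finitely many elements of `Γ` move a given point by a bounded distance; in a proper space
this is equivalent to discreteness of `Γ`. -/
def ActsMetricallyProperly (Γ : Subgroup (X ≃ᵢ X)) : Prop :=
  ∀ (x : X) (r : ℝ), {g | g ∈ Γ ∧ dist (g x) x ≤ r}.Finite

namespace ActsCoboundedly

theorem of_dist_le {x₀ : X} {R : ℝ} (h : ∀ x, ∃ g ∈ Γ, dist (g x) x₀ ≤ R) : ActsCoboundedly Γ := by
  refine ⟨R + R, fun x y => ?_⟩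
  obtain ⟨g, hg, hgx⟩ := h x
  obtain ⟨k, hk, hky⟩ := h y
  refine ⟨k⁻¹ * g, Γ.mul_mem (Γ.inv_mem hk) hg, ?_⟩
  rw [← k.dist_eq, IsometryEquiv.mul_apply, IsometryEquiv.apply_inv_self]
  exact (dist_triangle_right _ _ x₀).trans (add_le_add hgx hky)

theorem mono (h : ActsCoboundedly Γ) (hle : Γ ≤ Δ) : ActsCoboundedly Δ := by
  obtain ⟨R, hR⟩ := h
  exact ⟨R, fun x y => (hR x y).imp fun _ hg => ⟨hle hg.1, hg.2⟩⟩

theorem map_conj (h : ActsCoboundedly Γ) (g : X ≃ᵢ X) :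
    ActsCoboundedly (Γ.map (MulAut.conj g).toMonoidHom) := by
  obtain ⟨R, hR⟩ := h
  refine ⟨R, fun x y => ?_⟩
  obtain ⟨c, hc, hcx⟩ := hR (g⁻¹ x) (g⁻¹ y)
  refine ⟨g * c * g⁻¹, ⟨c, hc, rfl⟩, ?_⟩
  rwa [← g.dist_eq, IsometryEquiv.apply_inv_self] at hcx

theorem of_relIndex_ne_zero [Nonempty X] (h : ActsCoboundedly Γ) (index : Δ.relIndex Γ ≠ 0) :
    ActsCoboundedly (Δ ⊓ Γ) := by
  obtain ⟨R, hR⟩ := h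
  obtain ⟨x₀⟩ := ‹Nonempty X›
  have : (Δ.subgroupOf Γ).FiniteIndex := ⟨index⟩
  obtain ⟨C, hC⟩ := (Set.finite_range fun q : Γ ⧸ Δ.subgroupOf Γ =>
    dist ((q.out : X ≃ᵢ X)⁻¹ x₀) x₀).bddAbove
  refine of_dist_le (x₀ := x₀) (R := R + C) fun x => ?_
  obtain ⟨g, hg, hgx⟩ := hR x x₀
  let q : Γ ⧸ Δ.subgroupOf Γ := QuotientGroup.mk ⟨g, hg⟩
  have mem : q.out⁻¹ * ⟨g, hg⟩ ∈ Δ.subgroupOf Γ := QuotientGroup.eq.1 (QuotientGroup.out_eq' q)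
  refine ⟨(q.out : X ≃ᵢ X)⁻¹ * g, ⟨mem, Subtype.property (q.out⁻¹ * ⟨g, hg⟩)⟩,
    (dist_triangle _ ((q.out : X ≃ᵢ X)⁻¹ x₀) _).trans (add_le_add ?_ (hC ⟨q, rfl⟩))⟩
  rwa [IsometryEquiv.mul_apply, IsometryEquiv.dist_eq]

theorem exists_smul_eq_one_and_dist_le (h : ActsCoboundedly Γ) :
    ∃ R : ℝ, ∀ (x y : X) (q : (X ≃ᵢ X) ⧸ Γ),
      ∃ k : X ≃ᵢ X, k • q = ((1 : X ≃ᵢ X) : (X ≃ᵢ X) ⧸ Γ) ∧ dist (k x) y ≤ R := by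
  obtain ⟨R, hR⟩ := h
  refine ⟨R, fun x y q => ?_⟩
  obtain ⟨g, rfl⟩ := QuotientGroup.mk_surjective q
  obtain ⟨c, hc, hcx⟩ := hR (g⁻¹ x) y
  refine ⟨c * g⁻¹, ?_, hcx⟩
  rw [MulAction.Quotient.smul_coe, smul_eq_mul, inv_mul_cancel_right]
  exact QuotientGroup.eq.2 (by simpa only [mul_one] using Γ.inv_mem hc)

end ActsCoboundedly

theorem ActsGeometrically.actsCoboundedly (h : ActsGeometrically Γ) : ActsCoboundedly Γ := by
  obtain ⟨-, K, hK, hΓ⟩ := h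
  obtain ⟨R, hR⟩ := Metric.isBounded_iff.1 hK.isBounded
  refine ⟨R, fun x y => ?_⟩
  obtain ⟨g, hg, hgx⟩ := hΓ x
  obtain ⟨k, hk, hky⟩ := hΓ y
  refine ⟨k⁻¹ * g, Γ.mul_mem (Γ.inv_mem hk) hg, ?_⟩
  rw [← k.dist_eq, IsometryEquiv.mul_apply, IsometryEquiv.apply_inv_self]
  exact hR hgx hky

theorem isOpen_image_mk_setOf_dist_lt (Γ : Subgroup (X ≃ᵢ X)) (x₀ : X) (r : ℝ) :
    IsOpen ((QuotientGroup.mk : (X ≃ᵢ X) → (X ≃ᵢ X) ⧸ Γ) '' {g | dist (g x₀) x₀ < r}) := by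
  have continuous_apply (y : X) : Continuous fun g : X ≃ᵢ X => g y :=
    (continuous_apply y).comp continuous_induced_dom
  have isOpen : IsOpen (⋃ c ∈ Γ, {g : X ≃ᵢ X | dist (g (c x₀)) x₀ < r}) :=
    isOpen_biUnion fun c _ => isOpen_lt ((continuous_apply _).dist continuous_const)
      continuous_const
  refine isOpen_coinduced.2 ?_
  convert isOpen using 1
  ext g
  simp only [Set.mem_preimage, Set.mem_image, Set.mem_ofPred_eq, Set.mem_iUnion, exists_prop]
  constructor
  · rintro ⟨k, hk, hkg⟩
    refine ⟨g⁻¹ * k, QuotientGroup.eq.1 hkg.symm, ?_⟩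
    rwa [IsometryEquiv.mul_apply, IsometryEquiv.apply_inv_self]
  · rintro ⟨c, hc, hgc⟩
    exact ⟨g * c, hgc, QuotientGroup.mk_mul_of_mem g hc⟩

theorem actsCoboundedly_of_compactSpace [Nonempty X] [CompactSpace ((X ≃ᵢ X) ⧸ Γ)]
    (h : ActsCoboundedly (⊤ : Subgroup (X ≃ᵢ X))) : ActsCoboundedly Γ := by
  obtain ⟨R, hR⟩ := h
  obtain ⟨x₀⟩ := ‹Nonempty X›
  obtain ⟨N, hN⟩ := isCompact_univ.elim_directed_cover _
    (fun n : ℕ => isOpen_image_mk_setOf_dist_lt Γ x₀ n)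
    (fun q _ => by
      obtain ⟨g, rfl⟩ := QuotientGroup.mk_surjective q
      obtain ⟨n, hn⟩ := exists_nat_gt (dist (g x₀) x₀)
      exact Set.mem_iUnion.2 ⟨n, g, hn, rfl⟩)
    (Monotone.directed_le fun m n hmn => Set.image_mono fun g (hg : dist (g x₀) x₀ < m) =>
      hg.trans_le (Nat.cast_le.2 hmn))
  refine .of_dist_le (x₀ := x₀) (R := R + N) fun x => ?_
  obtain ⟨g, -, hg⟩ := hR x x₀
  obtain ⟨k, hk, hkg⟩ := hN (Set.mem_univ (g : (X ≃ᵢ X) ⧸ Γ))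
  refine ⟨k⁻¹ * g, QuotientGroup.eq.1 hkg,
    (dist_triangle _ (k⁻¹ x₀) _).trans (add_le_add ?_ (le_of_lt ?_))⟩
  · rwa [IsometryEquiv.mul_apply, IsometryEquiv.dist_eq]
  · rwa [← k.dist_eq, IsometryEquiv.apply_inv_self, dist_comm]

theorem exists_finset_forall_dist_lt_imp_eq_one [DiscreteTopology Γ] :
    ∃ (F : Finset X) (ε : ℝ), 0 < ε ∧ ∀ g ∈ Γ, (∀ y ∈ F, dist (g y) y < ε) → g = 1 := by
  obtain ⟨O, hO, hO₁⟩ := isOpen_induced_iff.1 (isOpen_discrete ({1} : Set Γ))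
  obtain ⟨W, hW, rfl⟩ := isOpen_induced_iff.1 hO
  have mem_iff (g : Γ) : (fun x => g.1 x) ∈ W ↔ g = 1 := Set.ext_iff.1 hO₁ g
  obtain ⟨F, U, hU, hFU⟩ := isOpen_pi_iff.1 hW _ ((mem_iff 1).2 rfl)
  have eventually : ∀ᶠ ε in 𝓝[>] (0 : ℝ), ∀ y ∈ F, Metric.ball y ε ⊆ U y := by
    refine (Filter.eventually_all_finset F).2 fun y hy => ?_
    obtain ⟨ε, hε, hball⟩ := Metric.isOpen_iff.1 (hU y hy).1 y (hU y hy).2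
    filter_upwards [Ioo_mem_nhdsGT hε] with δ hδ
    exact (Metric.ball_subset_ball hδ.2.le).trans hball
  obtain ⟨ε, hε, ε_pos⟩ := (eventually.and self_mem_nhdsWithin).exists
  exact ⟨F, ε, ε_pos, fun g hg hgF => congrArg Subtype.val <|
    (mem_iff ⟨g, hg⟩).1 (hFU fun y hy => hε y hy (hgF y hy))⟩

theorem actsMetricallyProperly_of_discreteTopology [ProperSpace X] [DiscreteTopology Γ] :
    ActsMetricallyProperly Γ := by
  intro x r
  obtain ⟨F, ε, ε_pos, hF⟩ := exists_finset_forall_dist_lt_imp_eq_one (Γ := Γ)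
  obtain ⟨C, hC⟩ := (F.finite_toSet.image fun y => dist y x).bddAbove
  have separated (g h : Γ) (hgh : g ≠ h) :
      ε ≤ dist (fun y : F => g.1 y) (fun y : F => h.1 y) := by
    by_contra! hlt
    refine hgh (Subtype.ext (inv_mul_eq_one.1
      (hF (h.1⁻¹ * g.1) (Γ.mul_mem (Γ.inv_mem h.2) g.2) fun y hy => ?_)).symm)
    rw [← h.1.dist_eq, IsometryEquiv.mul_apply, IsometryEquiv.apply_inv_self]
    exact (dist_le_pi_dist (fun y : F => g.1 y) (fun y : F => h.1 y) ⟨y, hy⟩).trans_lt hlt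
  refine ((finite_setOf_mem_closedBall (fun (g : Γ) (y : F) => g.1 y) ε_pos separated
    (fun y : F => (y : X)) (max 0 (2 * C + r))).image Subtype.val).subset ?_
  rintro g ⟨hg, hgx⟩
  refine ⟨⟨g, hg⟩, (dist_pi_le_iff (le_max_left _ _)).2 fun y => le_max_of_le_right ?_, rfl⟩
  have dist_le : dist (y : X) x ≤ C := hC ⟨y, y.2, rfl⟩
  have triangle := dist_triangle4 (g y) (g x) x y
  rw [g.dist_eq, dist_comm x] at triangle
  change dist (g y) y ≤ _
  linarith

theorem exists_relIndex_ne_zero_forall_lt_dist [Nonempty X] [Group.ResiduallyFinite Γ]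
    (proper : ActsMetricallyProperly Γ) (cobounded : ActsCoboundedly Γ) (L : ℝ) :
    ∃ Γ₀ ≤ Γ, Γ₀.relIndex Γ ≠ 0 ∧ ∀ g ∈ Γ₀, g ≠ 1 → ∀ x, L < dist (g x) x := by
  obtain ⟨R, hR⟩ := cobounded
  obtain ⟨x₀⟩ := ‹Nonempty X›
  let S : Set Γ := {g | g ≠ 1 ∧ dist (g.1 x₀) x₀ ≤ R + L + R}
  have finite : S.Finite := ((proper x₀ (R + L + R)).preimage Subtype.val_injective.injOn).subset
    fun g hg => ⟨g.2, hg.2⟩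
  obtain ⟨N, normal, finiteIndex, notMem⟩ :=
    exists_normal_finiteIndex_forall_notMem finite (fun h => h.1 rfl)
  refine ⟨N.map Γ.subtype, Subgroup.map_subtype_le N, ?_, ?_⟩
  · rw [Subgroup.relIndex, Subgroup.subgroupOf,
      Subgroup.comap_map_eq_self_of_injective Γ.subtype_injective]
    exact finiteIndex.index_ne_zero
  rintro _ ⟨g, hg, rfl⟩ g_ne_one x
  by_contra! hle
  -- Conjugating `g` brings the point that it moves little close to `x₀`.
  obtain ⟨c, hc, hcx⟩ := hR x x₀
  let c' : Γ := ⟨c, hc⟩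
  refine notMem (c' * g * c'⁻¹) ⟨fun h => g_ne_one ?_, ?_⟩ (normal.conj_mem g hg c')
  · rw [conj_eq_one_iff.1 h, map_one]
  have dist_left : dist ((c * g.1 * c⁻¹) x₀) ((c * g.1) x) ≤ R := by
    rwa [IsometryEquiv.mul_apply, (c * g.1).dist_eq, ← c.dist_eq, IsometryEquiv.apply_inv_self,
      dist_comm]
  have dist_middle : dist ((c * g.1) x) (c x) ≤ L := by
    rwa [IsometryEquiv.mul_apply, c.dist_eq]
  exact (dist_triangle4 _ _ _ _).trans (add_le_add (add_le_add dist_left dist_middle) hcx)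

theorem ActsMetricallyProperly.relIndex_ne_zero [Nonempty X] (proper : ActsMetricallyProperly Γ)
    (cobounded : ActsCoboundedly Δ) (index : Γ.relIndex Δ ≠ 0) : Δ.relIndex Γ ≠ 0 := by
  obtain ⟨R, hR⟩ := cobounded.of_relIndex_ne_zero index
  obtain ⟨x₀⟩ := ‹Nonempty X›
  have exists_mem (γ : Γ) : ∃ d ∈ Γ ⊓ Δ, dist ((γ.1 * d) x₀) x₀ ≤ R := by
    obtain ⟨d, hd, hdx⟩ := hR x₀ (γ.1⁻¹ x₀)
    refine ⟨d, hd, ?_⟩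
    rwa [← γ.1.dist_eq, IsometryEquiv.apply_inv_self] at hdx
  choose d mem dist_le using exists_mem
  refine relIndex_ne_zero_of_finite_range (fun γ => γ.1 * d γ) ((proper x₀ R).subset ?_)
    fun γ δ h => ?_
  · rintro _ ⟨γ, rfl⟩
    exact ⟨Γ.mul_mem γ.2 (mem γ).1, dist_le γ⟩
  · have : (γ : X ≃ᵢ X)⁻¹ * δ = d γ * (d δ)⁻¹ := by
      rw [eq_mul_inv_iff_mul_eq, mul_assoc, inv_mul_eq_iff_eq_mul]
      exact h.symm
    rw [Subgroup.coe_inv, this]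
    exact Δ.mul_mem (mem γ).2 (Δ.inv_mem (mem δ).2)

end Lattices

section Fixators

namespace IdealTreeOfSpaces

open Node

open scoped Pointwise

variable {X : Type*} [MetricSpace X] {D : IdealTreeOfSpaces X}

theorem exists_mem_attachingPoints_inter_space [Nontrivial D.V] (v : D.V) :
    (D.attachingPoints ∩ D.space v).Nonempty := by
  obtain ⟨w, hw⟩ := D.isTree.preconnected.exists_adj_of_nontrivial v
  let d : D.tree.Dart := ⟨(v, w), hw⟩
  exact ⟨D.edge d 0, ⟨d, rfl⟩, D.edge_zero_mem d⟩

theorem edge_one_mem_attachingPoints (d : D.tree.Dart) : D.edge d 1 ∈ D.attachingPoints :=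
  ⟨d.symm, coe_attachingPoint_symm d⟩

theorem finite_attachingPoints_inter_closedBall [ProperSpace X] (x : X) (R : ℝ) :
    (D.attachingPoints ∩ Metric.closedBall x R).Finite := by
  refine ((D.finite_darts x R).image fun d => D.edge d 0).subset ?_
  rintro _ ⟨⟨d, rfl⟩, hd⟩
  exact ⟨d, hd, rfl⟩

variable [hD : D.IsInvariant]

theorem smul_point_ne {g : X ≃ᵢ X} (hg : ∀ x, 1 < dist (g x) x) (p : D.attachingPoints) :
    g • (point p : D.Node) ≠ point p := by
  intro h
  have apply_eq : g p = p := congrArg Subtype.val (point.inj h)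
  have := hg p
  rw [apply_eq, dist_self] at this
  exact this.not_gt one_pos

theorem smul_pair_ne {g : X ≃ᵢ X} (hg : ∀ x, 1 < dist (g x) x) {u w : D.Node}
    (huw : D.attachGraph.Adj u w) : g • ({u, w} : Set D.Node) ≠ {u, w} := by
  intro h
  rw [Set.smul_set_insert, Set.smul_set_singleton, Set.pair_eq_pair_iff] at h
  obtain v | p := u <;> obtain v' | q := w
  · exact huw
  · obtain ⟨-, h⟩ | ⟨h, -⟩ := h
    · exact smul_point_ne hg q h
    · exact nomatch h
  · obtain ⟨h, -⟩ | ⟨h, -⟩ := h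
    · exact smul_point_ne hg p h
    · exact nomatch h
  · obtain ⟨h, -⟩ | ⟨h, -⟩ := h
    · exact smul_point_ne hg p h
    obtain ⟨d, rfl, rfl⟩ := huw
    have apply_eq : g (D.edge d 0) = D.edge d 1 :=
      (congrArg Subtype.val (point.inj h)).trans (coe_attachingPoint_symm d)
    have := hg (D.edge d 0)
    rw [apply_eq, D.dist_edge] at this
    simp at this

variable [ProperSpace X]

theorem exists_finite_forall_exists_smul_mem (hco : ActsCoboundedly (⊤ : Subgroup (X ≃ᵢ X))) :
    ∃ F : Set D.Node, F.Finite ∧ ∀ u, ∃ g : X ≃ᵢ X, g • u ∈ F := by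
  obtain ⟨R, hR⟩ := hco
  obtain ⟨v₀⟩ := D.isTree.nonempty
  obtain ⟨x₀, -⟩ := D.space_nonempty v₀
  refine ⟨vertex '' {v | (D.space v ∩ Metric.closedBall x₀ R).Nonempty} ∪
    (fun d => point (D.attachingPoint d)) '' {d | D.edge d 0 ∈ Metric.closedBall x₀ R},
    ((D.finite_vertices x₀ R).image _).union ((D.finite_darts x₀ R).image _), ?_⟩
  rintro (v | p)
  · obtain ⟨x, hx⟩ := D.space_nonempty v
    obtain ⟨g, -, hg⟩ := hR x x₀
    exact ⟨g, Or.inl ⟨_, ⟨g x, hD.apply_mem_space g hx, hg⟩, rfl⟩⟩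
  · obtain ⟨g, -, hg⟩ := hR p x₀
    obtain ⟨d, hd⟩ := hD.apply_mem_attachingPoints g p.2
    exact ⟨g, Or.inr ⟨d, (congrArg (dist · x₀ ≤ R) hd).mpr hg, congrArg point (Subtype.ext hd)⟩⟩

variable [Nontrivial D.V]

theorem exists_forall_exists_attachingPoint_dist_le
    (hco : ActsCoboundedly (⊤ : Subgroup (X ≃ᵢ X))) :
    ∃ C : ℝ, ∀ v, ∀ x ∈ D.space v, ∃ p ∈ D.attachingPoints ∩ D.space v, dist x p ≤ C := by
  obtain ⟨R, hR⟩ := hco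
  obtain ⟨v₀⟩ := D.isTree.nonempty
  obtain ⟨x₀, -⟩ := D.space_nonempty v₀
  choose p hp using exists_mem_attachingPoints_inter_space (D := D)
  obtain ⟨C, hC⟩ := ((D.finite_vertices x₀ R).image fun v => dist x₀ (p v)).bddAbove
  refine ⟨R + C, fun v x hx => ?_⟩
  obtain ⟨g, -, hg⟩ := hR x x₀
  have hgx := hD.apply_mem_space g hx
  have act_inv_act : hD.act g⁻¹ (hD.act g v) = v :=
    hD.act_eq_of_mem hgx (by rwa [IsometryEquiv.inv_apply_self])
  refine ⟨g⁻¹ (p (hD.act g v)), ⟨hD.apply_mem_attachingPoints _ (hp _).1, ?_⟩, ?_⟩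
  · rw [← act_inv_act]
    simpa only [act_inv_act] using hD.apply_mem_space g⁻¹ (hp (hD.act g v)).2
  · rw [← g.dist_eq, IsometryEquiv.apply_inv_self]
    exact (dist_triangle _ x₀ _).trans (add_le_add hg (hC ⟨_, ⟨g x, hgx, hg⟩, rfl⟩))

theorem exists_finite_resolving_space (hco : ActsCoboundedly (⊤ : Subgroup (X ≃ᵢ X))) (v : D.V) :
    ∃ F : Set X, F.Finite ∧ F ⊆ D.attachingPoints ∩ D.space v ∧
      ∀ x ∈ D.space v, ∀ y ∈ D.space v, (∀ a ∈ F, dist x a = dist y a) → x = y := by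
  rcases D.space_spec v with ⟨z, hz⟩ | hsymm
  · refine ⟨∅, Set.finite_empty, Set.empty_subset _, fun x hx y hy _ => ?_⟩
    rw [hz] at hx hy
    exact hx.trans hy.symm
  · obtain ⟨C, hC⟩ := exists_forall_exists_attachingPoint_dist_le (D := D) hco
    obtain ⟨F, hF, hFA, resolving⟩ := hsymm.exists_finite_resolving
      (A := {s | s.1 ∈ D.attachingPoints}) (R := C) fun s => by
        obtain ⟨p, hp, hsp⟩ := hC v s.1 s.2
        exact ⟨⟨p, hp.2⟩, hp.1, hsp⟩
    refine ⟨Subtype.val '' F, hF.image _, ?_, fun x hx y hy h => congrArg Subtype.val <|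
      resolving ⟨x, hx⟩ ⟨y, hy⟩ fun a ha => h a ⟨a, ha, rfl⟩⟩
    rintro _ ⟨s, hs, rfl⟩
    exact ⟨hFA hs, s.2⟩

theorem exists_finite_fixing_space (hco : ActsCoboundedly (⊤ : Subgroup (X ≃ᵢ X))) (v : D.V) :
    ∃ F : Set X, F.Finite ∧ F ⊆ D.attachingPoints ∧
      ∀ g : X ≃ᵢ X, (∀ a ∈ F, g a = a) → hD.act g v = v ∧ ∀ x ∈ D.space v, g x = x := by
  obtain ⟨F, hF, hFv, resolving⟩ := exists_finite_resolving_space hco v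
  obtain ⟨p, hp⟩ := exists_mem_attachingPoints_inter_space v
  refine ⟨insert p F, hF.insert p,
    Set.insert_subset hp.1 (hFv.trans Set.inter_subset_left), fun g hg => ?_⟩
  have act_eq : hD.act g v = v :=
    hD.act_eq_of_mem hp.2 ((hg p (Set.mem_insert _ _)).symm ▸ hp.2)
  refine ⟨act_eq, fun x hx => resolving _ (act_eq ▸ hD.apply_mem_space g hx) x hx fun a ha => ?_⟩
  nth_rw 1 [← hg a (Set.mem_insert_of_mem _ ha), g.dist_eq]

theorem eq_one_of_forall_smul_eq (hco : ActsCoboundedly (⊤ : Subgroup (X ≃ᵢ X))) {g : X ≃ᵢ X}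
    (hg : ∀ u : D.Node, g • u = u) : g = 1 := by
  have apply_eq (p) (hp : p ∈ D.attachingPoints) : g p = p :=
    congrArg Subtype.val (point.inj (hg (point ⟨p, hp⟩)))
  ext x
  obtain ⟨v, hv⟩ | ⟨d, t, rfl⟩ := D.cover x
  · obtain ⟨F, -, hF, fixing⟩ := exists_finite_fixing_space hco v
    exact (fixing g fun a ha => apply_eq a (hF ha)).2 x hv
  · exact hD.apply_edge_eq_apply_edge (g' := 1) (apply_eq _ ⟨d, rfl⟩)
      (apply_eq _ (edge_one_mem_attachingPoints d)) t

theorem exists_finite_forall_mem_starFixer (hco : ActsCoboundedly (⊤ : Subgroup (X ≃ᵢ X)))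
    (u : D.Node) : ∃ F : Set X, F.Finite ∧ F ⊆ D.attachingPoints ∧
      ∀ g : X ≃ᵢ X, (∀ a ∈ F, g a = a) → g ∈ starFixer (X ≃ᵢ X) D.attachGraph u := by
  obtain v | p := u
  · obtain ⟨F, hF, hFa, fixing⟩ := exists_finite_fixing_space hco v
    refine ⟨F, hF, hFa, fun g hg => (mem_fixingSubgroup_iff _).2 ?_⟩
    obtain ⟨act_eq, apply_eq⟩ := fixing g hg
    rintro w (rfl | hw)
    · exact congrArg vertex act_eq
    · obtain w | q := w
      · exact hw.elim
      · exact congrArg point (Subtype.ext (apply_eq q hw))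
  · refine ⟨insert ↑p ((fun d => D.edge d 1) '' {d | D.edge d 0 ∈ Metric.closedBall (p : X) 0}),
      ((D.finite_darts p 0).image _).insert _, Set.insert_subset p.2 ?_,
      fun g hg => (mem_fixingSubgroup_iff _).2 ?_⟩
    · rintro _ ⟨d, -, rfl⟩
      exact edge_one_mem_attachingPoints d
    have hgp : g p = p := hg p (Set.mem_insert _ _)
    rintro w (rfl | hw)
    · exact congrArg point (Subtype.ext hgp)
    obtain w | q := w
    · exact congrArg vertex (hD.act_eq_of_mem hw (by rwa [hgp]))
    · obtain ⟨d, rfl, rfl⟩ := hw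
      refine congrArg point (Subtype.ext (hg _ (Set.mem_insert_of_mem _ ⟨d, ?_, ?_⟩)))
      · exact (dist_self _).le
      · exact (coe_attachingPoint_symm d).symm

theorem finite_orbits_starFixer {Γ : Subgroup (X ≃ᵢ X)} (hΓ : ActsCoboundedly Γ) (u : D.Node) :
    Finite (orbits (starFixer (X ≃ᵢ X) D.attachGraph u) ((X ≃ᵢ X) ⧸ Γ)) := by
  obtain ⟨F, hF, hFa, fixing⟩ := exists_finite_forall_mem_starFixer (hΓ.mono le_top) u
  obtain ⟨R, hR⟩ := hΓ.exists_smul_eq_one_and_dist_le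
  obtain ⟨v₀⟩ := D.isTree.nonempty
  obtain ⟨x₀, -⟩ := D.space_nonempty v₀
  obtain ⟨C, hC⟩ := (hF.image fun a => dist a x₀).bddAbove
  choose k smul_eq dist_le using hR x₀ x₀
  let ψ (q : (X ≃ᵢ X) ⧸ Γ) (a : F) : X := k q a
  have : Finite F := hF
  have finite_range : (Set.range ψ).Finite := by
    refine (Set.Finite.pi' fun _ : F =>
      finite_attachingPoints_inter_closedBall (D := D) x₀ (C + R)).subset ?_
    rintro _ ⟨q, rfl⟩ a
    refine ⟨hD.apply_mem_attachingPoints (k q) (hFa a.2),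
      (dist_triangle _ (k q x₀) _).trans (add_le_add ?_ (dist_le q))⟩
    rw [(k q).dist_eq]
    exact hC ⟨a, a.2, rfl⟩
  have orbit_eq (q r) (h : ψ q = ψ r) : MulAction.orbit (starFixer (X ≃ᵢ X) D.attachGraph u) q =
      MulAction.orbit (starFixer (X ≃ᵢ X) D.attachGraph u) r := by
    have mem : (k q)⁻¹ * k r ∈ starFixer (X ≃ᵢ X) D.attachGraph u := fixing _ fun a ha => by
      have : k q a = k r a := congrFun h ⟨a, ha⟩
      rw [IsometryEquiv.mul_apply, ← this, IsometryEquiv.inv_apply_self]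
    refine MulAction.orbit_eq_iff.2 ⟨⟨_, mem⟩, ?_⟩
    change ((k q)⁻¹ * k r) • r = q
    rw [mul_smul, inv_smul_eq_iff, smul_eq, smul_eq]
  refine (finite_range.image (Function.extend ψ
    (MulAction.orbit (starFixer (X ≃ᵢ X) D.attachGraph u)) fun _ => ∅)).subset ?_
  rintro _ ⟨q, rfl⟩
  exact ⟨ψ q, ⟨q, rfl⟩, Function.FactorsThrough.extend_apply (fun q r => orbit_eq q r) _ q⟩

end IdealTreeOfSpaces

end Fixators

section RankOne

variable {S T : Type*} [MetricSpace S] [MetricSpace T]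

theorem IsHyperbolicSpaceOver.of_isometryEquiv {F : Type*} [Mul F] [Star F] {re : F → ℝ} {n : ℕ}
    (h : IsHyperbolicSpaceOver re n S) (e : T ≃ᵢ S) : IsHyperbolicSpaceOver re n T := by
  obtain ⟨c, f, hc, hf, range_eq, hd⟩ := h
  refine ⟨c, f ∘ e, hc, hf.comp e.injective, ?_, fun s t => ?_⟩
  · rw [e.surjective.range_comp, range_eq]
  · rw [← e.dist_eq]
    exact hd _ _

theorem IsRankOneSymmetricSpace.of_isometryEquiv (h : IsRankOneSymmetricSpace S) (e : T ≃ᵢ S) :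
    IsRankOneSymmetricSpace T := by
  rcases h with ⟨n, hn, h⟩ | ⟨n, hn, h⟩ | ⟨n, hn, h⟩ | h
  · exact Or.inl ⟨n, hn, h.of_isometryEquiv e⟩
  · exact Or.inr (Or.inl ⟨n, hn, h.of_isometryEquiv e⟩)
  · exact Or.inr (Or.inr (Or.inl ⟨n, hn, h.of_isometryEquiv e⟩))
  · exact Or.inr (Or.inr (Or.inr (h.of_isometryEquiv e)))

end RankOne

section Commensurability

namespace IdealTreeOfSpaces

variable {X : Type*} [MetricSpace X]

theorem space_eq_univ (D : IdealTreeOfSpaces X) [Subsingleton D.V] (v : D.V) :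
    D.space v = Set.univ := by
  refine Set.eq_univ_of_forall fun x => ?_
  obtain ⟨w, hw⟩ | ⟨d, -⟩ := D.cover x
  · rwa [Subsingleton.elim v w]
  · exact (d.fst_ne_snd (Subsingleton.elim _ _)).elim

theorem nontrivial_vertices [Nontrivial X] (D : IdealTreeOfSpaces X)
    (hsymm : ¬ IsRankOneSymmetricSpace X) : Nontrivial D.V := by
  by_contra h
  have := not_nontrivial_iff_subsingleton.1 h
  obtain ⟨v⟩ := D.isTree.nonempty
  obtain ⟨x, hx⟩ | hv := D.space_spec v
  · rw [D.space_eq_univ v] at hx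
    exact (Set.nontrivial_univ (α := X)).ne_singleton hx
  · rw [D.space_eq_univ v] at hv
    exact hsymm (hv.of_isometryEquiv ⟨(Equiv.Set.univ X).symm, fun _ _ => rfl⟩)

theorem branchLocus_nonempty (D : IdealTreeOfSpaces X) (hline : IsEmpty (X ≃ᵢ ℝ)) :
    (branchLocus X).Nonempty := by
  by_contra! h
  refine hline.elim (D.nonempty_isometryEquiv_real fun x => ?_).some
  exact not_not.1 (Set.eq_empty_iff_forall_notMem.1 h x)

theorem exists_relIndex_map_conj_ne_zero [ProperSpace X] {D : IdealTreeOfSpaces X}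
    [D.IsInvariant] [Nontrivial D.V] {Γ Γ' : Subgroup (X ≃ᵢ X)}
    (hΓ : ∀ g ∈ Γ, g ≠ 1 → ∀ x, 1 < dist (g x) x)
    (hΓ' : ∀ g ∈ Γ', g ≠ 1 → ∀ x, 1 < dist (g x) x) (cobounded : ActsCoboundedly Γ') :
    ∃ g : X ≃ᵢ X, Γ'.relIndex (Γ.map (MulAut.conj g).toMonoidHom) ≠ 0 := by
  have hco := cobounded.mono le_top
  refine exists_relIndex_map_conj_ne_zero_of_isTree isTree_attachGraph attachGraph_adj_smul_iff
    (fun _ => eq_one_of_forall_smul_eq hco) (exists_finite_forall_exists_smul_mem (D := D) hco)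
    (fun _ => exists_isometry_smul_eq) (fun γ hγ u w huw h => ?_) (fun γ hγ u w huw hu hw => ?_)
    (finite_orbits_starFixer cobounded)
  · by_contra γ_ne_one
    exact smul_pair_ne (hΓ γ hγ γ_ne_one) huw h
  · by_contra γ_ne_one
    refine smul_pair_ne (hΓ' γ hγ γ_ne_one) huw ?_
    rw [Set.smul_set_insert, Set.smul_set_singleton, hu, hw]

end IdealTreeOfSpaces

theorem mainTheorem6_general {X : Type*} [MetricSpace X] [ProperSpace X]
    (D : IdealTreeOfSpaces X) (cobounded : ActsCoboundedly (⊤ : Subgroup (X ≃ᵢ X)))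
    (hsymm : ¬ IsRankOneSymmetricSpace X) (hline : IsEmpty (X ≃ᵢ ℝ))
    (Γ Γ' : Subgroup (X ≃ᵢ X)) (hΓ : IsUniformLattice Γ) (hΓ' : IsUniformLattice Γ')
    (hΓrf : Group.ResiduallyFinite Γ) (hΓ'rf : Group.ResiduallyFinite Γ') :
    WeaklyCommensurable Γ Γ' := by
  obtain _ | _ := subsingleton_or_nontrivial X
  · have : Subsingleton (X ≃ᵢ X) := DFunLike.coe_injective.subsingleton
    exact ⟨1, Subgroup.index_ne_zero_of_finite, Subgroup.index_ne_zero_of_finite⟩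
  have := D.nontrivial_vertices hsymm
  have := D.isInvariant (D.branchLocus_nonempty hline)
  obtain ⟨_, _⟩ := hΓ
  obtain ⟨_, _⟩ := hΓ'
  have proper : ActsMetricallyProperly Γ := actsMetricallyProperly_of_discreteTopology
  have proper' : ActsMetricallyProperly Γ' := actsMetricallyProperly_of_discreteTopology
  have cobounded_Γ : ActsCoboundedly Γ := actsCoboundedly_of_compactSpace cobounded
  have cobounded_Γ' : ActsCoboundedly Γ' := actsCoboundedly_of_compactSpace cobounded
  obtain ⟨Γ₀, -, index, displacement⟩ :=
    exists_relIndex_ne_zero_forall_lt_dist proper cobounded_Γ 1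
  obtain ⟨Γ₀', le', index', displacement'⟩ :=
    exists_relIndex_ne_zero_forall_lt_dist proper' cobounded_Γ' 1
  have cobounded_Γ₀' := (cobounded_Γ'.of_relIndex_ne_zero index').mono inf_le_left
  obtain ⟨g, hg⟩ :=
    D.exists_relIndex_map_conj_ne_zero displacement displacement' cobounded_Γ₀'
  have index_conj : Γ'.relIndex (Γ.map (MulAut.conj g).toMonoidHom) ≠ 0 :=
    Subgroup.relIndex_ne_zero_trans
      (ne_zero_of_dvd_ne_zero hg (Subgroup.relIndex_dvd_of_le_left _ le'))
      (by rwa [Subgroup.relIndex_map_map_of_injective _ _ (MulAut.conj g).injective])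
  exact ⟨g, proper'.relIndex_ne_zero (cobounded_Γ.map_conj g) index_conj, index_conj⟩

end Commensurability

theorem mainTheorem6 {X : Type*} [MetricSpace X] (hX : IsIdealModelGeometry X)
    (hsymm : ¬ IsRankOneSymmetricSpace X) (hline : IsEmpty (X ≃ᵢ ℝ))
    (Γ Γ' : Subgroup (X ≃ᵢ X)) (hΓ : IsUniformLattice Γ) (hΓ' : IsUniformLattice Γ')
    (hΓrf : Group.ResiduallyFinite Γ) (hΓ'rf : Group.ResiduallyFinite Γ') :
    WeaklyCommensurable Γ Γ' := by
  obtain ⟨_, -, D, π, hπ, -, -⟩ := hX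
  exact mainTheorem6_general D (hπ.actsCoboundedly.mono le_top) hsymm hline Γ Γ' hΓ hΓ' hΓrf hΓ'rf
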